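/- **Existence of a minimizer.** Let $\lambda>0$, $\mathcal X=\mathbb R^d$, let $\mathcal Y\subset\mathbb R^d$ be compact, and let $v:\mathbb R^d\times\mathbb R^m\to\mathbb R^d$ be continuous. Let $\ell:\mathcal X\times\mathcal Y\to[0,\infty)$ be lower semicontinuous (for instance continuous) with $\ell(x,y)\le A+B|x|^2$ for some constants $A,B>0$, and let $\mu_0$ be a compactly supported Borel probability measure on $\mathcal X\times\mathcal Y$. Assume that there are $C>0$ and $p\in[0,2)$ such that $$|v(x,\theta)|\le C|\theta|^p(1+|x|),\qquad |v(x^1,\theta)-v(x^2,\theta)|\le C|\theta|^p|x^1-x^2|$$ for all $x,x^1,x^2\in\mathbb R^d$ and $\theta\in\mathbb R^m$ (Euclidean norms, $|\theta|^0=1$). Let $\mathcal P_2(\mathbb R^m)$ be the space of Borel probability measures on $\mathbb R^m$ with finite second moment, with the Wasserstein distance $W_2$, and let $L^2(0,1;\mathcal P_2(\mathbb R^m))$ be the space of Lebesgue measurable maps $\eta:[0,1]\to\mathcal P_2(\mathbb R^m)$ with $\int_0^1W_2(\eta_t,\bar\eta)^2\,dt<\infty$ for some $\bar\eta\in\mathcal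 P_2(\mathbb R^m)$, modulo equality almost everywhere. For such $\eta$ put $v_{\eta_t}(x)=\int_{\mathbb R^m}v(x,\theta)\,d\eta_t(\theta)$. Then for every $\eta\in L^2(0,1;\mathcal P_2(\mathbb R^m))$ there is exactly one narrowly continuous curve $\mu^\eta:[0,1]\to\mathcal P(\mathcal X\times\mathcal Y)$ with $\int_0^1\int|v_{\eta_t}(x)|\,d\mu^\eta_t\,dt<\infty$ that solves $$\partial_t\mu^\eta_t+\operatorname{div}_x\bigl(\mu^\eta_t\,v_{\eta_t}\bigr)=0\ \text{ on }(0,1)\times\mathcal X\times\mathcal Y,\qquad \mu^\eta_0=\mu_0,$$ in the sense of distributions, i.e. $\mu^\eta_0=\mu_0$ and $$\int_0^1\int_{\mathcal X\times\mathcal Y}\bigl(\partial_t\phi+\nabla_x\phi\cdot v_{\eta_t}(x)\bigr)\,d\mu^\eta_t(x,y)\,dt=0\quad\text{for all }\phi\in C_c^\infty((0,1)\times\mathbb R^d\times\mathbb R^d).$$ The functional $$J(\eta)=\int_{\mathcal X\times\mathcal Y}\ell\,d\mu^\eta_1+\frac\lambda2\int_0^1\int_{\mathbb R^m}|\theta|^2\,d\eta_t(\theta)\,dt$$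 is therefore well defined, it is finite on $L^2(0,1;\mathcal P_2(\mathbb R^m))$, and it has a minimizer: there is $\eta^*\in L^2(0,1;\mathcal P_2(\mathbb R^m))$ with $J(\eta^*)\le J(\eta)$ for all $\eta\in L^2(0,1;\mathcal P_2(\mathbb R^m))$. -/

import Mathlib

open MeasureTheory Set
open scoped ENNReal NNReal ContDiff unitInterval

noncomputable section

namespace MeanFieldNet

/-- `ℝⁿ` with the Euclidean norm. -/
abbrev E (n : ℕ) : Type := EuclideanSpace ℝ (Fin n)

/-! ### The Wasserstein space -/

/-- `𝒫₂(ℝᵐ)`: Borel probability measures on `ℝᵐ` with finite second moment. -/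
structure P2 (m : ℕ) where
  law : ProbabilityMeasure (E m)
  moment_lt_top : ∫⁻ θ, ‖θ‖ₑ ^ 2 ∂(law : Measure (E m)) < ⊤

/-- The underlying measure of an element of `𝒫₂(ℝᵐ)`. -/
def P2.meas {m : ℕ} (ν : P2 m) : Measure (E m) := (ν.law : Measure (E m))

/-- Transport plans between `ν₀` and `ν₁`. -/
def transportPlans {m : ℕ} (ν₀ ν₁ : P2 m) : Set (Measure (E m × E m)) :=
  {π | π.map Prod.fst = ν₀.meas ∧ π.map Prod.snd = ν₁.meas}

/-- The Wasserstein distance `W₂`. -/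
def W2 {m : ℕ} (ν₀ ν₁ : P2 m) : ℝ≥0∞ :=
  (⨅ π ∈ transportPlans ν₀ ν₁, ∫⁻ z, edist z.1 z.2 ^ 2 ∂π) ^ (1 / 2 : ℝ)

/-- The topology of `𝒫₂(ℝᵐ)` given by `W₂`: a set is open when it contains a `W₂`-ball around
each of its points. -/
instance {m : ℕ} : TopologicalSpace (P2 m) where
  IsOpen U := ∀ ν ∈ U, ∃ ε : ℝ≥0∞, 0 < ε ∧ ∀ ν', W2 ν ν' < ε → ν' ∈ U
  isOpen_univ := fun _ _ => ⟨1, one_pos, fun _ _ => mem_univ _⟩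
  isOpen_inter := by
    intro U V hU hV ν hν
    obtain ⟨ε, hε, h⟩ := hU ν hν.1
    obtain ⟨δ, hδ, k⟩ := hV ν hν.2
    exact ⟨min ε δ, lt_min hε hδ, fun ν' h' =>
      ⟨h ν' (h'.trans_le (min_le_left _ _)), k ν' (h'.trans_le (min_le_right _ _))⟩⟩
  isOpen_sUnion := by
    intro S hS ν hν
    obtain ⟨U, hU, hνU⟩ := hν
    obtain ⟨ε, hε, h⟩ := hS U hU ν hνU
    exact ⟨ε, hε, fun ν' h' => ⟨U, hU, h ν' h'⟩⟩

/-- The Borel `σ`-algebra of `(𝒫₂(ℝᵐ), W₂)`. -/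
instance {m : ℕ} : MeasurableSpace (P2 m) := borel (P2 m)

/-! ### The space `L²(0,1;𝒫₂(ℝᵐ))` -/

/-- `ℒ²(0,1;𝒫₂(ℝᵐ))`: maps `u : [0,1] → 𝒫₂(ℝᵐ)` which are Lebesgue measurable (preimages of
Borel sets are Lebesgue measurable) and satisfy `∫₀¹ W₂(u_t, ū)² dt < ⊤` for some `ū`. -/
structure PreL2P2 (m : ℕ) where
  toFun : I → P2 m
  measurable : NullMeasurable toFun (volume : Measure I)
  sq_integrable : ∃ ν : P2 m, ∫⁻ t : I, W2 (toFun t) ν ^ 2 < ⊤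

/-- Equality for almost every `t ∈ [0,1]`. -/
instance PreL2P2.setoid (m : ℕ) : Setoid (PreL2P2 m) where
  r u w := u.toFun =ᵐ[volume] w.toFun
  iseqv := ⟨fun _ => Filter.EventuallyEq.rfl, fun h => h.symm, fun h k => h.trans k⟩

/-- `L²(0,1;𝒫₂(ℝᵐ))`, the quotient of `ℒ²(0,1;𝒫₂(ℝᵐ))` by equality almost everywhere. -/
def L2P2 (m : ℕ) : Type := Quotient (PreL2P2.setoid m)

/-! ### The continuity equation -/

variable {d m : ℕ} {Y : Set (E d)}

/-- The averaged velocity field `v_ν(x) = ∫ v(x,θ) dν(θ)`. -/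
def avgField (v : E d → E m → E d) (ν : P2 m) (x : E d) : E d :=
  ∫ θ, v x θ ∂ν.meas

/-- The narrowly continuous curve `μ : [0,1] → 𝒫(ℝᵈ × Y)` is a distributional solution of
`∂ₜμ_t + div_x (μ_t v_{u_t}) = 0` on `(0,1)` with initial value `μ₀`. Test functions on
`(0,1) × ℝᵈ × Y` are restrictions of functions of class `C_c^∞((0,1) × ℝᵈ × ℝᵈ)`. -/
structure IsSolution (v : E d → E m → E d) (μ₀ : ProbabilityMeasure (E d × Y))
    (u : PreL2P2 m) (μ : C(I, ProbabilityMeasure (E d × Y))) : Prop where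
  initial : μ 0 = μ₀
  field_integrable :
    ∫⁻ t : I, ∫⁻ z, ‖avgField v (u.toFun t) z.1‖ₑ ∂(μ t : Measure (E d × Y)) < ⊤
  weak : ∀ φ : ℝ × E d × E d → ℝ, ContDiff ℝ ∞ φ → HasCompactSupport φ →
    tsupport φ ⊆ Ioo (0 : ℝ) 1 ×ˢ univ →
    ∫ t : I, ∫ z : E d × Y,
      (fderiv ℝ φ ((t : ℝ), z.1, (z.2 : E d)) (1, 0, 0)
        + fderiv ℝ φ ((t : ℝ), z.1, (z.2 : E d)) (0, avgField v (u.toFun t) z.1, 0))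
      ∂(μ t : Measure (E d × Y)) = 0

open Classical in
/-- The solution `μ^u` of the continuity equation (the constant curve `μ₀` if there is none). -/
def solution (v : E d → E m → E d) (μ₀ : ProbabilityMeasure (E d × Y)) (u : PreL2P2 m) :
    C(I, ProbabilityMeasure (E d × Y)) :=
  if h : ∃ μ, IsSolution v μ₀ u μ then h.choose else ContinuousMap.const I μ₀

/-! ### The regularized loss -/

/-- `J(u) = ∫ ℓ dμ^u₁ + (λ/2) ∫₀¹ ∫ |θ|² du_t(θ) dt`, with values in `[0,∞]`, on
representatives. -/
def preJ (lam : ℝ) (v : E d → E m → E d) (l : E d × Y → ℝ≥0)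
    (μ₀ : ProbabilityMeasure (E d × Y)) (u : PreL2P2 m) : ℝ≥0∞ :=
  (∫⁻ z, (l z : ℝ≥0∞) ∂(solution v μ₀ u 1 : Measure (E d × Y)))
    + ENNReal.ofReal (lam / 2) * (∫⁻ t : I, ∫⁻ θ, ‖θ‖ₑ ^ 2 ∂(u.toFun t).meas)

theorem IsSolution.congr {v : E d → E m → E d} {μ₀ : ProbabilityMeasure (E d × Y)}
    {u w : PreL2P2 m} (h : u.toFun =ᵐ[volume] w.toFun)
    {μ : C(I, ProbabilityMeasure (E d × Y))} (hu : IsSolution v μ₀ u μ) :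
    IsSolution v μ₀ w μ where
  initial := hu.initial
  field_integrable := by
    rw [lintegral_congr_ae (g := fun t : I => ∫⁻ z, ‖avgField v (u.toFun t) z.1‖ₑ
      ∂(μ t : Measure (E d × Y)))]
    · exact hu.field_integrable
    · filter_upwards [h] with t ht
      rw [ht]
  weak := by
    intro φ h1 h2 h3
    refine Eq.trans (integral_congr_ae ?_) (hu.weak φ h1 h2 h3)
    filter_upwards [h] with t ht
    rw [ht]

theorem preJ_congr (lam : ℝ) (v : E d → E m → E d) (l : E d × Y → ℝ≥0)
    (μ₀ : ProbabilityMeasure (E d × Y)) {u w : PreL2P2 m}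
    (h : u.toFun =ᵐ[volume] w.toFun) : preJ lam v l μ₀ u = preJ lam v l μ₀ w := by
  have hs : solution v μ₀ u = solution v μ₀ w := by
    have : IsSolution v μ₀ u = IsSolution v μ₀ w := by
      funext μ
      exact propext ⟨fun k => k.congr h, fun k => k.congr h.symm⟩
    unfold solution
    by_cases hex : ∃ μ, IsSolution v μ₀ u μ
    · have hex' : ∃ μ, IsSolution v μ₀ w μ := this ▸ hex
      rw [dif_pos hex, dif_pos hex']
      congr
    · have hex' : ¬ ∃ μ, IsSolution v μ₀ w μ := this ▸ hex
      rw [dif_neg hex, dif_neg hex']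
  have hi : ∫⁻ t : I, ∫⁻ θ, ‖θ‖ₑ ^ 2 ∂(u.toFun t).meas
      = ∫⁻ t : I, ∫⁻ θ, ‖θ‖ₑ ^ 2 ∂(w.toFun t).meas := by
    apply lintegral_congr_ae
    filter_upwards [h] with t ht
    rw [ht]
  unfold preJ
  rw [hs, hi]

/-- The functional `J` on `L²(0,1;𝒫₂(ℝᵐ))`. -/
def J (lam : ℝ) (v : E d → E m → E d) (l : E d × Y → ℝ≥0)
    (μ₀ : ProbabilityMeasure (E d × Y)) (η : L2P2 m) : ℝ≥0∞ :=
  Quotient.lift (preJ lam v l μ₀) (fun _ _ h => preJ_congr lam v l μ₀ h) η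

end MeanFieldNet

end

/-! Maps into the Wasserstein space are traded for Markov kernels from `[0,1]` to `ℝᵐ` with finite
energy, called controls; `PreL2P2.exists_isControl` and `IsControl.exists_preL2P2` translate in both
directions. Since `|θ|^p ≤ 1 + |θ|²`, the velocity averaged with a control is Lipschitz and of
linear growth in `x`, with constants integrable in time, so it has a flow in the sense of
Carathéodory.

Well-posedness. The image of `μ₀` under the flow is a solution, by the chain rule along trajectories
(`isSolution_flowCurve`). Conversely, every solution is this image (`IsField.eq_map_flow`). For a
Lipschitz function `ψ` of compact support, `Φ s z = ψ (flow s z T)` is constant along the flow, and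
by duality `s ↦ ∫ Φ s dμ_s` should be constant. As `Φ s` is only Lipschitz it is mollified in space.
Over a short time interval the integral then changes by a term proportional to the mollification
radius, plus an error that is a product of two integrals over the interval. The second error
disappears when summed over fine partitions, the first when the radius tends to zero.

Minimizer. By uniqueness, `J` depends on the control only through the flow map at time 1 and the
energy (`preJ_eq`), and the direct method applies. A minimizing sequence has bounded energy because
`λ > 0`. The joint laws of time and parameter on `[0,1] × ℝᵐ` are therefore tight, and a weak limit
keeps Lebesgue measure as first marginal, hence disintegrates into a control
(`exists_subseq_tendsto_joint`). The energy is lower semicontinuous. Because `p < 2`, a bound on the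
energy makes `|θ|^p` uniformly integrable, so the fields integrated over `[0,r]` along the limit
trajectory converge, uniformly in `r`. A Gronwall estimate that needs no more than this gives
convergence of the flows (`tendsto_flow`), and lower semicontinuity of `ℓ` with Fatou's lemma
handles the terminal cost. -/

set_option linter.unusedSectionVars false

/-! ### Absolutely continuous chain rule and Gronwall's inequality -/

namespace Caratheodory

open Filter Topology intervalIntegral

variable {F : Type*} [NormedAddCommGroup F] [NormedSpace ℝ F] [FiniteDimensional ℝ F]
  [MeasurableSpace F] [BorelSpace F]

/-- The chain rule along a primitive of an integrable function, in integrated form. -/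
theorem integral_fderiv_comp_primitive {g : ℝ → F} {a b : ℝ} (hg : IntervalIntegrable g volume a b)
    (c : F) {φ : F → ℝ} (hφ : ContDiff ℝ 1 φ) :
    ∫ t in a..b, fderiv ℝ φ (c + ∫ r in a..t, g r) (g t) = φ (c + ∫ r in a..b, g r) - φ c := by
  set γ : ℝ → F := fun t => c + ∫ r in a..t, g r with hγ
  have hac : AbsolutelyContinuousOnInterval (fun t => ∫ r in a..t, ‖g r‖) a b :=
    hg.norm.absolutelyContinuousOnInterval_intervalIntegral (by simp)
  have hγc : ContinuousOn γ (uIcc a b) := continuousOn_const.add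
    (continuousOn_primitive_interval' hg left_mem_uIcc)
  -- Increments of `γ` are dominated by those of the real primitive of `‖g‖`. Composed with the
  -- Lipschitz bound for `φ` on a ball containing the curve, this transfers absolute continuity to
  -- `φ ∘ γ`.
  have hd : ∀ x ∈ uIcc a b, ∀ y ∈ uIcc a b,
      dist (γ x) (γ y) ≤ dist (∫ r in a..x, ‖g r‖) (∫ r in a..y, ‖g r‖) := by
    intro x hx y hy
    have h1 := hg.mono_set (uIcc_subset_uIcc_left hx)
    have h2 := hg.mono_set (uIcc_subset_uIcc_left hy)
    rw [dist_eq_norm, Real.dist_eq, integral_interval_sub_left h1.norm h2.norm, hγ]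
    simp only [add_sub_add_left_eq_sub]
    rw [integral_interval_sub_left h1 h2]
    exact norm_integral_le_abs_integral_norm
  obtain ⟨R, hR⟩ := isCompact_uIcc.exists_bound_of_continuousOn hγc
  have hmem : ∀ t ∈ uIcc a b, γ t ∈ Metric.closedBall (0 : F) R := fun t ht => by
    simpa using hR t ht
  obtain ⟨K, hKl⟩ := hφ.contDiffOn.exists_lipschitzOnWith (n := 1) (by norm_num)
    (convex_closedBall (0 : F) R) (isCompact_closedBall 0 R)
  have hφγ : AbsolutelyContinuousOnInterval (φ ∘ γ) a b := by
    rw [absolutelyContinuousOnInterval_iff] at hac ⊢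
    intro ε hε
    -- `K + 1` avoids a division by zero when `K = 0`.
    obtain ⟨δ, hδ, h⟩ := hac (ε / (K + 1)) (by positivity)
    refine ⟨δ, hδ, fun E hE hEδ => ?_⟩
    have h1 := h E hE hEδ
    have h2 : ∑ i ∈ Finset.range E.1, dist ((φ ∘ γ) (E.2 i).1) ((φ ∘ γ) (E.2 i).2)
        ≤ K * ∑ i ∈ Finset.range E.1,
          dist (∫ r in a..(E.2 i).1, ‖g r‖) (∫ r in a..(E.2 i).2, ‖g r‖) := by
      rw [Finset.mul_sum]
      refine Finset.sum_le_sum fun i hi => ?_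
      have := hKl.dist_le_mul _ (hmem _ (hE.1 i hi).1) _ (hmem _ (hE.1 i hi).2)
      exact this.trans (mul_le_mul_of_nonneg_left (hd _ (hE.1 i hi).1 _ (hE.1 i hi).2) K.2)
    have h0 : 0 ≤ ∑ i ∈ Finset.range E.1,
        dist (∫ r in a..(E.2 i).1, ‖g r‖) (∫ r in a..(E.2 i).2, ‖g r‖) :=
      Finset.sum_nonneg fun _ _ => dist_nonneg
    rw [lt_div_iff₀ (by positivity)] at h1
    nlinarith
  have := hφγ.integral_deriv_eq_sub
  have h0 : γ a = c := by simp [hγ]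
  simp only [Function.comp, h0] at this
  rw [show φ (c + ∫ r in a..b, g r) = φ (γ b) from rfl, ← this]
  refine integral_congr_ae ?_
  filter_upwards [hg.ae_hasDerivAt_integral] with t ht htm
  have h1 := (ht (uIoc_subset_uIcc htm) a (by simp)).const_add c
  have h2 := (hφ.differentiable (by norm_num) (γ t)).hasFDerivAt.comp_hasDerivAt t h1
  exact h2.deriv.symm

/-- The weight `exp (2 |∫ₛᵗ L|)`. -/
noncomputable def weight (L : ℝ → ℝ) (s t : ℝ) : ℝ := Real.exp (2 * |∫ r in s..t, L r|)

theorem one_le_weight (L : ℝ → ℝ) (s t : ℝ) : 1 ≤ weight L s t :=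
  Real.one_le_exp (by positivity)

theorem weight_pos (L : ℝ → ℝ) (s t : ℝ) : 0 < weight L s t := Real.exp_pos _

theorem continuous_weight {L : ℝ → ℝ} (hL : Integrable L) (s : ℝ) : Continuous (weight L s) := by
  unfold weight
  have := continuous_primitive (fun a b => hL.intervalIntegrable) s (f := L)
  fun_prop

theorem weight_le {L : ℝ → ℝ} (hL : Integrable L) (h0 : ∀ t, 0 ≤ L t) (s t : ℝ) :
    weight L s t ≤ Real.exp (2 * ∫ r, L r) := by
  refine Real.exp_le_exp.2 (mul_le_mul_of_nonneg_left ?_ (by norm_num))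
  rw [← Real.norm_eq_abs]
  refine norm_integral_le_integral_norm_uIoc.trans ?_
  simp_rw [Real.norm_of_nonneg (h0 _)]
  exact setIntegral_le_integral hL (Eventually.of_forall h0)

/-- The derivative of `exp (k ∫ₛʳ L)` is `k L` times itself; take `k = 2` forwards and `k = -2`
backwards in time. The factor `1/2` is what makes the Picard map a contraction and lets the Gronwall
argument absorb its integral term. -/
theorem abs_integral_mul_weight_le {L : ℝ → ℝ} (hL : Integrable L) (h0 : ∀ t, 0 ≤ L t) (s t : ℝ) :
    |∫ r in s..t, L r * weight L s r| ≤ weight L s t / 2 := by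
  have key : ∀ k : ℝ, ∫ r in s..t, Real.exp (k * ∫ q in s..r, L q) * (k * L r)
      = Real.exp (k * ∫ q in s..t, L q) - 1 := by
    intro k
    have := integral_fderiv_comp_primitive (a := s) (b := t) hL.intervalIntegrable 0
      (φ := fun z => Real.exp (k * z)) (by fun_prop)
    simp only [zero_add, mul_zero, Real.exp_zero] at this
    rw [← this]
    refine integral_congr fun r _ => ?_
    have hd : HasDerivAt (fun z => Real.exp (k * z)) (Real.exp (k * ∫ q in s..r, L q) * k)
        (∫ q in s..r, L q) := by
      simpa using ((hasDerivAt_id (∫ q in s..r, L q)).const_mul k).exp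
    simp [hd.hasFDerivAt.fderiv]
    ring
  rcases le_total s t with h | h
  · have e : ∫ r in s..t, L r * weight L s r
        = (1 / 2) * ∫ r in s..t, Real.exp (2 * ∫ q in s..r, L q) * (2 * L r) := by
      rw [← intervalIntegral.integral_const_mul]
      refine integral_congr fun r hr => ?_
      rw [uIcc_of_le h] at hr
      simp only [weight]
      rw [abs_of_nonneg (integral_nonneg hr.1 fun _ _ => h0 _)]
      ring
    rw [e, key, weight, abs_of_nonneg (integral_nonneg h fun _ _ => h0 _)]
    have : 1 ≤ Real.exp (2 * ∫ q in s..t, L q) :=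
      Real.one_le_exp (mul_nonneg (by norm_num) (integral_nonneg h fun _ _ => h0 _))
    rw [abs_of_nonneg (by linarith)]
    linarith
  · have np : ∀ r ≤ s, ∫ q in s..r, L q ≤ 0 := fun r hr => by
      rw [integral_symm]; linarith [integral_nonneg hr (fun u _ => h0 u) (μ := volume)]
    have e : ∫ r in s..t, L r * weight L s r
        = (-1 / 2) * ∫ r in s..t, Real.exp (-2 * ∫ q in s..r, L q) * (-2 * L r) := by
      rw [← intervalIntegral.integral_const_mul]
      refine integral_congr fun r hr => ?_
      rw [uIcc_of_ge h] at hr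
      simp only [weight]
      rw [abs_of_nonpos (np r hr.2)]
      ring_nf
    rw [e, key, weight, abs_of_nonpos (np t h)]
    have : 1 ≤ Real.exp (-2 * ∫ q in s..t, L q) :=
      Real.one_le_exp (mul_nonneg_of_nonpos_of_nonpos (by norm_num) (np t h))
    rw [abs_of_nonpos (by linarith)]
    rw [show 2 * -∫ q in s..t, L q = -2 * ∫ q in s..t, L q by ring]
    linarith

theorem abs_integral_mul_le_of_le {L f g : ℝ → ℝ} {s t : ℝ} (h0 : ∀ t, 0 ≤ L t)
    (hg : IntervalIntegrable (fun r => L r * g r) volume s t)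
    (hfg : ∀ r ∈ uIcc s t, |f r| ≤ g r) :
    |∫ r in s..t, L r * f r| ≤ |∫ r in s..t, L r * g r| := by
  refine norm_integral_le_abs_of_norm_le (f := fun r => L r * f r) ?_ hg
  refine (ae_restrict_iff' measurableSet_uIoc).2 (Eventually.of_forall fun r hr => ?_)
  rw [norm_mul, Real.norm_of_nonneg (h0 r)]
  exact mul_le_mul_of_nonneg_left (hfg r (uIoc_subset_uIcc hr)) (h0 r)

/-- Gronwall's inequality with an integrable kernel. -/
theorem gronwall {L f : ℝ → ℝ} (hL : Integrable L) (h0 : ∀ t, 0 ≤ L t) {a s t : ℝ}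
    (hf : ContinuousOn f (uIcc s t)) (hf0 : ∀ r, 0 ≤ f r)
    (h : ∀ r ∈ uIcc s t, f r ≤ a + |∫ q in s..r, L q * f q|) :
    f t ≤ 2 * a * weight L s t := by
  have hw := continuous_weight hL s
  -- Evaluate the hypothesis where `f / weight` attains its maximum `M`: the integral term costs at
  -- most half of `M * weight`, and is absorbed on the left.
  obtain ⟨r, hr, hmax⟩ := isCompact_uIcc.exists_isMaxOn ⟨s, left_mem_uIcc⟩
    (hf.div hw.continuousOn fun r _ => (weight_pos L s r).ne')
  set M := f r / weight L s r with hM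
  have hle : ∀ q ∈ uIcc s t, f q ≤ M * weight L s q := fun q hq => by
    have : f q / weight L s q ≤ M := hmax hq
    rwa [div_le_iff₀ (weight_pos L s q)] at this
  have hM0 : 0 ≤ M := div_nonneg (hf0 r) (weight_pos L s r).le
  have h1 : |∫ q in s..r, L q * f q| ≤ M * (weight L s r / 2) := by
    calc _ ≤ |∫ q in s..r, L q * (M * weight L s q)| := by
          refine abs_integral_mul_le_of_le h0 ?_ fun q hq => ?_
          · exact hL.intervalIntegrable.mul_continuousOn (by fun_prop)
          · rw [abs_of_nonneg (hf0 q)]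
            exact hle q (uIcc_subset_uIcc_left hr hq)
      _ = M * |∫ q in s..r, L q * weight L s q| := by
          rw [← abs_of_nonneg hM0, ← abs_mul, ← intervalIntegral.integral_const_mul,
            abs_of_nonneg hM0]
          congr 2; ext q; ring
      _ ≤ _ := mul_le_mul_of_nonneg_left (abs_integral_mul_weight_le hL h0 s r) hM0
  have h2 := h r hr
  have h3 : f r = M * weight L s r := by rw [hM, div_mul_cancel₀ _ (weight_pos L s r).ne']
  have h4 := one_le_weight L s r
  -- From `M w ≤ a + M w / 2` with `w ≥ 1`.
  have h5 : M ≤ 2 * a := by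
    by_contra hc
    push Not at hc
    nlinarith
  exact (hle t right_mem_uIcc).trans (mul_le_mul_of_nonneg_right h5 (weight_pos L s t).le)

end Caratheodory

/-! ### Flows of fields with integrable Lipschitz constants -/

namespace Caratheodory

open Filter Topology intervalIntegral

variable {F : Type*} [NormedAddCommGroup F] [NormedSpace ℝ F] [FiniteDimensional ℝ F]
  [MeasurableSpace F] [BorelSpace F]

/-- A time-dependent vector field, measurable in time, with integrable Lipschitz and linear growth
constants. -/
structure IsField (B : ℝ → F → F) (L : ℝ → ℝ) : Prop where
  measurable : ∀ x, Measurable fun t => B t x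
  integrable : Integrable L
  nonneg : ∀ t, 0 ≤ L t
  growth : ∀ t x, ‖B t x‖ ≤ L t * (1 + ‖x‖)
  lip : ∀ t x y, ‖B t x - B t y‖ ≤ L t * ‖x - y‖

namespace IsField

variable {B : ℝ → F → F} {L : ℝ → ℝ} (h : IsField B L)
include h

theorem continuous (t : ℝ) : Continuous (B t) :=
  (LipschitzWith.of_dist_le' (K := L t) fun x y => by
    simpa only [dist_eq_norm] using h.lip t x y).continuous

theorem measurable_uncurry : Measurable (Function.uncurry B) :=
  (measurable_uncurry_of_continuous_of_measurable (u := fun x t => B t x) h.continuous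
    h.measurable).comp measurable_swap

theorem measurable_comp {γ : ℝ → F} (hγ : Measurable γ) : Measurable fun t => B t (γ t) :=
  h.measurable_uncurry.comp (measurable_id.prodMk hγ)

theorem intervalIntegrable_comp {γ : ℝ → F} (hγ : Continuous γ) (a b : ℝ) :
    IntervalIntegrable (fun t => B t (γ t)) volume a b := by
  have hL : IntervalIntegrable (fun t => L t * (1 + ‖γ t‖)) volume a b :=
    h.integrable.intervalIntegrable.mul_continuousOn (by fun_prop)
  refine hL.mono_fun (h.measurable_comp hγ.measurable).aestronglyMeasurable ?_
  exact Eventually.of_forall fun t => (h.growth t _).trans (le_abs_self _)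

/-- The integral form of `γ' = B(t, γ)`, `γ(s) = x`. -/
def _root_.Caratheodory.IsCurve (B : ℝ → F → F) (s : ℝ) (x : F) (γ : ℝ → F) : Prop :=
  Continuous γ ∧ ∀ t, γ t = x + ∫ r in s..t, B r (γ r)

/-- Picard iteration for `ξ = γ / weight` in the bounded continuous functions on the whole line. In
this weighted norm the map contracts by `1/2`, so no gluing of short-time solutions is needed. -/
theorem exists_isCurve (s : ℝ) (x : F) : ∃ γ, IsCurve B s x γ := by
  set W := weight L s with hW
  have hWc : Continuous W := continuous_weight h.integrable s
  have hW1 : ∀ t, 1 ≤ W t := one_le_weight L s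
  have hW0 : ∀ t, 0 < W t := weight_pos L s
  set M := Real.exp (2 * ∫ r, L r)
  have hWM : ∀ t, W t ≤ M := weight_le h.integrable h.nonneg s
  have hii : ∀ (ξ : BoundedContinuousFunction ℝ F) (a b : ℝ),
      IntervalIntegrable (fun r => B r (W r • ξ r)) volume a b := fun ξ a b =>
    h.intervalIntegrable_comp (hWc.smul ξ.continuous) a b
  let T : BoundedContinuousFunction ℝ F → BoundedContinuousFunction ℝ F := fun ξ =>
    BoundedContinuousFunction.ofNormedAddCommGroup
      (fun t => (W t)⁻¹ • (x + ∫ r in s..t, B r (W r • ξ r)))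
      ((hWc.inv₀ fun t => (hW0 t).ne').smul (continuous_const.add (continuous_primitive (hii ξ) s)))
      -- Integrability of `L` on all of `ℝ` bounds the weight by `M` and keeps the image of `T`
      -- bounded.
      (‖x‖ + (∫ r, L r) * (1 + M * ‖ξ‖)) (by
        intro t
        rw [norm_smul, norm_inv, Real.norm_of_nonneg (hW0 t).le]
        have h1 : ‖∫ r in s..t, B r (W r • ξ r)‖ ≤ (∫ r, L r) * (1 + M * ‖ξ‖) := by
          refine norm_integral_le_integral_norm_uIoc.trans ?_
          rw [← MeasureTheory.integral_mul_const]
          refine le_trans (setIntegral_mono_on (hii ξ s t).norm.def'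
            (h.integrable.mul_const (1 + M * ‖ξ‖)).integrableOn measurableSet_uIoc fun r _ => ?_)
            (setIntegral_le_integral (h.integrable.mul_const _) (Eventually.of_forall fun r => ?_))
          · refine (h.growth r _).trans (mul_le_mul_of_nonneg_left ?_ (h.nonneg r))
            rw [norm_smul, Real.norm_of_nonneg (hW0 r).le]
            gcongr
            · exact hWM r
            · exact ξ.norm_coe_le_norm r
          · have := h.nonneg r
            have : 0 < M := Real.exp_pos _
            show 0 ≤ L r * _
            positivity
        have h2 : (W t)⁻¹ ≤ 1 := inv_le_one_of_one_le₀ (hW1 t)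
        have h3 := norm_add_le x (∫ r in s..t, B r (W r • ξ r))
        have h4 := inv_pos.2 (hW0 t)
        nlinarith [norm_nonneg (x + ∫ r in s..t, B r (W r • ξ r))])
  have hT : ContractingWith (1 / 2) T := by
    refine ⟨by norm_num, LipschitzWith.of_dist_le_mul fun ξ η => ?_⟩
    refine (BoundedContinuousFunction.dist_le (by positivity)).2 fun t => ?_
    show dist ((W t)⁻¹ • (x + ∫ r in s..t, B r (W r • ξ r)))
      ((W t)⁻¹ • (x + ∫ r in s..t, B r (W r • η r))) ≤ _
    rw [dist_smul₀, dist_add_left, dist_eq_norm, ← intervalIntegral.integral_sub (hii ξ s t) (hii η s t),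
      norm_inv, Real.norm_of_nonneg (hW0 t).le, inv_mul_le_iff₀ (hW0 t)]
    calc _ ≤ |∫ r in s..t, L r * W r * dist ξ η| := by
          refine norm_integral_le_abs_of_norm_le (Eventually.of_forall fun r => ?_) ?_
          · refine (h.lip r _ _).trans ?_
            rw [mul_assoc, ← smul_sub, norm_smul, Real.norm_of_nonneg (hW0 r).le, ← dist_eq_norm]
            refine mul_le_mul_of_nonneg_left (mul_le_mul_of_nonneg_left ?_ (hW0 r).le) (h.nonneg r)
            exact BoundedContinuousFunction.dist_coe_le_dist r
          · exact (h.integrable.intervalIntegrable.mul_continuousOn hWc.continuousOn).mul_const _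
      _ = |∫ r in s..t, L r * W r| * dist ξ η := by
          rw [intervalIntegral.integral_mul_const, abs_mul, abs_of_nonneg dist_nonneg]
      _ ≤ W t / 2 * dist ξ η := mul_le_mul_of_nonneg_right
          (abs_integral_mul_weight_le h.integrable h.nonneg s t) dist_nonneg
      _ = _ := by simp; ring
  set ξ := hT.fixedPoint T
  have hξ : T ξ = ξ := hT.fixedPoint_isFixedPt
  refine ⟨fun t => W t • ξ t, hWc.smul ξ.continuous, fun t => ?_⟩
  have : ξ t = (W t)⁻¹ • (x + ∫ r in s..t, B r (W r • ξ r)) := by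
    conv_lhs => rw [← hξ]
    rfl
  show W t • ξ t = _
  rw [this]
  rw [smul_smul, mul_inv_cancel₀ (hW0 t).ne', one_smul]

theorem dist_isCurve_le {s : ℝ} {x y : F} {γ η : ℝ → F} (hγ : IsCurve B s x γ)
    (hη : IsCurve B s y η) (t : ℝ) : ‖γ t - η t‖ ≤ 2 * ‖x - y‖ * weight L s t := by
  have hγc := hγ.1
  have hηc := hη.1
  refine gronwall (f := fun t => ‖γ t - η t‖) h.integrable h.nonneg (by fun_prop)
    (fun _ => norm_nonneg _) fun r _ => ?_
  rw [hγ.2 r, hη.2 r, add_sub_add_comm, ← intervalIntegral.integral_sub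
    (h.intervalIntegrable_comp hγc _ _) (h.intervalIntegrable_comp hηc _ _)]
  refine (norm_add_le _ _).trans (add_le_add_right ?_ _)
  refine norm_integral_le_abs_of_norm_le (Eventually.of_forall fun q => h.lip q _ _) ?_
  exact h.integrable.intervalIntegrable.mul_continuousOn (by fun_prop)

theorem isCurve_unique {s : ℝ} {x : F} {γ η : ℝ → F} (hγ : IsCurve B s x γ)
    (hη : IsCurve B s x η) : γ = η := by
  ext t
  have := h.dist_isCurve_le hγ hη t
  simpa [sub_eq_zero] using this

theorem growth_isCurve {s : ℝ} {x : F} {γ : ℝ → F} (hγ : IsCurve B s x γ) (t : ℝ) :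
    1 + ‖γ t‖ ≤ 2 * (1 + ‖x‖) * weight L s t := by
  have hγc := hγ.1
  refine gronwall (f := fun t => 1 + ‖γ t‖) h.integrable h.nonneg (by fun_prop)
    (fun _ => by positivity) fun r _ => ?_
  conv_lhs => rw [hγ.2 r]
  rw [add_assoc]
  refine add_le_add_right ((norm_add_le _ _).trans (add_le_add_right ?_ _)) _
  refine norm_integral_le_abs_of_norm_le (Eventually.of_forall fun q => h.growth q _) ?_
  exact h.integrable.intervalIntegrable.mul_continuousOn (by fun_prop)

/-- The flow of a field: `h.flow s x t` is the position at time `t` of the integral curve through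
`x` at time `s`. -/
noncomputable def flow (s : ℝ) (x : F) : ℝ → F := (h.exists_isCurve s x).choose

theorem isCurve_flow (s : ℝ) (x : F) : IsCurve B s x (h.flow s x) :=
  (h.exists_isCurve s x).choose_spec

theorem continuous_flow (s : ℝ) (x : F) : Continuous (h.flow s x) := (h.isCurve_flow s x).1

theorem flow_eq (s : ℝ) (x : F) (t : ℝ) :
    h.flow s x t = x + ∫ r in s..t, B r (h.flow s x r) := (h.isCurve_flow s x).2 t

theorem flow_self (s : ℝ) (x : F) : h.flow s x s = x := by rw [h.flow_eq]; simp

/-- A bound for the Lipschitz constants of the flow. -/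
noncomputable def _root_.Caratheodory.flowConst (L : ℝ → ℝ) : ℝ := 2 * Real.exp (2 * ∫ r, L r)

omit h in
theorem _root_.Caratheodory.flowConst_pos (L : ℝ → ℝ) : 0 < flowConst L := by
  unfold flowConst; positivity

theorem dist_flow_le (s t : ℝ) (x y : F) :
    ‖h.flow s x t - h.flow s y t‖ ≤ flowConst L * ‖x - y‖ := by
  refine (h.dist_isCurve_le (h.isCurve_flow s x) (h.isCurve_flow s y) t).trans ?_
  have := weight_le h.integrable h.nonneg s t
  unfold flowConst
  nlinarith [norm_nonneg (x - y)]

theorem growth_flow (s t : ℝ) (x : F) : 1 + ‖h.flow s x t‖ ≤ flowConst L * (1 + ‖x‖) := by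
  refine (h.growth_isCurve (h.isCurve_flow s x) t).trans ?_
  have := weight_le h.integrable h.nonneg s t
  unfold flowConst
  nlinarith [norm_nonneg x]

theorem flow_flow (s t : ℝ) (x : F) : h.flow t (h.flow s x t) = h.flow s x := by
  refine h.isCurve_unique (h.isCurve_flow _ _) ⟨h.continuous_flow s x, fun r => ?_⟩
  rw [h.flow_eq s x r, h.flow_eq s x t, add_assoc, integral_add_adjacent_intervals] <;>
  exact h.intervalIntegrable_comp (h.continuous_flow s x) _ _

theorem continuous_flow_right (s t : ℝ) : Continuous fun x => h.flow s x t :=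
  (LipschitzWith.of_dist_le' (K := flowConst L) fun x y => by
    simpa only [dist_eq_norm] using h.dist_flow_le s t x y).continuous

/-- The growth bound for the flow run backwards from time `t`. It shows that composition with the
flow preserves vanishing outside a ball. -/
theorem growth_le_flow (s t : ℝ) (x : F) : 1 + ‖x‖ ≤ flowConst L * (1 + ‖h.flow s x t‖) := by
  have := h.growth_flow t s (h.flow s x t)
  rwa [h.flow_flow, h.flow_self] at this

theorem norm_flow_sub_le {s t : ℝ} (hst : s ≤ t) (x : F) :
    ‖h.flow s x t - x‖ ≤ flowConst L * (1 + ‖x‖) * ∫ r in s..t, L r := by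
  rw [h.flow_eq, add_sub_cancel_left, ← intervalIntegral.integral_const_mul]
  refine norm_integral_le_of_norm_le hst (Eventually.of_forall fun r _ => ?_)
    (h.integrable.intervalIntegrable.const_mul _)
  refine (h.growth r _).trans ?_
  rw [mul_comm]
  exact mul_le_mul_of_nonneg_right (h.growth_flow s r x) (h.nonneg r)

/-- Over a short time the flow moves nearby points almost by a common translation. This controls the
commutator of mollification and flow in `eq_map_flow`. -/
theorem norm_flow_sub_flow_sub_le {s t : ℝ} (hst : s ≤ t) (x y : F) :
    ‖h.flow s x t - h.flow s y t - (x - y)‖ ≤ flowConst L * ‖x - y‖ * ∫ r in s..t, L r := by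
  rw [h.flow_eq s x t, h.flow_eq s y t, add_sub_add_comm, add_sub_cancel_left,
    ← intervalIntegral.integral_sub (h.intervalIntegrable_comp (h.continuous_flow s x) _ _)
      (h.intervalIntegrable_comp (h.continuous_flow s y) _ _),
    ← intervalIntegral.integral_const_mul]
  refine norm_integral_le_of_norm_le hst (Eventually.of_forall fun r _ => ?_)
    (h.integrable.intervalIntegrable.const_mul _)
  refine (h.lip r _ _).trans ?_
  rw [mul_comm]
  exact mul_le_mul_of_nonneg_right (h.dist_flow_le s r x y) (h.nonneg r)

/-- Two fields with integral curves from the same point: the distance of the curves is controlled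
by the defect `∫ (B - B')` along the second curve. -/
theorem dist_isCurve_le_of_defect {B' : ℝ → F → F} {L' : ℝ → ℝ} (h' : IsField B' L') {s t a : ℝ}
    {x : F} {γ γ' : ℝ → F} (hγ : IsCurve B s x γ) (hγ' : IsCurve B' s x γ')
    (ha : ∀ r ∈ uIcc s t, ‖∫ q in s..r, (B q (γ' q) - B' q (γ' q))‖ ≤ a) :
    ‖γ t - γ' t‖ ≤ flowConst L * a := by
  have hγc := hγ.1
  have hγc' := hγ'.1
  have ha0 : 0 ≤ a := (norm_nonneg _).trans (ha s left_mem_uIcc)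
  have key : ‖γ t - γ' t‖ ≤ 2 * a * weight L s t := by
    refine gronwall (f := fun t => ‖γ t - γ' t‖) h.integrable h.nonneg (by fun_prop)
      (fun _ => norm_nonneg _) fun r hr => ?_
    -- The Lipschitz bound is spent on `B` between the two curves, and `B - B'` is met only along
    -- `γ'` and inside a time integral. Cancellation in time is thus allowed, and weak convergence
    -- of fields will suffice.
    have e : γ r - γ' r = (∫ q in s..r, (B q (γ' q) - B' q (γ' q)))
        + ∫ q in s..r, (B q (γ q) - B q (γ' q)) := by
      have i1 := h.intervalIntegrable_comp hγc s r
      have i2 := h.intervalIntegrable_comp hγc' s r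
      have i3 := h'.intervalIntegrable_comp hγc' s r
      rw [hγ.2 r, hγ'.2 r, intervalIntegral.integral_sub i2 i3,
        intervalIntegral.integral_sub i1 i2]
      abel
    rw [e]
    refine (norm_add_le _ _).trans (add_le_add (ha r hr) ?_)
    refine norm_integral_le_abs_of_norm_le (Eventually.of_forall fun q => h.lip q _ _) ?_
    exact h.integrable.intervalIntegrable.mul_continuousOn (by fun_prop)
  refine key.trans ?_
  have := weight_le h.integrable h.nonneg s t
  unfold flowConst
  nlinarith

end IsField

end Caratheodory

/-! ### Mollification, determining test functions, summation of local errors -/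

namespace Caratheodory

open Filter Topology

variable {F : Type*} [NormedAddCommGroup F] [NormedSpace ℝ F] [FiniteDimensional ℝ F]
  [MeasurableSpace F] [BorelSpace F]

theorem continuous_of_abs_sub_le {f : F → ℝ} {K : ℝ} (hf : ∀ x y, |f x - f y| ≤ K * ‖x - y‖) :
    Continuous f :=
  (LipschitzWith.of_dist_le' (K := K) fun x y => by
    simpa only [dist_eq_norm, Real.norm_eq_abs] using hf x y).continuous

/-- The mollification of a real function with a smooth bump function. -/
noncomputable def mollify (φ : ContDiffBump (0 : F)) (f : F → ℝ) : F → ℝ :=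
  convolution (φ.normed Measure.addHaar) f (ContinuousLinearMap.lsmul ℝ ℝ) Measure.addHaar

variable (φ : ContDiffBump (0 : F))

theorem mollify_apply (f : F → ℝ) (x : F) :
    mollify φ f x = ∫ w, φ.normed Measure.addHaar w * f (x - w) ∂Measure.addHaar := rfl

theorem integrable_normed_mul {f : F → ℝ} (hf : Continuous f) (x : F) :
    Integrable (fun w => φ.normed Measure.addHaar w * f (x - w)) Measure.addHaar :=
  ((φ.continuous_normed).mul (by fun_prop)).integrable_of_hasCompactSupport
    (φ.hasCompactSupport_normed.mul_right)

theorem mollify_const (a : ℝ) (x : F) : mollify φ (fun _ => a) x = a := by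
  rw [mollify_apply, integral_mul_const, φ.integral_normed, one_mul]

/-- A mollification averages translates by `‖w‖ ≤ rOut`, so a bound common to these translates
survives. Two functions and two base points are allowed because functions at different times will be
compared along the flow. -/
theorem abs_mollify_sub_mollify_le {f g : F → ℝ} (hf : Continuous f) (hg : Continuous g)
    {x y : F} {c : ℝ} (h : ∀ w, ‖w‖ ≤ φ.rOut → |f (x - w) - g (y - w)| ≤ c) :
    |mollify φ f x - mollify φ g y| ≤ c := by
  rw [mollify_apply, mollify_apply, ← integral_sub (integrable_normed_mul φ hf x)
    (integrable_normed_mul φ hg y), ← Real.norm_eq_abs]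
  calc _ ≤ ∫ w, φ.normed Measure.addHaar w * c ∂(Measure.addHaar : Measure F) := by
        refine norm_integral_le_of_norm_le (φ.integrable_normed.mul_const c)
          (Eventually.of_forall fun w => ?_)
        rw [← mul_sub, norm_mul, Real.norm_of_nonneg (φ.nonneg_normed w)]
        by_cases hw : w ∈ Function.support (φ.normed (Measure.addHaar : Measure F))
        · rw [φ.support_normed_eq, Metric.mem_ball, dist_zero_right] at hw
          exact mul_le_mul_of_nonneg_left (h w hw.le) (φ.nonneg_normed w)
        · rw [Function.notMem_support.1 hw]; simp
    _ = c := by rw [integral_mul_const, φ.integral_normed, one_mul]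

theorem abs_mollify_sub_le {f : F → ℝ} {K : ℝ} (hf : ∀ x y, |f x - f y| ≤ K * ‖x - y‖) (hK : 0 ≤ K)
    (x : F) : |mollify φ f x - f x| ≤ K * φ.rOut := by
  conv_lhs => rw [← mollify_const φ (f x) x]
  refine abs_mollify_sub_mollify_le φ (continuous_of_abs_sub_le hf) continuous_const fun w hw => ?_
  refine (hf _ _).trans (mul_le_mul_of_nonneg_left ?_ hK)
  simpa using hw

theorem abs_mollify_sub_mollify_le_of_lip {f : F → ℝ} {K : ℝ}
    (hf : ∀ x y, |f x - f y| ≤ K * ‖x - y‖) (x y : F) :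
    |mollify φ f x - mollify φ f y| ≤ K * ‖x - y‖ :=
  abs_mollify_sub_mollify_le φ (continuous_of_abs_sub_le hf) (continuous_of_abs_sub_le hf)
    fun w _ => by simpa using hf (x - w) (y - w)

theorem contDiff_mollify {f : F → ℝ} (hf : Continuous f) : ContDiff ℝ ∞ (mollify φ f) :=
  φ.hasCompactSupport_normed.contDiff_convolution_left _ φ.contDiff_normed hf.locallyIntegrable

theorem mollify_eq_zero {f : F → ℝ} {R : ℝ} (hf : ∀ x, R < ‖x‖ → f x = 0) {x : F}
    (hx : R + φ.rOut < ‖x‖) : mollify φ f x = 0 := by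
  rw [mollify_apply]
  refine integral_eq_zero_of_ae (Eventually.of_forall fun w => ?_)
  by_cases hw : w ∈ Function.support (φ.normed (Measure.addHaar : Measure F))
  · rw [φ.support_normed_eq, Metric.mem_ball, dist_zero_right] at hw
    have := norm_sub_norm_le x w
    simp [hf (x - w) (by linarith)]
  · simp [Function.notMem_support.1 hw]

theorem hasCompactSupport_of_norm {G : Type*} [Zero G] {f : F → G} {R : ℝ}
    (hf : ∀ x, R < ‖x‖ → f x = 0) : HasCompactSupport f :=
  HasCompactSupport.intro (isCompact_closedBall 0 R) fun x hx => hf x (by simpa using hx)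

theorem hasCompactSupport_mollify {f : F → ℝ} {R : ℝ} (hf : ∀ x, R < ‖x‖ → f x = 0) :
    HasCompactSupport (mollify φ f) :=
  hasCompactSupport_of_norm (R := R + φ.rOut) fun _ hx => mollify_eq_zero φ hf hx

/-- A factor for the Lipschitz constant of the derivative of a mollification. -/
noncomputable def mollifyConst : ℝ :=
  ∫ w, ‖fderiv ℝ (φ.normed Measure.addHaar) w‖ ∂(Measure.addHaar : Measure F)

theorem mollifyConst_nonneg : 0 ≤ mollifyConst φ := integral_nonneg fun _ => norm_nonneg _

theorem norm_fderiv_mollify_le {f : F → ℝ} {K : ℝ} (hf : ∀ x y, |f x - f y| ≤ K * ‖x - y‖)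
    (hK : 0 ≤ K) (x : F) : ‖fderiv ℝ (mollify φ f) x‖ ≤ K := by
  have := norm_fderiv_le_of_lipschitz ℝ (f := mollify φ f) (x₀ := x) (C := K.toNNReal)
    (LipschitzWith.of_dist_le' fun x y => by
      simpa only [dist_eq_norm, Real.norm_eq_abs] using abs_mollify_sub_mollify_le_of_lip φ hf x y)
  rwa [Real.coe_toNNReal K hK] at this

theorem hasCompactSupport_fderiv_normed (ν : Measure F) [ν.IsAddHaarMeasure] :
    HasCompactSupport (fderiv ℝ (φ.normed ν)) :=
  φ.hasCompactSupport_normed.fderiv ℝ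

theorem continuous_fderiv_normed (ν : Measure F) [ν.IsAddHaarMeasure] :
    Continuous (fderiv ℝ (φ.normed ν)) :=
  (φ.contDiff_normed (n := 1)).continuous_fderiv (by norm_num)

theorem fderiv_mollify {f : F → ℝ} (hf : Continuous f) (x : F) :
    fderiv ℝ (mollify φ f) x =
      ∫ w, f (x - w) • fderiv ℝ (φ.normed Measure.addHaar) w ∂(Measure.addHaar : Measure F) := by
  have h := (φ.hasCompactSupport_normed (μ := Measure.addHaar)).hasFDerivAt_convolution_left
    (μ := Measure.addHaar)
    (ContinuousLinearMap.lsmul ℝ ℝ) (φ.contDiff_normed (n := 1)) hf.locallyIntegrable x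
  refine (HasFDerivAt.fderiv h).trans ?_
  refine integral_congr_ae (Eventually.of_forall fun w => ?_)
  ext v
  simp only [ContinuousLinearMap.precompL_apply, ContinuousLinearMap.lsmul_apply, smul_eq_mul,
    smul_apply, mul_comm]

theorem integrable_smul_of_hasCompactSupport {G : Type*} [NormedAddCommGroup G] [NormedSpace ℝ G]
    (ν : Measure F) [ν.IsAddHaarMeasure] {f : F → ℝ} {g : F → G} (hf : Continuous f)
    (hg : Continuous g) (hs : HasCompactSupport g) (x : F) :
    Integrable (fun w => f (x - w) • g w) ν :=
  Continuous.integrable_of_hasCompactSupport (by fun_prop) hs.smul_left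

/-- The derivative is put on the bump, so only the Lipschitz constant of `f` enters. `mollifyConst`
depends on the bump and is not controlled as its radius shrinks; it will multiply only the error
that vanishes with the mesh at fixed radius. -/
theorem norm_fderiv_mollify_sub_le {f : F → ℝ} {K : ℝ} (hf : ∀ x y, |f x - f y| ≤ K * ‖x - y‖)
    (x y : F) :
    ‖fderiv ℝ (mollify φ f) x - fderiv ℝ (mollify φ f) y‖ ≤ mollifyConst φ * K * ‖x - y‖ := by
  have hfc := continuous_of_abs_sub_le hf
  have hs := hasCompactSupport_fderiv_normed φ (Measure.addHaar : Measure F)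
  have hc := continuous_fderiv_normed φ (Measure.addHaar : Measure F)
  have hi := integrable_smul_of_hasCompactSupport (Measure.addHaar : Measure F) hfc hc hs
  rw [fderiv_mollify φ hfc, fderiv_mollify φ hfc, ← integral_sub (hi x) (hi y)]
  calc _ ≤ ∫ w, K * ‖x - y‖ * ‖fderiv ℝ (φ.normed Measure.addHaar) w‖
        ∂(Measure.addHaar : Measure F) := by
        refine norm_integral_le_of_norm_le ?_ (Eventually.of_forall fun w => ?_)
        · exact ((hc.integrable_of_hasCompactSupport hs).norm).const_mul _
        · rw [← sub_smul, norm_smul]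
          refine mul_le_mul_of_nonneg_right ?_ (norm_nonneg _)
          simpa using hf (x - w) (y - w)
    _ = mollifyConst φ * K * ‖x - y‖ := by rw [integral_const_mul, mollifyConst]; ring

/-- Finite measures which agree on compactly supported Lipschitz functions are equal. -/
theorem ext_of_forall_integral_lipschitz {μ ν : Measure F} [IsProbabilityMeasure μ]
    [IsProbabilityMeasure ν]
    (h : ∀ f : F → ℝ, (∃ K, 0 ≤ K ∧ ∀ x y, |f x - f y| ≤ K * ‖x - y‖) →
      (∃ R, ∀ x, R < ‖x‖ → f x = 0) → ∫ x, f x ∂μ = ∫ x, f x ∂ν) : μ = ν := by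
  have hK : ∀ K : Set F, IsCompact K → μ K = ν K := by
    intro K hK
    have hpos : ∀ n : ℕ, 0 < (1 : ℝ) / (n + 1) := fun n => by positivity
    -- The thickened indicators of a compact set are Lipschitz, vanish outside a ball and converge
    -- to its indicator.
    have e := fun (ρ : Measure F) [IsFiniteMeasure ρ] =>
      tendsto_lintegral_thickenedIndicator_of_isClosed ρ hK.isClosed hpos
        tendsto_one_div_add_atTop_nhds_zero_nat
    refine tendsto_nhds_unique (e μ) ?_
    refine (e ν).congr fun n => ?_
    rw [lintegral_coe_eq_integral _ (integrable_thickenedIndicator K (hpos n)),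
      lintegral_coe_eq_integral _ (integrable_thickenedIndicator K (hpos n)), h]
    · have := lipschitzWith_thickenedIndicator (hpos n) K
      refine ⟨((1 / (n + 1 : ℝ)).toNNReal⁻¹ : ℝ≥0), NNReal.coe_nonneg _, fun x y => ?_⟩
      have := this.dist_le_mul x y
      rwa [NNReal.dist_eq, dist_eq_norm] at this
    · obtain ⟨R, hR⟩ := hK.isBounded.exists_norm_le
      refine ⟨R + 1, fun x hx => ?_⟩
      rw [thickenedIndicator_zero (hpos n) K]
      · rfl
      · rw [Metric.mem_thickening_iff]
        rintro ⟨z, hz, hxz⟩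
        have h1 : (1 : ℝ) / (n + 1) ≤ 1 := by
          rw [div_le_one (by positivity)]; linarith [n.cast_nonneg (α := ℝ)]
        have h2 := hR z hz
        rw [dist_eq_norm] at hxz
        linarith [norm_sub_norm_le x z]
  refine ext_of_generate_finite _ (BorelSpace.measurable_eq.trans borel_eq_generateFrom_isClosed)
    isPiSystem_isClosed (fun A hA => ?_) (by simp)
  -- Closed sets form a generating π-system and are increasing unions of compact sets.
  have hu : A = ⋃ n : ℕ, A ∩ Metric.closedBall 0 n := by
    rw [← inter_iUnion, Metric.iUnion_closedBall_nat, inter_univ]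
  have hm : Monotone fun n : ℕ => A ∩ Metric.closedBall (0 : F) n := fun m n hmn =>
    inter_subset_inter_right _ (Metric.closedBall_subset_closedBall (by exact_mod_cast hmn))
  rw [hu, hm.measure_iUnion, hm.measure_iUnion]
  congr 1
  ext n
  exact hK _ ((isCompact_closedBall 0 _).inter_left hA)

/-- An almost additive function on an interval, up to an error quadratic in the mesh. -/
theorem abs_sub_le_of_local {f L M : ℝ → ℝ} (hL : Integrable L) (hL0 : ∀ t, 0 ≤ L t)
    (hM : Integrable M) {T a b : ℝ} (hT : 0 ≤ T) (hb : 0 ≤ b)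
    (h : ∀ s t, 0 ≤ s → s ≤ t → t ≤ T →
      |f t - f s| ≤ a * (∫ r in s..t, L r) + b * (∫ r in s..t, L r) * ∫ r in s..t, M r) :
    |f T - f 0| ≤ a * ∫ r in (0)..T, L r := by
  have hΛ : 0 ≤ ∫ r in (0)..T, L r := intervalIntegral.integral_nonneg hT fun _ _ => hL0 _
  have key : ∀ ε > 0, |f T - f 0| ≤ (a + b * ε) * ∫ r in (0)..T, L r := by
    intro ε hε
    -- Uniform continuity of this primitive gives a partition with `∫ M < ε` on every cell, so that
    -- the product errors sum to at most `b ε ∫ L`.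
    have hc : Continuous fun t => ∫ r in (0)..t, M r :=
      intervalIntegral.continuous_primitive (fun a b => hM.intervalIntegrable) 0
    obtain ⟨δ, hδ, hu⟩ := Metric.uniformContinuousOn_iff.1
      ((isCompact_Icc (a := (0 : ℝ)) (b := T)).uniformContinuousOn_of_continuous hc.continuousOn) ε hε
    obtain ⟨N, hN⟩ := exists_nat_gt (T / δ)
    have hN0 : (0 : ℝ) < N := lt_of_le_of_lt (by positivity) hN
    set p : ℕ → ℝ := fun k => k * (T / N) with hp
    have hpm : Monotone p := fun i j hij => by
      simp only [hp]; gcongr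
    have hp0 : p 0 = 0 := by simp [hp]
    have hpN : p N = T := by simp only [hp]; field_simp
    have hstep : ∀ k < N, |f (p (k + 1)) - f (p k)| ≤ (a + b * ε) * ∫ r in p k..p (k + 1), L r := by
      intro k hk
      have h0 : 0 ≤ p k := hp0 ▸ hpm (Nat.zero_le k)
      have h1 : p (k + 1) ≤ T := hpN ▸ hpm hk
      have h2 : p k ≤ p (k + 1) := hpm k.le_succ
      have h3 : |∫ r in p k..p (k + 1), M r| < ε := by
        have := hu (p (k + 1)) ⟨h0.trans h2, h1⟩ (p k) ⟨h0, h2.trans h1⟩ ?_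
        · rwa [Real.dist_eq, intervalIntegral.integral_interval_sub_left hM.intervalIntegrable
            hM.intervalIntegrable] at this
        · rw [Real.dist_eq, abs_of_nonneg (sub_nonneg.2 h2)]
          simp only [hp]
          push_cast
          rw [← sub_mul, add_sub_cancel_left, one_mul, div_lt_iff₀ hN0]
          rwa [div_lt_iff₀ hδ, mul_comm] at hN
      refine (h _ _ h0 h2 h1).trans ?_
      have hpos : 0 ≤ ∫ r in p k..p (k + 1), L r := intervalIntegral.integral_nonneg h2 fun _ _ => hL0 _
      rw [add_mul, mul_right_comm b ε]
      gcongr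
      exact (le_abs_self _).trans h3.le
    calc |f T - f 0| = |∑ k ∈ Finset.range N, (f (p (k + 1)) - f (p k))| := by
          rw [Finset.sum_range_sub (fun k => f (p k)), hp0, hpN]
      _ ≤ ∑ k ∈ Finset.range N, |f (p (k + 1)) - f (p k)| := Finset.abs_sum_le_sum_abs _ _
      _ ≤ ∑ k ∈ Finset.range N, (a + b * ε) * ∫ r in p k..p (k + 1), L r :=
          Finset.sum_le_sum fun k hk => hstep k (Finset.mem_range.1 hk)
      _ = _ := by
          rw [← Finset.mul_sum, intervalIntegral.sum_integral_adjacent_intervals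
            (fun k _ => hL.intervalIntegrable), hp0, hpN]
  have : Tendsto (fun ε : ℝ => (a + b * ε) * ∫ r in (0)..T, L r) (𝓝[>] 0)
      (𝓝 ((a + b * 0) * ∫ r in (0)..T, L r)) := by
    refine Tendsto.mono_left (Continuous.tendsto ?_ 0) nhdsWithin_le_nhds
    fun_prop
  have := ge_of_tendsto this (eventually_nhdsWithin_of_forall key)
  simpa using this

end Caratheodory

/-! ### Weak solutions are transported by the flow -/

namespace Caratheodory

open Filter Topology

variable {F : Type*} [NormedAddCommGroup F] [NormedSpace ℝ F] [FiniteDimensional ℝ F]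
  [MeasurableSpace F] [BorelSpace F]

/-- Curves of probability measures which solve the continuity equation with the field `B`, tested
against functions of the space variable. -/
structure IsWeakSolution (B : ℝ → F → F) (μ : ℝ → Measure F) : Prop where
  prob : ∀ t, IsProbabilityMeasure (μ t)
  measurable : Measurable μ
  integrable : ∀ᵐ t, Integrable (B t) (μ t)
  integrable_norm : Integrable fun t => ∫ z, ‖B t z‖ ∂μ t
  weak : ∀ f : F → ℝ, ContDiff ℝ ∞ f → HasCompactSupport f → ∀ s t, 0 ≤ s → s ≤ t → t ≤ 1 →
    ∫ z, f z ∂μ t - ∫ z, f z ∂μ s = ∫ r in s..t, ∫ z, fderiv ℝ f z (B r z) ∂μ r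

theorem integrable_of_continuous_of_eq_zero {ν : Measure F} [IsFiniteMeasure ν] {f : F → ℝ}
    (hf : Continuous f) {R : ℝ} (h0 : ∀ x, R < ‖x‖ → f x = 0) : Integrable f ν :=
  hf.integrable_of_hasCompactSupport (hasCompactSupport_of_norm h0)

theorem fderiv_eq_zero_of_norm {f : F → ℝ} {R : ℝ} (h0 : ∀ x, R < ‖x‖ → f x = 0) {x : F}
    (hx : R < ‖x‖) : fderiv ℝ f x = 0 := by
  have : f =ᶠ[𝓝 x] fun _ => 0 := by
    filter_upwards [(isOpen_lt continuous_const continuous_norm).mem_nhds hx] with y hy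
    exact h0 y hy
  rw [this.fderiv_eq]
  simp

theorem abs_integral_sub_integral_le_of_forall {ν : Measure F} [IsProbabilityMeasure ν]
    {f g : F → ℝ} (hf : Integrable f ν) (hg : Integrable g ν) {c : ℝ}
    (h : ∀ x, |f x - g x| ≤ c) : |∫ x, f x ∂ν - ∫ x, g x ∂ν| ≤ c := by
  rw [← integral_sub hf hg]
  have := norm_integral_le_of_norm_le_const (μ := ν) (f := fun x => f x - g x) (C := c)
    (Eventually.of_forall h)
  simpa using this

theorem abs_integral_fderiv_le {ν : Measure F} {b : F → F} (hb : Integrable b ν) {f : F → ℝ}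
    {K : ℝ} (hK : ∀ x, ‖fderiv ℝ f x‖ ≤ K) :
    |∫ z, fderiv ℝ f z (b z) ∂ν| ≤ K * ∫ z, ‖b z‖ ∂ν := by
  rw [← integral_const_mul, ← Real.norm_eq_abs]
  refine norm_integral_le_of_norm_le (hb.norm.const_mul K) (Eventually.of_forall fun z => ?_)
  exact ((fderiv ℝ f z).le_opNorm _).trans (mul_le_mul_of_nonneg_right (hK z) (norm_nonneg _))

variable {B : ℝ → F → F} {L : ℝ → ℝ}

namespace IsWeakSolution

variable {μ : ℝ → Measure F} (hμ : IsWeakSolution B μ)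
include hμ

/-- Mollifying `g` gives a test function with gradient still bounded by `K`, and the error vanishes
with the radius. Functions that are merely Lipschitz must be covered because the lemma is applied to
`z ↦ fderiv ℝ f z (B r z)`. -/
theorem abs_integral_sub_integral_le {g : F → ℝ} {K R : ℝ} (hK : 0 ≤ K)
    (hg : ∀ x y, |g x - g y| ≤ K * ‖x - y‖) (hR : ∀ x, R < ‖x‖ → g x = 0) {s t : ℝ} (hs : 0 ≤ s)
    (hst : s ≤ t) (ht : t ≤ 1) :
    |∫ z, g z ∂μ t - ∫ z, g z ∂μ s| ≤ K * ∫ r in s..t, ∫ z, ‖B r z‖ ∂μ r := by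
  have := hμ.prob
  have hgc := continuous_of_abs_sub_le hg
  have key : ∀ δ > 0, |∫ z, g z ∂μ t - ∫ z, g z ∂μ s|
      ≤ K * (∫ r in s..t, ∫ z, ‖B r z‖ ∂μ r) + 2 * (K * δ) := by
    intro δ hδ
    let φ : ContDiffBump (0 : F) := ⟨δ / 2, δ, by positivity, by linarith⟩
    have hmc := contDiff_mollify φ hgc
    have hm : ∀ ν : Measure F, IsProbabilityMeasure ν →
        |∫ z, mollify φ g z ∂ν - ∫ z, g z ∂ν| ≤ K * δ := fun ν _ =>
      abs_integral_sub_integral_le_of_forall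
        (integrable_of_continuous_of_eq_zero hmc.continuous fun x hx => mollify_eq_zero φ hR hx)
        (integrable_of_continuous_of_eq_zero hgc hR) fun x => abs_mollify_sub_le φ hg hK x
    have h1 := hm (μ t) (hμ.prob t)
    have h2 := hm (μ s) (hμ.prob s)
    have h3 : |∫ z, mollify φ g z ∂μ t - ∫ z, mollify φ g z ∂μ s|
        ≤ K * ∫ r in s..t, ∫ z, ‖B r z‖ ∂μ r := by
      rw [hμ.weak _ hmc (hasCompactSupport_mollify φ hR) s t hs hst ht,
        ← intervalIntegral.integral_const_mul, ← Real.norm_eq_abs]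
      refine intervalIntegral.norm_integral_le_of_norm_le hst ?_
        (hμ.integrable_norm.intervalIntegrable.const_mul K)
      filter_upwards [hμ.integrable] with r hr _
      exact abs_integral_fderiv_le hr (norm_fderiv_mollify_le φ hg hK)
    rw [abs_le] at *
    constructor <;> linarith [h1.1, h1.2, h2.1, h2.2, h3.1, h3.2]
  have : Tendsto (fun δ : ℝ => K * (∫ r in s..t, ∫ z, ‖B r z‖ ∂μ r) + 2 * (K * δ)) (𝓝[>] 0)
      (𝓝 (K * (∫ r in s..t, ∫ z, ‖B r z‖ ∂μ r) + 2 * (K * 0))) := by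
    refine Tendsto.mono_left (Continuous.tendsto ?_ 0) nhdsWithin_le_nhds
    fun_prop
  have := ge_of_tendsto this (eventually_nhdsWithin_of_forall key)
  simpa using this

end IsWeakSolution

namespace IsField

variable (h : IsField B L)
include h

theorem measurable_flow_uncurry (s : ℝ) : Measurable fun p : ℝ × F => h.flow s p.2 p.1 :=
  (measurable_uncurry_of_continuous_of_measurable (u := fun t x => h.flow s x t)
    (fun x => h.continuous_flow s x) fun t => (h.continuous_flow_right s t).measurable)

theorem comp_flow_sub_eq (s t : ℝ) (x : F) {f : F → ℝ} (hf : ContDiff ℝ 1 f) :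
    f (h.flow s x t) - f x = ∫ r in s..t, fderiv ℝ f (h.flow s x r) (B r (h.flow s x r)) := by
  have := integral_fderiv_comp_primitive
    (h.intervalIntegrable_comp (h.continuous_flow s x) s t) x hf
  rw [← h.flow_eq s x t] at this
  rw [← this]
  simp_rw [← h.flow_eq s x]

theorem abs_fderiv_apply_le {f : F → ℝ} {K R : ℝ} (hK : ∀ x, ‖fderiv ℝ f x‖ ≤ K)
    (hR : ∀ x, R < ‖x‖ → f x = 0) (hR0 : 0 ≤ R) (r : ℝ) (x : F) :
    |fderiv ℝ f x (B r x)| ≤ K * (1 + R) * L r := by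
  have hK0 : 0 ≤ K := (norm_nonneg _).trans (hK 0)
  have hL := h.nonneg r
  rcases lt_or_ge R ‖x‖ with hx | hx
  · rw [fderiv_eq_zero_of_norm hR hx]
    simp only [zero_apply, abs_zero]
    positivity
  · rw [← Real.norm_eq_abs]
    refine ((fderiv ℝ f x).le_opNorm _).trans ?_
    rw [mul_assoc]
    refine mul_le_mul (hK x) ((h.growth r x).trans ?_) (norm_nonneg _) hK0
    rw [mul_comm]
    exact mul_le_mul_of_nonneg_right (by linarith) hL

/-- The linear growth of `B` is harmless because `fderiv ℝ f` vanishes outside a ball: one of the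
two points may be taken in the ball, and `B` is bounded there. -/
theorem abs_fderiv_apply_sub_le {f : F → ℝ} {K R D : ℝ} (hK : ∀ x, ‖fderiv ℝ f x‖ ≤ K)
    (hD : ∀ x y, ‖fderiv ℝ f x - fderiv ℝ f y‖ ≤ D * ‖x - y‖)
    (hR : ∀ x, R < ‖x‖ → f x = 0) (hR0 : 0 ≤ R) (hD0 : 0 ≤ D) (r : ℝ) (x y : F) :
    |fderiv ℝ f x (B r x) - fderiv ℝ f y (B r y)| ≤ (D * (1 + R) + K) * L r * ‖x - y‖ := by
  have hK0 : 0 ≤ K := (norm_nonneg _).trans (hK 0)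
  have hL := h.nonneg r
  have key : ∀ x y : F, ‖x‖ ≤ R → |fderiv ℝ f x (B r x) - fderiv ℝ f y (B r y)|
      ≤ (D * (1 + R) + K) * L r * ‖x - y‖ := by
    intro x y hx
    have e : fderiv ℝ f x (B r x) - fderiv ℝ f y (B r y)
        = (fderiv ℝ f x - fderiv ℝ f y) (B r x) + fderiv ℝ f y (B r x - B r y) := by
      simp
    have h1 : ‖(fderiv ℝ f x - fderiv ℝ f y) (B r x)‖ ≤ D * ‖x - y‖ * (L r * (1 + R)) := by
      refine ((fderiv ℝ f x - fderiv ℝ f y).le_opNorm _).trans ?_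
      refine mul_le_mul (hD x y) ((h.growth r x).trans ?_) (norm_nonneg _) (by positivity)
      gcongr
    have h2 : ‖fderiv ℝ f y (B r x - B r y)‖ ≤ K * (L r * ‖x - y‖) :=
      ((fderiv ℝ f y).le_opNorm _).trans
        (mul_le_mul (hK y) (h.lip r x y) (norm_nonneg _) hK0)
    rw [e, ← Real.norm_eq_abs]
    refine (norm_add_le _ _).trans ((add_le_add h1 h2).trans (le_of_eq ?_))
    ring
  rcases lt_or_ge R ‖x‖ with hx | hx
  · rcases lt_or_ge R ‖y‖ with hy | hy
    · rw [fderiv_eq_zero_of_norm hR hx, fderiv_eq_zero_of_norm hR hy]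
      simp only [zero_apply, sub_zero, abs_zero]
      positivity
    · rw [abs_sub_comm, norm_sub_rev]
      exact key y x hy
  · exact key x y hx

theorem integral_comp_flow_sub {s t : ℝ} (hst : s ≤ t) {ν : Measure F} [IsProbabilityMeasure ν]
    {f : F → ℝ} (hf : ContDiff ℝ 1 f) {K R : ℝ} (hK : ∀ x, ‖fderiv ℝ f x‖ ≤ K)
    (hR : ∀ x, R < ‖x‖ → f x = 0) (hR0 : 0 ≤ R) :
    Integrable (fun z => f (h.flow s z t)) ν ∧
    IntervalIntegrable (fun r => ∫ z, fderiv ℝ f (h.flow s z r) (B r (h.flow s z r)) ∂ν)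
      volume s t ∧
    ∫ z, f (h.flow s z t) ∂ν - ∫ z, f z ∂ν
      = ∫ r in s..t, ∫ z, fderiv ℝ f (h.flow s z r) (B r (h.flow s z r)) ∂ν := by
  have hm : Measurable fun p : ℝ × F =>
      fderiv ℝ f (h.flow s p.2 p.1) (B p.1 (h.flow s p.2 p.1)) := by
    have h1 := h.measurable_flow_uncurry s
    have h2 : Measurable fun p : ℝ × F => B p.1 (h.flow s p.2 p.1) :=
      h.measurable_uncurry.comp (measurable_fst.prodMk h1)
    have h3 : Continuous fun q : F × F => fderiv ℝ f q.1 q.2 :=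
      (((hf.continuous_fderiv (by norm_num)).comp continuous_fst).clm_apply continuous_snd)
    exact h3.measurable.comp (h1.prodMk h2)
  have hint : Integrable (fun p : ℝ × F =>
      fderiv ℝ f (h.flow s p.2 p.1) (B p.1 (h.flow s p.2 p.1)))
      ((volume.restrict (Ioc s t)).prod ν) := by
    have : Integrable (fun p : ℝ × F => K * (1 + R) * L p.1) ((volume.restrict (Ioc s t)).prod ν) :=
      ((h.integrable.restrict (s := Ioc s t)).comp_fst ν).const_mul _
    exact this.mono' hm.aestronglyMeasurable
      (Eventually.of_forall fun p => h.abs_fderiv_apply_le hK hR hR0 p.1 _)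
  have hfi : Integrable f ν := integrable_of_continuous_of_eq_zero hf.continuous hR
  have hfx : Integrable (fun z => f (h.flow s z t)) ν := by
    refine (hf.continuous.comp (h.continuous_flow_right s t)).integrable_of_hasCompactSupport ?_
    refine hasCompactSupport_of_norm (R := flowConst L * (1 + R)) fun z hz => hR _ ?_
    have h1 := h.growth_le_flow s t z
    have h2 := flowConst_pos L
    nlinarith
  refine ⟨hfx, ?_, ?_⟩
  · rw [intervalIntegrable_iff_integrableOn_Ioc_of_le hst]
    exact hint.integral_prod_left
  · rw [← integral_sub hfx hfi, intervalIntegral.integral_of_le hst,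
      integral_integral_swap (f := fun r z => fderiv ℝ f (h.flow s z r) (B r (h.flow s z r))) hint]
    refine integral_congr_ae (Eventually.of_forall fun z => ?_)
    simp only [h.comp_flow_sub_eq s t z hf, intervalIntegral.integral_of_le hst]

/-- The constant in the comparison of a weak solution with the flow over a short time. -/
noncomputable def _root_.Caratheodory.defectConst (L : ℝ → ℝ) (K D R : ℝ) : ℝ :=
  (D * (1 + R) + K) * (1 + flowConst L * (1 + flowConst L * (1 + R)))

theorem one_le_flowConst : 1 ≤ flowConst L := by
  have : 0 ≤ ∫ r, L r := integral_nonneg h.nonneg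
  have : 1 ≤ Real.exp (2 * ∫ r, L r) := Real.one_le_exp (by positivity)
  unfold flowConst
  linarith

/-- Both quantities equal `∫ f dμ_s` at `t = s`. With `g_r z = fderiv ℝ f z (B r z)`, their rates of
change are `∫ g_r dμ_r` and `∫ g_r(flow) dμ_s`, and both are compared with `∫ g_r dμ_s`. The
Lipschitz constant of `g_r` is a multiple of `L r`, while solution and flow have moved only by
integrals over `[s,t]`; hence the product of two small factors. -/
theorem abs_integral_sub_integral_comp_flow_le {μ : ℝ → Measure F} (hμ : IsWeakSolution B μ)
    {s t : ℝ} (hs : 0 ≤ s) (hst : s ≤ t) (ht : t ≤ 1) {f : F → ℝ} (hf : ContDiff ℝ ∞ f)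
    {K D R : ℝ} (hK : ∀ x, ‖fderiv ℝ f x‖ ≤ K)
    (hD : ∀ x y, ‖fderiv ℝ f x - fderiv ℝ f y‖ ≤ D * ‖x - y‖)
    (hR : ∀ x, R < ‖x‖ → f x = 0) (hR0 : 0 ≤ R) (hD0 : 0 ≤ D) :
    |∫ z, f z ∂μ t - ∫ z, f (h.flow s z t) ∂μ s| ≤ defectConst L K D R * (∫ r in s..t, L r)
      * ∫ r in s..t, (L r + ∫ z, ‖B r z‖ ∂μ r) := by
  have := hμ.prob
  have hf1 : ContDiff ℝ 1 f := hf.of_le (by norm_cast)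
  obtain ⟨-, hi1, e1⟩ := h.integral_comp_flow_sub hst (ν := μ s) hf1 hK hR hR0
  have e2 := hμ.weak f hf (hasCompactSupport_of_norm hR) s t hs hst ht
  have hK0 : 0 ≤ K := (norm_nonneg _).trans (hK 0)
  have hfc := h.one_le_flowConst
  have hfc0 := flowConst_pos L
  have hi2 : IntervalIntegrable (fun r => ∫ z, fderiv ℝ f z (B r z) ∂μ r) volume s t := by
    refine (h.integrable.const_mul (K * (1 + R))).intervalIntegrable.mono_fun' ?_ ?_
    · let κ : ProbabilityTheory.Kernel ℝ F := ⟨μ, hμ.measurable⟩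
      have : ProbabilityTheory.IsMarkovKernel κ := ⟨hμ.prob⟩
      have hm : Measurable fun p : ℝ × F => fderiv ℝ f p.2 (B p.1 p.2) := by
        have h3 : Continuous fun q : F × F => fderiv ℝ f q.1 q.2 :=
          (((hf1.continuous_fderiv (by norm_num)).comp continuous_fst).clm_apply continuous_snd)
        exact h3.measurable.comp (measurable_snd.prodMk h.measurable_uncurry)
      exact (StronglyMeasurable.integral_kernel_prod_right' (κ := κ)
        hm.stronglyMeasurable).aestronglyMeasurable
    · refine Eventually.of_forall fun r => ?_
      have := norm_integral_le_of_norm_le_const (μ := μ r) (f := fun z => fderiv ℝ f z (B r z))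
        (Eventually.of_forall fun z => h.abs_fderiv_apply_le hK hR hR0 r z)
      simpa using this
  have e3 : ∫ z, f z ∂μ t - ∫ z, f (h.flow s z t) ∂μ s = ∫ r in s..t,
      (∫ z, fderiv ℝ f z (B r z) ∂μ r
        - ∫ z, fderiv ℝ f (h.flow s z r) (B r (h.flow s z r)) ∂μ s) := by
    rw [intervalIntegral.integral_sub hi2 hi1, ← e1, ← e2]
    ring
  set β := fun r => ∫ z, ‖B r z‖ ∂μ r with hβ
  set M := ∫ r in s..t, (L r + β r) with hM
  have hβ0 : ∀ r, 0 ≤ β r := fun r => integral_nonneg fun _ => norm_nonneg _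
  have hMadd : M = (∫ r in s..t, L r) + ∫ r in s..t, β r :=
    intervalIntegral.integral_add h.integrable.intervalIntegrable
      hμ.integrable_norm.intervalIntegrable
  have hL0 : 0 ≤ ∫ r in s..t, L r := intervalIntegral.integral_nonneg hst fun _ _ => h.nonneg _
  have hβi0 : 0 ≤ ∫ r in s..t, β r := intervalIntegral.integral_nonneg hst fun _ _ => hβ0 _
  rw [e3, mul_right_comm, ← intervalIntegral.integral_const_mul, ← Real.norm_eq_abs]
  refine intervalIntegral.norm_integral_le_of_norm_le hst (Eventually.of_forall fun r hr => ?_)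
    (h.integrable.intervalIntegrable.const_mul _)
  have hLr := h.nonneg r
  have hlip := h.abs_fderiv_apply_sub_le hK hD hR hR0 hD0 r
  set c := (D * (1 + R) + K) * L r with hc
  have hc0 : 0 ≤ c := by positivity
  have hg0 : ∀ z, R < ‖z‖ → fderiv ℝ f z (B r z) = 0 := fun z hz => by
    rw [fderiv_eq_zero_of_norm hR hz]; simp
  have a1 : |∫ z, fderiv ℝ f z (B r z) ∂μ r - ∫ z, fderiv ℝ f z (B r z) ∂μ s|
      ≤ c * ∫ q in s..t, β q := by
    refine (hμ.abs_integral_sub_integral_le hc0 hlip hg0 hs hr.1.le (hr.2.trans ht)).trans ?_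
    refine mul_le_mul_of_nonneg_left ?_ hc0
    exact intervalIntegral.integral_mono_interval le_rfl hr.1.le hr.2
      (Eventually.of_forall hβ0) hμ.integrable_norm.intervalIntegrable
  -- The displacement of the flow is not bounded uniformly in `z`, but for large `z` both integrands
  -- vanish, by `growth_le_flow`.
  have a2 : |∫ z, fderiv ℝ f z (B r z) ∂μ s
      - ∫ z, fderiv ℝ f (h.flow s z r) (B r (h.flow s z r)) ∂μ s|
      ≤ c * (flowConst L * (1 + flowConst L * (1 + R)) * ∫ q in s..t, L q) := by
    have hgc := continuous_of_abs_sub_le hlip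
    refine abs_integral_sub_integral_le_of_forall (integrable_of_continuous_of_eq_zero hgc hg0)
      (integrable_of_continuous_of_eq_zero (R := flowConst L * (1 + R))
        (hgc.comp (h.continuous_flow_right s r)) fun z hz => hg0 _ ?_) fun z => ?_
    · have h1 := h.growth_le_flow s r z
      nlinarith
    · rcases lt_or_ge (flowConst L * (1 + R)) ‖z‖ with hz | hz
      · have h1 := h.growth_le_flow s r z
        rw [Function.comp_apply, hg0 z (by nlinarith), hg0 (h.flow s z r) (by nlinarith)]
        simp only [sub_zero, abs_zero]
        positivity
      · refine (hlip _ _).trans (mul_le_mul_of_nonneg_left ?_ hc0)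
        rw [norm_sub_rev]
        refine (h.norm_flow_sub_le hr.1.le z).trans ?_
        have h5 : ∫ q in s..r, L q ≤ ∫ q in s..t, L q :=
          intervalIntegral.integral_mono_interval le_rfl hr.1.le hr.2
            (Eventually.of_forall h.nonneg) h.integrable.intervalIntegrable
        have h6 : 0 ≤ ∫ q in s..r, L q :=
          intervalIntegral.integral_nonneg hr.1.le fun _ _ => h.nonneg _
        gcongr
  rw [Real.norm_eq_abs]
  refine (abs_sub_le _ (∫ z, fderiv ℝ f z (B r z) ∂μ s) _).trans ((add_le_add a1 a2).trans ?_)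
  have hp : 0 ≤ flowConst L * (1 + flowConst L * (1 + R)) := by positivity
  have : (∫ q in s..t, β q) + flowConst L * (1 + flowConst L * (1 + R)) * ∫ q in s..t, L q
      ≤ (1 + flowConst L * (1 + flowConst L * (1 + R))) * M := by
    rw [hMadd]
    nlinarith [mul_nonneg hp hβi0]
  rw [← mul_add]
  refine (mul_le_mul_of_nonneg_left this hc0).trans (le_of_eq ?_)
  rw [hc, defectConst]
  ring

/-- A weak solution of the continuity equation is transported by the flow. -/
theorem eq_map_flow {μ : ℝ → Measure F} (hμ : IsWeakSolution B μ) {T : ℝ} (hT0 : 0 ≤ T)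
    (hT1 : T ≤ 1) : μ T = (μ 0).map fun z => h.flow 0 z T := by
  have := hμ.prob
  have hfm : Measurable fun z => h.flow 0 z T := (h.continuous_flow_right 0 T).measurable
  have : IsProbabilityMeasure ((μ 0).map fun z => h.flow 0 z T) :=
    Measure.isProbabilityMeasure_map hfm.aemeasurable
  refine ext_of_forall_integral_lipschitz fun ψ ⟨K, hK0, hK⟩ ⟨R', hR'⟩ => ?_
  have hψc := continuous_of_abs_sub_le hK
  rw [integral_map hfm.aemeasurable hψc.aestronglyMeasurable]
  obtain ⟨R, hR0, hR⟩ : ∃ R, 0 ≤ R ∧ ∀ x, R < ‖x‖ → ψ x = 0 :=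
    ⟨max R' 0, le_max_right _ _, fun x hx => hR' x ((le_max_left _ _).trans_lt hx)⟩
  have hC := flowConst_pos L
  set K' := K * flowConst L with hK'
  have hK'0 : 0 ≤ K' := by positivity
  set R₁ := flowConst L * (1 + R) with hR₁
  have hR₁0 : 0 ≤ R₁ := by positivity
  -- The backward transport of `ψ`: `Φ T = ψ`, and `Φ` is constant along trajectories. Its Lipschitz
  -- constant and its support are bounded uniformly in `s`.
  let Φ : ℝ → F → ℝ := fun s z => ψ (h.flow s z T)
  have hΦl : ∀ s x y, |Φ s x - Φ s y| ≤ K' * ‖x - y‖ := fun s x y => by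
    refine (hK _ _).trans ?_
    rw [hK', mul_assoc]
    exact mul_le_mul_of_nonneg_left (h.dist_flow_le s T x y) hK0
  have hΦc : ∀ s, Continuous (Φ s) := fun s => continuous_of_abs_sub_le (hΦl s)
  have hΦ0 : ∀ s x, R₁ < ‖x‖ → Φ s x = 0 := fun s x hx => hR _ (by
    have h1 := h.growth_le_flow s T x
    nlinarith)
  have hΦi : ∀ s (ν : Measure F) [IsProbabilityMeasure ν], Integrable (Φ s) ν := fun s ν _ =>
    integrable_of_continuous_of_eq_zero (hΦc s) (hΦ0 s)
  have key : ∀ δ > 0, |∫ z, ψ z ∂μ T - ∫ z, ψ (h.flow 0 z T) ∂μ 0|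
      ≤ δ * (K' * flowConst L * (∫ r in (0)..T, L r) + 2 * K') := by
    intro δ hδ
    let φ : ContDiffBump (0 : F) := ⟨δ / 2, δ, by positivity, by linarith⟩
    have hm0 : ∀ s x, R₁ + δ < ‖x‖ → mollify φ (Φ s) x = 0 := fun s x hx =>
      mollify_eq_zero φ (hΦ0 s) hx
    have hmi : ∀ s (ν : Measure F) [IsProbabilityMeasure ν], Integrable (mollify φ (Φ s)) ν :=
      fun s ν _ => integrable_of_continuous_of_eq_zero (contDiff_mollify φ (hΦc s)).continuous
        (hm0 s)
    have hclose : ∀ s (ν : Measure F) [IsProbabilityMeasure ν],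
        |∫ z, mollify φ (Φ s) z ∂ν - ∫ z, Φ s z ∂ν| ≤ K' * δ := fun s ν _ =>
      abs_integral_sub_integral_le_of_forall (hmi s ν) (hΦi s ν) fun x =>
        abs_mollify_sub_le φ (hΦl s) hK'0 x
    -- The change splits into the failure of `μ` to follow the flow, a product error, and the
    -- commutator of mollification with the flow, which is linear in `∫ L` but carries the factor
    -- `δ`.
    have hloc : ∀ s t, 0 ≤ s → s ≤ t → t ≤ T →
        |∫ z, mollify φ (Φ t) z ∂μ t - ∫ z, mollify φ (Φ s) z ∂μ s|
          ≤ K' * flowConst L * δ * (∫ r in s..t, L r)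
            + defectConst L K' (mollifyConst φ * K') (R₁ + δ) * (∫ r in s..t, L r)
              * ∫ r in s..t, (L r + ∫ z, ‖B r z‖ ∂μ r) := by
      intro s t hs hst htT
      have b1 := h.abs_integral_sub_integral_comp_flow_le hμ hs hst (htT.trans hT1)
        (contDiff_mollify φ (hΦc t)) (norm_fderiv_mollify_le φ (hΦl t) hK'0)
        (norm_fderiv_mollify_sub_le φ (hΦl t)) (hm0 t) (by positivity)
        (mul_nonneg (mollifyConst_nonneg φ) hK'0)
      -- Since `Φ s (z - w) = Φ t (flow s (z - w) t)`, the task is to compare `flow s (z - w) t`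
      -- with `flow s z t - w`.
      have b2 : |∫ z, mollify φ (Φ t) (h.flow s z t) ∂μ s - ∫ z, mollify φ (Φ s) z ∂μ s|
          ≤ K' * flowConst L * δ * ∫ r in s..t, L r := by
        refine abs_integral_sub_integral_le_of_forall
          (h.integral_comp_flow_sub hst ((contDiff_mollify φ (hΦc t)).of_le
            (by norm_cast)) (norm_fderiv_mollify_le φ (hΦl t) hK'0) (hm0 t)
            (by positivity)).1 (hmi s _) fun z => ?_
        refine abs_mollify_sub_mollify_le φ (hΦc t) (hΦc s) fun w hw => ?_
        have e : Φ s (z - w) = Φ t (h.flow s (z - w) t) := by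
          simp only [Φ]
          rw [h.flow_flow]
        rw [e]
        refine (hΦl t _ _).trans ?_
        have h1 := h.norm_flow_sub_flow_sub_le hst z (z - w)
        have h0 : 0 ≤ ∫ r in s..t, L r :=
          intervalIntegral.integral_nonneg hst fun _ _ => h.nonneg _
        rw [sub_sub_cancel, sub_right_comm] at h1
        calc _ ≤ K' * (flowConst L * ‖w‖ * ∫ r in s..t, L r) :=
              mul_le_mul_of_nonneg_left h1 hK'0
          _ ≤ K' * (flowConst L * δ * ∫ r in s..t, L r) := by gcongr
          _ = _ := by ring
      exact (abs_sub_le _ _ _).trans ((add_le_add b1 b2).trans (le_of_eq (add_comm _ _)))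
    have hfin := abs_sub_le_of_local (f := fun t => ∫ z, mollify φ (Φ t) z ∂μ t) h.integrable
      h.nonneg (h.integrable.add hμ.integrable_norm) hT0
      (by
        have := mollifyConst_nonneg φ
        unfold defectConst
        positivity) hloc
    have c1 := hclose T (μ T)
    have c2 := hclose 0 (μ 0)
    have eT : ∀ z, Φ T z = ψ z := fun z => by simp only [Φ]; rw [h.flow_self]
    simp only [eT] at c1
    have e0 : ∫ z, Φ 0 z ∂μ 0 = ∫ z, ψ (h.flow 0 z T) ∂μ 0 := rfl
    rw [e0] at c2
    rw [abs_le] at *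
    constructor <;> nlinarith [c1.1, c1.2, c2.1, c2.2, hfin.1, hfin.2]
  have : Tendsto (fun δ : ℝ => δ * (K' * flowConst L * (∫ r in (0)..T, L r) + 2 * K')) (𝓝[>] 0)
      (𝓝 (0 * (K' * flowConst L * (∫ r in (0)..T, L r) + 2 * K'))) := by
    refine Tendsto.mono_left (Continuous.tendsto ?_ 0) nhdsWithin_le_nhds
    fun_prop
  have := ge_of_tendsto this (eventually_nhdsWithin_of_forall key)
  rw [zero_mul] at this
  exact sub_eq_zero.1 (abs_nonpos_iff.1 this)

end IsField

end Caratheodory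

namespace MeanFieldNet

open Filter Topology ProbabilityTheory

/-! ### Measurability of families of measures -/

/-- Closed sets are a generating π-system, and their indicators are limits of Lipschitz thickened
indicators. Only Lipschitz integrands are required since these are the ones estimated by transport
plans. -/
theorem measurable_of_forall_lipschitz {T X : Type*} [MeasurableSpace T] [MeasurableSpace X]
    [PseudoEMetricSpace X] [BorelSpace X] {m : T → Measure X} [∀ t, IsProbabilityMeasure (m t)]
    (h : ∀ (f : BoundedContinuousFunction X ℝ≥0) (K : ℝ≥0), LipschitzWith K f →
      Measurable fun t => ∫⁻ x, f x ∂m t) : Measurable m := by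
  refine Measurable.measure_of_isPiSystem_of_isProbabilityMeasure
    (BorelSpace.measurable_eq.trans borel_eq_generateFrom_isClosed) isPiSystem_isClosed ?_
  intro A hA
  have hpos : ∀ n : ℕ, 0 < (1 : ℝ) / (n + 1) := fun n => by positivity
  refine measurable_of_tendsto_metrizable (f := fun n t => ∫⁻ x, thickenedIndicator (hpos n) A x ∂m t)
    (fun n => h _ _ (lipschitzWith_thickenedIndicator (hpos n) A)) (tendsto_pi_nhds.2 fun t => ?_)
  exact tendsto_lintegral_thickenedIndicator_of_isClosed (m t) hA hpos
    tendsto_one_div_add_atTop_nhds_zero_nat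

theorem measurable_coe_of_continuous {T X : Type*} [TopologicalSpace T] [MeasurableSpace T]
    [OpensMeasurableSpace T] [MeasurableSpace X] [PseudoEMetricSpace X] [BorelSpace X]
    {m : T → ProbabilityMeasure X} (hm : Continuous m) :
    Measurable fun t => (m t : Measure X) := by
  refine measurable_of_forall_lipschitz fun f _ _ => ?_
  exact (continuous_iff_continuousAt.2 fun t =>
    ProbabilityMeasure.tendsto_iff_forall_lintegral_tendsto.1 (hm.tendsto t) f).measurable

/-- Each of countably many generators has a preimage that agrees almost everywhere with a measurable
set. Making `f` constant on one measurable null set containing all exceptions makes it measurable.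
-/
theorem NullMeasurable.aemeasurable_of_countablyGenerated {T X : Type*} {mT : MeasurableSpace T}
    [MeasurableSpace X] [MeasurableSpace.CountablyGenerated X] [Nonempty X] {μ : Measure T}
    {f : T → X} (hf : NullMeasurable f μ) : AEMeasurable f μ := by
  classical
  obtain ⟨b, hbc, hb⟩ := MeasurableSpace.CountablyGenerated.isCountablyGenerated (α := X)
  have hs : ∀ s : b, ∃ t, MeasurableSet t ∧ ∀ᵐ x ∂μ, x ∈ f ⁻¹' s ↔ x ∈ t := by
    intro s
    have : MeasurableSet (s : Set X) := by
      rw [hb]; exact MeasurableSpace.measurableSet_generateFrom s.2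
    obtain ⟨t, ht, hst⟩ := (hf this).exists_measurable_superset_ae_eq
    exact ⟨t, hst.1, hst.2.mem_iff.mono fun x hx => hx.symm⟩
  choose t htm hst using hs
  have : Countable b := hbc
  have hall := ae_all_iff.2 hst
  obtain ⟨N, hN, hNm, hN0⟩ := exists_measurable_superset_of_null (ae_iff.1 hall)
  obtain ⟨x₀⟩ := ‹Nonempty X›
  refine ⟨N.piecewise (fun _ => x₀) f, ?_, ?_⟩
  · rw [hb]
    refine measurable_generateFrom fun s hs => ?_
    have e : N.piecewise (fun _ => x₀) f ⁻¹' s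
        = N.ite ((fun _ => x₀) ⁻¹' s) (t ⟨s, hs⟩) := by
      rw [piecewise_preimage]
      ext x
      by_cases hx : x ∈ N
      · simp [Set.ite, hx]
      · have : ∀ s : b, x ∈ f ⁻¹' s ↔ x ∈ t s := by
          by_contra hc
          exact hx (hN hc)
        have := this ⟨s, hs⟩
        simp only [mem_preimage] at this
        simp [Set.ite, hx, this]
    rw [e]
    exact hNm.ite (measurable_const (hb ▸ MeasurableSpace.measurableSet_generateFrom hs) ) (htm _)
  · have : ∀ᵐ x ∂μ, x ∉ N := measure_eq_zero_iff_ae_notMem.1 hN0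
    filter_upwards [this] with x hx
    simp [hx]

/-- A standard Borel space embeds in `ℝ`, and a probability measure on it is determined by the
preimages of half-lines with rational endpoints. Only countably many null sets arise, and on their
union `f` is replaced by a fixed value. -/
theorem exists_kernel_ae_eq {T X : Type*} {mT : MeasurableSpace T} [MeasurableSpace X]
    [StandardBorelSpace X] {μ : Measure T} [NeZero μ] {f : T → Measure X}
    [hp : ∀ t, IsProbabilityMeasure (f t)] (hf : NullMeasurable f μ) :
    ∃ κ : Kernel T X, IsMarkovKernel κ ∧ ∀ᵐ t ∂μ, κ t = f t := by
  classical
  let S : ℚ → Set X := fun q => embeddingReal X ⁻¹' Iic (q : ℝ)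
  have hSm : ∀ q, MeasurableSet (S q) := fun q => measurable_embeddingReal X measurableSet_Iic
  have hae : ∀ q, AEMeasurable (fun t => f t (S q)) μ := fun q =>
    NullMeasurable.aemeasurable_of_countablyGenerated
      ((Measure.measurable_coe (hSm q)).comp_nullMeasurable hf)
  choose g hgm hg using hae
  obtain ⟨N, hN, hNm, hN0⟩ := exists_measurable_superset_of_null (ae_iff.1 (ae_all_iff.2 hg))
  have hNN : ∀ᵐ x ∂μ, x ∉ N := measure_eq_zero_iff_ae_notMem.1 hN0
  obtain ⟨t₀⟩ : Nonempty T := μ.nonempty_of_neZero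
  let k : T → Measure X := N.piecewise (fun _ => f t₀) f
  have hk : ∀ t, IsProbabilityMeasure (k t) := fun t => by
    by_cases ht : t ∈ N <;> simp only [k, ht, piecewise_eq_of_mem, piecewise_eq_of_notMem,
      not_false_eq_true] <;> infer_instance
  have hkm : Measurable k := by
    refine Measurable.measure_of_isPiSystem_of_isProbabilityMeasure (S := range S) ?_ ?_ ?_
    · have e := (measurableEmbedding_embeddingReal X).comap_eq
      rw [BorelSpace.measurable_eq (α := ℝ), Real.borel_eq_generateFrom_Iic_rat,
        MeasurableSpace.comap_generateFrom, iUnion_singleton_eq_range, ← range_comp] at e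
      exact e.symm
    · have := Real.isPiSystem_Iic_rat.comap (embeddingReal X)
      convert this
      ext s
      simp [S]
    · rintro _ ⟨q, rfl⟩
      have : (fun t => k t (S q)) = N.piecewise (fun _ => f t₀ (S q)) (g q) := by
        ext t
        by_cases ht : t ∈ N
        · simp [k, ht]
        · have : ∀ q, f t (S q) = g q t := by
            by_contra hc
            exact ht (hN hc)
          simp [k, ht, this]
      rw [this]
      exact measurable_const.piecewise hNm (hgm q)
  refine ⟨⟨k, hkm⟩, ⟨hk⟩, ?_⟩
  filter_upwards [hNN] with t ht
  show k t = f t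
  simp [k, ht]

/-- By separability every open set is a countable union of balls around a dense sequence. -/
theorem measurable_of_forall_edist {T X : Type*} [MeasurableSpace T] [PseudoEMetricSpace X]
    [SecondCountableTopology X] [MeasurableSpace X] [BorelSpace X] {f : T → X}
    (h : ∀ y, Measurable fun t => edist (f t) y) : Measurable f := by
  refine measurable_of_isOpen fun U hU => ?_
  rcases isEmpty_or_nonempty X with hX | hX
  · rw [U.eq_empty_of_isEmpty]; simp
  obtain ⟨s, hs⟩ := TopologicalSpace.exists_dense_seq X
  have e : f ⁻¹' U = ⋃ (n : ℕ) (k : ℕ) (_ : Metric.eball (s n) (k + 1 : ℝ≥0∞)⁻¹ ⊆ U),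
      {t | edist (f t) (s n) < (k + 1 : ℝ≥0∞)⁻¹} := by
    ext t
    simp only [mem_preimage, mem_iUnion, mem_ofPred_eq, exists_prop]
    constructor
    · intro ht
      obtain ⟨ε, hε, hεU⟩ := EMetric.isOpen_iff.1 hU _ ht
      obtain ⟨k, hk⟩ := ENNReal.exists_inv_nat_lt (ENNReal.half_pos hε.ne').ne'
      have hk' : ((k : ℝ≥0∞) + 1)⁻¹ < ε / 2 :=
        (ENNReal.inv_le_inv.2 le_self_add).trans_lt hk
      have hk0 : 0 < ((k : ℝ≥0∞) + 1)⁻¹ := ENNReal.inv_pos.2 (by finiteness)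
      obtain ⟨n, hn⟩ := hs.exists_mem_open Metric.isOpen_eball
        ⟨f t, Metric.mem_eball_self hk0⟩
      rw [Metric.mem_eball, edist_comm] at hn
      refine ⟨n, k, fun y hy => hεU ?_, hn⟩
      rw [Metric.mem_eball] at hy ⊢
      calc edist y (f t) ≤ edist y (s n) + edist (f t) (s n) := edist_triangle_right _ _ _
        _ < ε / 2 + ε / 2 := ENNReal.add_lt_add (hy.trans hk') (hn.trans hk')
        _ = ε := ENNReal.add_halves ε
    · rintro ⟨n, k, hsub, hlt⟩
      exact hsub hlt
  rw [e]
  refine MeasurableSet.iUnion fun n => MeasurableSet.iUnion fun k => MeasurableSet.iUnion fun _ => ?_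
  exact measurableSet_lt (h _) measurable_const

/-! ### The Wasserstein space -/

variable {m : ℕ}

instance (ν : P2 m) : IsProbabilityMeasure ν.meas := by unfold P2.meas; infer_instance

theorem W2_sq (ν ν' : P2 m) :
    W2 ν ν' ^ 2 = ⨅ π ∈ transportPlans ν ν', ∫⁻ z, edist z.1 z.2 ^ 2 ∂π := by
  rw [W2, ← ENNReal.rpow_natCast, ← ENNReal.rpow_mul]
  norm_num

theorem isProbabilityMeasure_of_mem_transportPlans {ν ν' : P2 m} {π : Measure (E m × E m)}
    (hπ : π ∈ transportPlans ν ν') : IsProbabilityMeasure π := by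
  constructor
  have := congrArg (fun ρ : Measure (E m) => ρ univ) hπ.1
  simpa [Measure.map_apply measurable_fst] using this

theorem exists_plan_of_W2_lt {ν ν' : P2 m} {ε : ℝ≥0∞} (h : W2 ν ν' < ε) :
    ∃ π ∈ transportPlans ν ν', ∫⁻ z, edist z.1 z.2 ^ 2 ∂π < ε ^ 2 := by
  have : W2 ν ν' ^ 2 < ε ^ 2 := ENNReal.pow_lt_pow_left (by norm_num) h
  rw [W2_sq] at this
  simpa only [iInf_lt_iff, exists_prop] using this

theorem W2_lt_of_plan {ν ν' : P2 m} {ε : ℝ≥0∞} {π : Measure (E m × E m)}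
    (hπ : π ∈ transportPlans ν ν') (h : ∫⁻ z, edist z.1 z.2 ^ 2 ∂π < ε ^ 2) : W2 ν ν' < ε := by
  by_contra hc
  have h1 : ε ^ 2 ≤ W2 ν ν' ^ 2 := by gcongr; exact not_lt.1 hc
  rw [W2_sq] at h1
  exact absurd h (not_lt.2 (h1.trans (iInf₂_le π hπ)))

theorem lintegral_fst_plan {ν ν' : P2 m} {π : Measure (E m × E m)} (hπ : π ∈ transportPlans ν ν')
    {f : E m → ℝ≥0∞} (hf : Measurable f) : ∫⁻ z, f z.1 ∂π = ∫⁻ x, f x ∂ν.meas := by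
  rw [← hπ.1, lintegral_map hf measurable_fst]

theorem lintegral_snd_plan {ν ν' : P2 m} {π : Measure (E m × E m)} (hπ : π ∈ transportPlans ν ν')
    {f : E m → ℝ≥0∞} (hf : Measurable f) : ∫⁻ z, f z.2 ∂π = ∫⁻ x, f x ∂ν'.meas := by
  rw [← hπ.2, lintegral_map hf measurable_snd]

theorem lintegral_le_of_plan {ν ν' : P2 m} {π : Measure (E m × E m)}
    (hπ : π ∈ transportPlans ν ν') {δ : ℝ≥0} (hδ : 0 < δ)
    (h : ∫⁻ z, edist z.1 z.2 ^ 2 ∂π ≤ (δ : ℝ≥0∞) ^ 2)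
    {f : E m → ℝ≥0} {K : ℝ≥0} (hf : LipschitzWith K f) :
    ∫⁻ x, f x ∂ν.meas ≤ ∫⁻ x, f x ∂ν'.meas + K * (2 * δ) ∧
      ∫⁻ x, f x ∂ν'.meas ≤ ∫⁻ x, f x ∂ν.meas + K * (2 * δ) := by
  have := isProbabilityMeasure_of_mem_transportPlans hπ
  have hfm : Measurable fun x => (f x : ℝ≥0∞) := by
    have := hf.continuous.measurable
    fun_prop
  have hd0 : (δ : ℝ≥0∞) ≠ 0 := by simpa using hδ.ne'
  have h1 : ∫⁻ z, edist z.1 z.2 ∂π ≤ 2 * δ := by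
    -- The pointwise bound `r ≤ δ + r² / δ` replaces the Cauchy–Schwarz inequality, at the cost of a
    -- factor 2.
    calc ∫⁻ z, edist z.1 z.2 ∂π ≤ ∫⁻ z, (δ + edist z.1 z.2 ^ 2 * (δ : ℝ≥0∞)⁻¹) ∂π := by
          refine lintegral_mono fun z => ?_
          rcases le_total (edist z.1 z.2) δ with hz | hz
          · exact hz.trans le_self_add
          · refine le_trans ?_ le_add_self
            rw [sq, mul_assoc, ← div_eq_mul_inv]
            refine le_mul_of_one_le_right' ?_
            rw [ENNReal.le_div_iff_mul_le (Or.inl hd0) (Or.inl ENNReal.coe_ne_top), one_mul]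
            exact hz
      _ = δ + (∫⁻ z, edist z.1 z.2 ^ 2 ∂π) * (δ : ℝ≥0∞)⁻¹ := by
          rw [lintegral_add_left measurable_const, lintegral_mul_const _ (by fun_prop)]
          simp
      _ ≤ δ + (δ : ℝ≥0∞) ^ 2 * (δ : ℝ≥0∞)⁻¹ := by gcongr
      _ = 2 * δ := by
          rw [sq, mul_assoc, ENNReal.mul_inv_cancel hd0 ENNReal.coe_ne_top]; ring
  have h2 : ∀ x y, (f x : ℝ≥0∞) ≤ f y + K * edist x y := fun x y => by
    have h3 : f x ≤ f y + K * nndist x y := by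
      have := hf.dist_le_mul x y
      rw [NNReal.dist_eq, abs_le] at this
      rw [← NNReal.coe_le_coe]
      push_cast
      linarith [this.2]
    rw [edist_nndist]
    exact_mod_cast h3
  rw [← lintegral_fst_plan hπ hfm, ← lintegral_snd_plan hπ hfm]
  have hm2 : Measurable fun z : E m × E m => (f z.2 : ℝ≥0∞) := hfm.comp measurable_snd
  have hm1 : Measurable fun z : E m × E m => (f z.1 : ℝ≥0∞) := hfm.comp measurable_fst
  constructor
  · calc _ ≤ ∫⁻ z, (f z.2 + K * edist z.1 z.2) ∂π := lintegral_mono fun z => h2 _ _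
      _ = _ := by rw [lintegral_add_left hm2, lintegral_const_mul _ (by fun_prop)]
      _ ≤ _ := by gcongr
  · calc _ ≤ ∫⁻ z, (f z.1 + K * edist z.1 z.2) ∂π := lintegral_mono fun z => by
          rw [edist_comm]; exact h2 _ _
      _ = _ := by rw [lintegral_add_left hm1, lintegral_const_mul _ (by fun_prop)]
      _ ≤ _ := by gcongr

theorem isOpen_P2_iff {U : Set (P2 m)} :
    IsOpen U ↔ ∀ ν ∈ U, ∃ ε : ℝ≥0∞, 0 < ε ∧ ∀ ν', W2 ν ν' < ε → ν' ∈ U := Iff.rfl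

theorem continuous_lintegral_P2 (f : BoundedContinuousFunction (E m) ℝ≥0) {K : ℝ≥0}
    (hf : LipschitzWith K f) : Continuous fun ν : P2 m => ∫⁻ x, f x ∂ν.meas := by
  have hfin : ∀ ν : P2 m, ∫⁻ x, f x ∂ν.meas ≠ ⊤ := fun ν =>
    (BoundedContinuousFunction.lintegral_lt_top_of_nnreal _ f).ne
  refine continuous_def.2 fun U hU => isOpen_P2_iff.2 fun ν hν => ?_
  have hU' : U ∈ 𝓝 (∫⁻ x, f x ∂ν.meas) := hU.mem_nhds hν
  obtain ⟨ε, hε, hεU⟩ := (ENNReal.hasBasis_nhds_of_ne_top (hfin ν)).mem_iff.1 hU'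
  obtain ⟨ε', hε'0, hε'⟩ := ENNReal.lt_iff_exists_nnreal_btwn.1 hε
  have hε'0 : 0 < ε' := by simpa using hε'0
  refine ⟨(ε' / (2 * (K + 1)) : ℝ≥0), ENNReal.coe_pos.2 (by positivity), fun ν' h => hεU ?_⟩
  obtain ⟨π, hπ, hlt⟩ := exists_plan_of_W2_lt h
  obtain ⟨h1, h2⟩ := lintegral_le_of_plan hπ (by positivity) hlt.le hf
  have h3 : (K : ℝ≥0∞) * (2 * ((ε' / (2 * (K + 1)) : ℝ≥0) : ℝ≥0∞)) ≤ ε := by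
    refine le_trans ?_ hε'.le
    norm_cast
    rw [← NNReal.coe_le_coe]
    push_cast
    have hK := K.2
    rw [show (K : ℝ) * (2 * (ε' / (2 * (K + 1)))) = ε' * (K / (K + 1)) by field_simp]
    have : (K : ℝ) / (K + 1) ≤ 1 := by rw [div_le_one (by positivity)]; linarith
    nlinarith [ε'.2]
  exact ⟨tsub_le_iff_right.2 (h1.trans (by gcongr)), h2.trans (by gcongr)⟩

/-- Integrals of Lipschitz functions are `W2`-continuous. This is the passage from Borel sets for
`W2` to the σ-algebra on measures that defines kernels. -/
theorem measurable_meas : Measurable (P2.meas (m := m)) := by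
  have : BorelSpace (P2 m) := ⟨rfl⟩
  exact measurable_of_forall_lipschitz fun f K hf => (continuous_lintegral_P2 f hf).measurable

/-- Under any plan, `|x| ≤ 2 max (|x - y|, |y|)`, whence the factor 4. It turns square integrability
of the distance to one fixed measure into finite energy. -/
theorem lintegral_norm_sq_le (ν ν' : P2 m) :
    ∫⁻ θ, ‖θ‖ₑ ^ 2 ∂ν.meas ≤ 4 * W2 ν ν' ^ 2 + 4 * ∫⁻ θ, ‖θ‖ₑ ^ 2 ∂ν'.meas := by
  have hm : Measurable fun θ : E m => ‖θ‖ₑ ^ 2 := by fun_prop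
  rw [W2_sq, ENNReal.mul_iInf_of_ne (by norm_num) (by norm_num), ENNReal.iInf_add]
  refine le_iInf fun π => ?_
  rw [ENNReal.mul_iInf_of_ne (by norm_num) (by norm_num), ENNReal.iInf_add]
  refine le_iInf fun hπ => ?_
  rw [← lintegral_fst_plan hπ hm, ← lintegral_snd_plan hπ hm, ← mul_add,
    ← lintegral_add_left (by fun_prop), ← lintegral_const_mul _ (by fun_prop)]
  refine lintegral_mono fun z => ?_
  have h1 : ‖z.1‖ₑ ≤ edist z.1 z.2 + ‖z.2‖ₑ := by
    rw [edist_eq_enorm_sub]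
    calc ‖z.1‖ₑ = ‖z.1 - z.2 + z.2‖ₑ := by rw [sub_add_cancel]
      _ ≤ _ := enorm_add_le _ _
  rcases le_total (edist z.1 z.2) ‖z.2‖ₑ with h | h
  · calc ‖z.1‖ₑ ^ 2 ≤ (2 * ‖z.2‖ₑ) ^ 2 := by
          gcongr
          exact h1.trans (by rw [two_mul]; gcongr)
      _ = 4 * ‖z.2‖ₑ ^ 2 := by ring
      _ ≤ _ := by gcongr; exact le_add_self
  · calc ‖z.1‖ₑ ^ 2 ≤ (2 * edist z.1 z.2) ^ 2 := by
          gcongr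
          exact h1.trans (by rw [two_mul]; gcongr)
      _ = 4 * edist z.1 z.2 ^ 2 := by ring
      _ ≤ _ := by gcongr; exact le_self_add

end MeanFieldNet

/-! ### Controls: kernels in place of Wasserstein-valued maps -/

namespace MeanFieldNet

open Filter Topology ProbabilityTheory

variable {m : ℕ}

/-- Markov kernels from `[0,1]` to `ℝᵐ` with square integrable second moments: measurable
representatives of the elements of `L²(0,1;𝒫₂(ℝᵐ))`. -/
structure IsControl (κ : Kernel I (E m)) : Prop where
  markov : IsMarkovKernel κ
  moment_lt_top : ∀ t, ∫⁻ θ, ‖θ‖ₑ ^ 2 ∂κ t < ⊤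
  total_lt_top : ∫⁻ t, ∫⁻ θ, ‖θ‖ₑ ^ 2 ∂κ t < ⊤

theorem measurable_enorm_sq : Measurable fun θ : E m => ‖θ‖ₑ ^ 2 := by fun_prop

/-- The second moment is finite for almost every time; at the other times the kernel is replaced by
the Dirac mass at the origin. -/
theorem exists_isControl_of_kernel (κ : Kernel I (E m)) [IsMarkovKernel κ]
    (h : ∫⁻ t, ∫⁻ θ, ‖θ‖ₑ ^ 2 ∂κ t < ⊤) :
    ∃ κ' : Kernel I (E m), IsControl κ' ∧ ∀ᵐ t, κ' t = κ t := by
  classical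
  have hm : Measurable fun t => ∫⁻ θ, ‖θ‖ₑ ^ 2 ∂κ t :=
    Measurable.lintegral_kernel measurable_enorm_sq
  have hs : MeasurableSet {t | ∫⁻ θ, ‖θ‖ₑ ^ 2 ∂κ t < ⊤} := measurableSet_lt hm measurable_const
  have hae : ∀ᵐ t, Kernel.piecewise hs κ (Kernel.const I (Measure.dirac 0)) t = κ t := by
    filter_upwards [ae_lt_top hm h.ne] with t ht
    rw [Kernel.piecewise_apply]
    exact if_pos ht
  refine ⟨Kernel.piecewise hs κ (Kernel.const I (Measure.dirac 0)), ⟨inferInstance, fun t => ?_, ?_⟩,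
    hae⟩
  · rw [Kernel.piecewise_apply]
    split_ifs with ht
    · exact ht
    · simp [lintegral_dirac]
  · refine lt_of_eq_of_lt (lintegral_congr_ae (hae.mono fun t ht => ?_)) h
    simp only [ht]

theorem PreL2P2.exists_isControl (u : PreL2P2 m) :
    ∃ κ : Kernel I (E m), IsControl κ ∧ ∀ᵐ t, κ t = (u.toFun t).meas := by
  obtain ⟨κ, hκ, hae⟩ := exists_kernel_ae_eq (f := fun t => (u.toFun t).meas)
    (measurable_meas.comp_nullMeasurable u.measurable)
  have hfin : ∫⁻ t, ∫⁻ θ, ‖θ‖ₑ ^ 2 ∂κ t < ⊤ := by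
    obtain ⟨ν, hν⟩ := u.sq_integrable
    calc ∫⁻ t, ∫⁻ θ, ‖θ‖ₑ ^ 2 ∂κ t = ∫⁻ t, ∫⁻ θ, ‖θ‖ₑ ^ 2 ∂(u.toFun t).meas :=
          lintegral_congr_ae (hae.mono fun t ht => by simp only [ht])
      _ ≤ ∫⁻ t : I, (4 * W2 (u.toFun t) ν ^ 2 + 4 * ∫⁻ θ, ‖θ‖ₑ ^ 2 ∂ν.meas) :=
          lintegral_mono fun t => lintegral_norm_sq_le _ _
      _ = 4 * (∫⁻ t : I, W2 (u.toFun t) ν ^ 2) + 4 * ∫⁻ θ, ‖θ‖ₑ ^ 2 ∂ν.meas := by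
          rw [lintegral_add_right _ measurable_const, lintegral_const_mul' _ _ (by norm_num)]
          simp
      _ < ⊤ := ENNReal.add_lt_top.2 ⟨ENNReal.mul_lt_top (by norm_num) hν,
          ENNReal.mul_lt_top (by norm_num) ν.moment_lt_top⟩
  obtain ⟨κ', hκ', hae'⟩ := exists_isControl_of_kernel κ hfin
  exact ⟨κ', hκ', by filter_upwards [hae, hae'] with t h1 h2; rw [h2, h1]⟩

/-- The law of a square integrable random variable. -/
noncomputable def lawP2 (f : Lp (E m) 2 (volume : Measure I)) : P2 m where
  law := ⟨(volume : Measure I).map f,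
    Measure.isProbabilityMeasure_map (Lp.aestronglyMeasurable f).aemeasurable⟩
  moment_lt_top := by
    show ∫⁻ θ, ‖θ‖ₑ ^ 2 ∂((volume : Measure I).map f) < ⊤
    rw [lintegral_map' measurable_enorm_sq.aemeasurable
      (Lp.aestronglyMeasurable f).aemeasurable]
    have := lintegral_rpow_enorm_lt_top_of_eLpNorm_lt_top (by norm_num) (by norm_num)
      (Lp.memLp f).2
    simpa using this

theorem lawP2_meas (f : Lp (E m) 2 (volume : Measure I)) :
    (lawP2 f).meas = (volume : Measure I).map f := rfl

/-- The pair `(f, g)` couples the two laws with cost `‖f - g‖²`, so `W2` of the laws is at most the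
`L²` distance. -/
theorem continuous_lawP2 : Continuous (lawP2 (m := m)) := by
  refine continuous_def.2 fun U hU => EMetric.isOpen_iff.2 fun f hf => ?_
  obtain ⟨ε, hε, h⟩ := isOpen_P2_iff.1 hU _ hf
  refine ⟨ε, hε, fun g hg => h _ ?_⟩
  have hfm := (Lp.aestronglyMeasurable f).aemeasurable
  have hgm := (Lp.aestronglyMeasurable g).aemeasurable
  refine W2_lt_of_plan (π := (volume : Measure I).map fun w => (f w, g w)) ⟨?_, ?_⟩ ?_
  · rw [AEMeasurable.map_map_of_aemeasurable measurable_fst.aemeasurable (hfm.prodMk hgm)]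
    rfl
  · rw [AEMeasurable.map_map_of_aemeasurable measurable_snd.aemeasurable (hfm.prodMk hgm)]
    rfl
  · rw [lintegral_map' (by fun_prop) (hfm.prodMk hgm)]
    rw [Metric.mem_eball, edist_comm, Lp.edist_def, eLpNorm_eq_lintegral_rpow_enorm_toReal
      (by norm_num) (by norm_num)] at hg
    have : ∀ w, edist (f w) (g w) ^ 2 = ‖(f - g : I → E m) w‖ₑ ^ (2 : ℝ≥0∞).toReal := fun w => by
      simp [edist_eq_enorm_sub]
    simp only [this]
    have h2 := ENNReal.pow_lt_pow_left (n := 2) (by norm_num) hg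
    refine lt_of_eq_of_lt ?_ h2
    rw [← ENNReal.rpow_natCast, ← ENNReal.rpow_mul]
    norm_num

theorem W2_dirac_sq_le (ν ν₀ : P2 m) (h : ν₀.meas = Measure.dirac 0) :
    W2 ν ν₀ ^ 2 ≤ ∫⁻ θ, ‖θ‖ₑ ^ 2 ∂ν.meas := by
  rw [W2_sq]
  have hm : Measurable fun x : E m => (x, (0 : E m)) := by fun_prop
  refine (iInf₂_le (ν.meas.map fun x => (x, (0 : E m))) ⟨?_, ?_⟩).trans ?_
  · rw [lintegral_map (by fun_prop) hm]
    simp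
  · rw [Measure.map_map measurable_fst hm]
    exact Measure.map_id
  · rw [Measure.map_map measurable_snd hm, h]
    show Measure.map (fun _ => (0 : E m)) _ = _
    simp [Measure.map_const]

/-- The Dirac mass at the origin. -/
noncomputable def diracP2 (m : ℕ) : P2 m where
  law := ⟨Measure.dirac 0, inferInstance⟩
  moment_lt_top := by
    show ∫⁻ θ, ‖θ‖ₑ ^ 2 ∂(Measure.dirac (0 : E m)) < ⊤
    simp [lintegral_dirac]

/-- The difficulty is measurability for the Borel sets of `W2`. The kernel is realized as the laws
of jointly measurable random variables `f t` on `[0,1]`. The map `t ↦ f t` into the separable space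
`L²` is measurable because distances to fixed points are, and taking laws is continuous. -/
theorem IsControl.exists_preL2P2 {κ : Kernel I (E m)} (hκ : IsControl κ) :
    ∃ u : PreL2P2 m, ∀ t, (u.toFun t).meas = κ t := by
  have := hκ.markov
  obtain ⟨f, hf, hfκ⟩ := κ.exists_measurable_map_eq_unitInterval
  have hft : ∀ t, Measurable (f t) := fun t => hf.comp measurable_prodMk_left
  have hmem : ∀ t, MemLp (f t) 2 (volume : Measure I) := fun t => by
    refine ⟨(hft t).aestronglyMeasurable, ?_⟩
    refine (eLpNorm_lt_top_iff_lintegral_rpow_enorm_lt_top (by norm_num) (by norm_num)).2 ?_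
    have := hκ.moment_lt_top t
    rw [← hfκ t, lintegral_map measurable_enorm_sq (hft t)] at this
    simpa using this
  let g : I → Lp (E m) 2 (volume : Measure I) := fun t => (hmem t).toLp (f t)
  let : MeasurableSpace (Lp (E m) 2 (volume : Measure I)) := borel _
  -- Needed for the second countability of `L²`.
  have : Fact ((2 : ℝ≥0∞) ≠ ⊤) := ⟨by norm_num⟩
  have : BorelSpace (Lp (E m) 2 (volume : Measure I)) := ⟨rfl⟩
  have hg : Measurable g := by
    refine measurable_of_forall_edist fun y => ?_
    have : ∀ t, edist (g t) y = (∫⁻ w, ‖f t w - y w‖ₑ ^ 2) ^ (1 / 2 : ℝ) := fun t => by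
      rw [Lp.edist_def, eLpNorm_eq_lintegral_rpow_enorm_toReal (by norm_num) (by norm_num)]
      have h1 : ∫⁻ w, ‖((g t : I → E m) - y) w‖ₑ ^ (2 : ℝ≥0∞).toReal
          = ∫⁻ w, ‖f t w - y w‖ₑ ^ 2 := by
        refine lintegral_congr_ae ?_
        filter_upwards [(hmem t).coeFn_toLp] with w hw
        simp only [Pi.sub_apply, g, hw]
        norm_num
      rw [h1]
      norm_num
    simp only [this]
    refine Measurable.pow_const (Measurable.lintegral_prod_right' (f := fun p : I × I =>
      ‖f p.1 p.2 - y p.2‖ₑ ^ 2) ?_) _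
    have : Measurable (y : I → E m) := (Lp.stronglyMeasurable y).measurable
    have h2 : Measurable fun p : I × I => f p.1 p.2 := hf
    fun_prop
  have : BorelSpace (P2 m) := ⟨rfl⟩
  have hmeas : ∀ t, (lawP2 (g t)).meas = κ t := fun t => by
    rw [lawP2_meas, ← hfκ t]
    exact Measure.map_congr (hmem t).coeFn_toLp
  refine ⟨⟨fun t => lawP2 (g t), (continuous_lawP2.measurable.comp hg).nullMeasurable,
    diracP2 m, ?_⟩, hmeas⟩
  refine lt_of_le_of_lt (lintegral_mono fun t => W2_dirac_sq_le _ _ rfl) ?_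
  simp only [hmeas]
  exact hκ.total_lt_top

instance : Nonempty (L2P2 m) := by
  have : IsControl (Kernel.const I (Measure.dirac (0 : E m))) :=
    ⟨inferInstance, fun t => by simp [lintegral_dirac], by simp [lintegral_dirac]⟩
  exact ⟨Quotient.mk _ this.exists_preL2P2.choose⟩

end MeanFieldNet

/-! ### Fields that act on one factor of a product -/

namespace Caratheodory

variable {F G : Type*} [NormedAddCommGroup F] [NormedSpace ℝ F] [FiniteDimensional ℝ F]
  [MeasurableSpace F] [BorelSpace F] [NormedAddCommGroup G] [NormedSpace ℝ G]
  [FiniteDimensional ℝ G] [MeasurableSpace G] [BorelSpace G]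

/-- The field which moves only the first coordinate. -/
def prodField (G : Type*) [Zero G] (B : ℝ → F → F) (t : ℝ) (z : F × G) : F × G := (B t z.1, 0)

theorem IsField.prod {B : ℝ → F → F} {L : ℝ → ℝ} (h : IsField B L) :
    IsField (prodField G B) L where
  measurable z := (h.measurable z.1).prodMk measurable_const
  integrable := h.integrable
  nonneg := h.nonneg
  growth t z := by
    simp only [prodField, Prod.norm_mk, norm_zero, norm_nonneg, sup_of_le_left]
    refine (h.growth t z.1).trans (mul_le_mul_of_nonneg_left ?_ (h.nonneg t))
    linarith [norm_fst_le z]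
  lip t z w := by
    simp only [prodField, Prod.mk_sub_mk, sub_zero, Prod.norm_mk, norm_zero, norm_nonneg,
      sup_of_le_left]
    exact (h.lip t z.1 w.1).trans (mul_le_mul_of_nonneg_left (norm_fst_le (z - w)) (h.nonneg t))

theorem intervalIntegral_prodMk {f : ℝ → F} {g : ℝ → G} {a b : ℝ}
    (hf : IntervalIntegrable f volume a b) (hg : IntervalIntegrable g volume a b) :
    ∫ t in a..b, (f t, g t) = (∫ t in a..b, f t, ∫ t in a..b, g t) := by
  have hfg : IntervalIntegrable (fun t => (f t, g t)) volume a b :=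
    ⟨hf.1.prodMk hg.1, hf.2.prodMk hg.2⟩
  ext1
  · exact ((ContinuousLinearMap.fst ℝ F G).intervalIntegral_comp_comm hfg).symm
  · exact ((ContinuousLinearMap.snd ℝ F G).intervalIntegral_comp_comm hfg).symm

theorem IsField.flow_prod {B : ℝ → F → F} {L : ℝ → ℝ} (h : IsField B L) (s t : ℝ) (z : F × G) :
    (h.prod (G := G)).flow s z t = (h.flow s z.1 t, z.2) := by
  have hc := h.continuous_flow s z.1
  have : IsCurve (prodField G B) s z fun t => (h.flow s z.1 t, z.2) := by
    refine ⟨by fun_prop, fun t => ?_⟩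
    simp only [prodField]
    rw [intervalIntegral_prodMk (h.intervalIntegrable_comp hc s t)
      intervalIntegrable_const, h.flow_eq s z.1 t]
    ext1 <;> simp
  exact congrFun (h.prod.isCurve_unique (h.prod.isCurve_flow s z) this) t

end Caratheodory

namespace MeanFieldNet

open Filter Topology ProbabilityTheory Caratheodory

variable {d m : ℕ}

/-! ### The unit interval -/

theorem integral_unitInterval {G : Type*} [NormedAddCommGroup G] [NormedSpace ℝ G] (f : ℝ → G) :
    ∫ t : I, f t = ∫ t in (0)..1, f t := by
  rw [intervalIntegral.integral_of_le zero_le_one, ← integral_Icc_eq_integral_Ioc]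
  exact (unitInterval.measurePreserving_coe.integral_comp unitInterval.measurableEmbedding_coe f)

theorem lintegral_unitInterval (f : ℝ → ℝ≥0∞) : ∫⁻ t : I, f t = ∫⁻ t in I, f t :=
  unitInterval.measurePreserving_coe.lintegral_comp_emb unitInterval.measurableEmbedding_coe f

theorem integrableOn_unitInterval {G : Type*} [NormedAddCommGroup G] {f : ℝ → G} :
    IntegrableOn f I ↔ Integrable fun t : I => f t :=
  (unitInterval.measurePreserving_coe.integrable_comp_emb
    unitInterval.measurableEmbedding_coe).symm

/-- The retraction of the real line to the unit interval. -/
noncomputable abbrev proj (t : ℝ) : I := projIcc 0 1 zero_le_one t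

theorem proj_coe (t : I) : proj t = t := projIcc_val zero_le_one t

theorem measurable_proj : Measurable proj := continuous_projIcc.measurable

/-! ### Velocity fields -/

theorem rpow_le_one_add_sq {a p : ℝ} (ha : 0 ≤ a) (hp0 : 0 ≤ p) (hp2 : p < 2) :
    a ^ p ≤ 1 + a ^ 2 := by
  rcases le_total a 1 with h | h
  · have := Real.rpow_le_one ha h hp0
    nlinarith [sq_nonneg a]
  · have := Real.rpow_le_rpow_of_exponent_le h hp2.le
    rw [Real.rpow_two] at this
    linarith

/-- The growth and Lipschitz conditions on the velocity. -/
structure IsVelocity (v : E d → E m → E d) (C p : ℝ) : Prop where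
  continuous : Continuous (Function.uncurry v)
  pos : 0 < C
  exponent : p ∈ Ico (0 : ℝ) 2
  bound : ∀ x θ, ‖v x θ‖ ≤ C * ‖θ‖ ^ p * (1 + ‖x‖)
  lip : ∀ x₁ x₂ θ, ‖v x₁ θ - v x₂ θ‖ ≤ C * ‖θ‖ ^ p * ‖x₁ - x₂‖

theorem integrable_norm_sq {ν : Measure (E m)} (hν : ∫⁻ θ, ‖θ‖ₑ ^ 2 ∂ν < ⊤) :
    Integrable (fun θ => ‖θ‖ ^ 2) ν := by
  refine ⟨by fun_prop, ?_⟩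
  simpa [HasFiniteIntegral, enorm_pow] using hν

theorem integral_norm_sq (ν : Measure (E m)) :
    ENNReal.ofReal (∫ θ, ‖θ‖ ^ 2 ∂ν) ≤ ∫⁻ θ, ‖θ‖ₑ ^ 2 ∂ν := by
  by_cases h : Integrable (fun θ => ‖θ‖ ^ 2) ν
  · rw [ofReal_integral_eq_lintegral_ofReal h (Eventually.of_forall fun _ => by positivity)]
    refine lintegral_mono fun θ => ?_
    rw [ENNReal.ofReal_pow (norm_nonneg _), ofReal_norm]
  · rw [integral_undef h]; simp

/-- The velocity averaged with a control, extended by zero to all times. -/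
noncomputable def controlField (v : E d → E m → E d) (κ : Kernel I (E m)) (t : ℝ) (x : E d) : E d :=
  (Icc (0 : ℝ) 1).indicator (fun t => ∫ θ, v x θ ∂κ (proj t)) t

/-- The Lipschitz constants of the averaged velocity. -/
noncomputable def controlLip (C p : ℝ) (κ : Kernel I (E m)) (t : ℝ) : ℝ :=
  (Icc (0 : ℝ) 1).indicator (fun t => C * ∫ θ, ‖θ‖ ^ p ∂κ (proj t)) t

theorem controlField_coe (v : E d → E m → E d) (κ : Kernel I (E m)) (t : I) (x : E d) :
    controlField v κ t x = ∫ θ, v x θ ∂κ t := by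
  rw [controlField, indicator_of_mem t.2, proj_coe]

namespace IsVelocity

variable {v : E d → E m → E d} {C p : ℝ} (hv : IsVelocity v C p)
include hv

theorem measurable_rpow : Measurable fun θ : E m => ‖θ‖ ^ p := by fun_prop

theorem rpow_le (θ : E m) : ‖θ‖ ^ p ≤ 1 + ‖θ‖ ^ 2 :=
  rpow_le_one_add_sq (norm_nonneg θ) hv.exponent.1 hv.exponent.2

theorem integrable_rpow {ν : Measure (E m)} [IsProbabilityMeasure ν]
    (hν : ∫⁻ θ, ‖θ‖ₑ ^ 2 ∂ν < ⊤) : Integrable (fun θ => ‖θ‖ ^ p) ν := by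
  refine ((integrable_const (1 : ℝ)).add (integrable_norm_sq hν)).mono'
    hv.measurable_rpow.aestronglyMeasurable (Eventually.of_forall fun θ => ?_)
  rw [Real.norm_of_nonneg (by positivity)]
  exact hv.rpow_le θ

theorem continuous_right (x : E d) : Continuous (v x) :=
  hv.continuous.comp (Continuous.prodMk_right x)

theorem integrable {ν : Measure (E m)} [IsProbabilityMeasure ν]
    (hν : ∫⁻ θ, ‖θ‖ₑ ^ 2 ∂ν < ⊤) (x : E d) : Integrable (v x) ν := by
  refine (((hv.integrable_rpow hν).const_mul C).mul_const (1 + ‖x‖)).mono'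
    (hv.continuous_right x).aestronglyMeasurable (Eventually.of_forall fun θ => hv.bound x θ)

theorem norm_integral_le {ν : Measure (E m)} [IsProbabilityMeasure ν]
    (hν : ∫⁻ θ, ‖θ‖ₑ ^ 2 ∂ν < ⊤) (x : E d) :
    ‖∫ θ, v x θ ∂ν‖ ≤ (C * ∫ θ, ‖θ‖ ^ p ∂ν) * (1 + ‖x‖) := by
  rw [← integral_const_mul, ← integral_mul_const]
  exact norm_integral_le_of_norm_le (((hv.integrable_rpow hν).const_mul C).mul_const _)
    (Eventually.of_forall fun θ => hv.bound x θ)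

theorem norm_integral_sub_le {ν : Measure (E m)} [IsProbabilityMeasure ν]
    (hν : ∫⁻ θ, ‖θ‖ₑ ^ 2 ∂ν < ⊤) (x y : E d) :
    ‖∫ θ, v x θ ∂ν - ∫ θ, v y θ ∂ν‖ ≤ (C * ∫ θ, ‖θ‖ ^ p ∂ν) * ‖x - y‖ := by
  rw [← integral_sub (hv.integrable hν x) (hv.integrable hν y), ← integral_const_mul,
    ← integral_mul_const]
  exact norm_integral_le_of_norm_le (((hv.integrable_rpow hν).const_mul C).mul_const _)
    (Eventually.of_forall fun θ => hv.lip x y θ)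

theorem integral_rpow_le {ν : Measure (E m)} [IsProbabilityMeasure ν]
    (hν : ∫⁻ θ, ‖θ‖ₑ ^ 2 ∂ν < ⊤) : ∫ θ, ‖θ‖ ^ p ∂ν ≤ 1 + ∫ θ, ‖θ‖ ^ 2 ∂ν := by
  calc _ ≤ ∫ θ, (1 + ‖θ‖ ^ 2) ∂ν := integral_mono (hv.integrable_rpow hν)
        ((integrable_const _).add (integrable_norm_sq hν)) hv.rpow_le
    _ = _ := by rw [integral_add (integrable_const _) (integrable_norm_sq hν)]; simp

end IsVelocity

namespace IsControl

variable {κ : Kernel I (E m)} (hκ : IsControl κ)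
include hκ

theorem integrable_integral_norm_sq : Integrable fun t => ∫ θ, ‖θ‖ ^ 2 ∂κ t := by
  have := hκ.markov
  refine ⟨?_, ?_⟩
  · exact (StronglyMeasurable.integral_kernel (f := fun θ : E m => ‖θ‖ ^ 2)
      (by fun_prop : Measurable fun θ : E m => ‖θ‖ ^ 2).stronglyMeasurable).aestronglyMeasurable
  · refine lt_of_le_of_lt (lintegral_mono fun t => ?_) hκ.total_lt_top
    rw [Real.enorm_of_nonneg (integral_nonneg fun _ => by positivity)]
    exact integral_norm_sq (κ t)

variable {v : E d → E m → E d} {C p : ℝ}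

/-- `|θ|^p ≤ 1 + |θ|²`, so the Lipschitz constants are dominated by the energy density. Finite
energy gives integrability in time and no uniform bound, which is why Carathéodory flows are used.
-/
theorem integrable_controlLip (hv : IsVelocity v C p) : Integrable (controlLip C p κ) := by
  have := hκ.markov
  unfold controlLip
  rw [integrable_indicator_iff measurableSet_Icc, integrableOn_unitInterval]
  simp only [proj_coe]
  refine Integrable.const_mul ?_ C
  refine ((integrable_const (1 : ℝ)).add hκ.integrable_integral_norm_sq).mono' ?_
    (Eventually.of_forall fun t => ?_)
  · exact (StronglyMeasurable.integral_kernel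
      hv.measurable_rpow.stronglyMeasurable).aestronglyMeasurable
  · rw [Real.norm_of_nonneg (integral_nonneg fun _ => by positivity)]
    exact hv.integral_rpow_le (hκ.moment_lt_top t)

theorem isField (hv : IsVelocity v C p) : IsField (controlField v κ) (controlLip C p κ) where
  measurable x := by
    have := hκ.markov
    have : Measurable fun t => ∫ θ, v x θ ∂κ t :=
      (StronglyMeasurable.integral_kernel (hv.continuous_right x).stronglyMeasurable).measurable
    exact (this.comp measurable_proj).indicator measurableSet_Icc
  integrable := hκ.integrable_controlLip hv
  nonneg t := indicator_nonneg (fun t _ => mul_nonneg hv.pos.le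
    (integral_nonneg fun _ => by positivity)) t
  growth t x := by
    have := hκ.markov
    unfold controlField controlLip
    by_cases ht : t ∈ I
    · rw [indicator_of_mem ht, indicator_of_mem ht]
      exact hv.norm_integral_le (hκ.moment_lt_top _) x
    · simp [indicator_of_notMem ht]
  lip t x y := by
    have := hκ.markov
    unfold controlField controlLip
    by_cases ht : t ∈ I
    · rw [indicator_of_mem ht, indicator_of_mem ht, indicator_of_mem ht]
      exact hv.norm_integral_sub_le (hκ.moment_lt_top _) x y
    · simp [indicator_of_notMem ht]

end IsControl

end MeanFieldNet

namespace MeanFieldNet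

open Filter Topology ProbabilityTheory Caratheodory

/-! ### Distributional derivatives on the unit interval -/

theorem integral_eq_integral_of_tsupport {g : ℝ → ℝ} (hg : tsupport g ⊆ Ioo 0 1) :
    ∫ t in (0)..1, g t = ∫ t, g t :=
  intervalIntegral.integral_eq_integral_of_support_subset
    ((subset_tsupport g).trans (hg.trans Ioo_subset_Ioc_self))

/-- The support lies in some `[a,b]` inside `(0,1)`. The primitive from 0 vanishes before `a`, and
after `b` it equals the total integral, which is zero. -/
theorem exists_primitive_of_integral_eq_zero {ξ : ℝ → ℝ} (hξ : ContDiff ℝ ∞ ξ)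
    (hc : HasCompactSupport ξ) (hs : tsupport ξ ⊆ Ioo 0 1) (h0 : ∫ t, ξ t = 0) :
    ∃ θ : ℝ → ℝ, ContDiff ℝ ∞ θ ∧ HasCompactSupport θ ∧ tsupport θ ⊆ Ioo 0 1 ∧ deriv θ = ξ := by
  obtain ⟨a, b, ha, hb, hab⟩ : ∃ a b : ℝ, 0 < a ∧ b < 1 ∧ tsupport ξ ⊆ Icc a b := by
    rcases (tsupport ξ).eq_empty_or_nonempty with he | hne
    · exact ⟨1 / 2, 1 / 2, by norm_num, by norm_num, by simp [he]⟩
    · exact ⟨_, _, (hs (hc.isCompact.sInf_mem hne)).1, (hs (hc.isCompact.sSup_mem hne)).2, fun t ht =>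
        ⟨csInf_le hc.isCompact.bddBelow ht, le_csSup hc.isCompact.bddAbove ht⟩⟩
  have hz : ∀ t, t ∉ Icc a b → ξ t = 0 := fun t ht => image_eq_zero_of_notMem_tsupport
    fun h => ht (hab h)
  have hξc := hξ.continuous
  have hd : ∀ t, HasDerivAt (fun t => ∫ r in (0)..t, ξ r) (ξ t) t := fun t =>
    intervalIntegral.integral_hasDerivAt_right (hξc.intervalIntegrable _ _)
      (hξc.stronglyMeasurableAtFilter _ _) hξc.continuousAt
  have hde : deriv (fun t => ∫ r in (0)..t, ξ r) = ξ := funext fun t => (hd t).deriv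
  have hi1 : ∫ r in (0)..1, ξ r = 0 := by rw [integral_eq_integral_of_tsupport hs, h0]
  have hzero : ∀ t, t ∉ Icc a b → ∫ r in (0)..t, ξ r = 0 := by
    intro t ht
    rw [mem_Icc, not_and_or, not_le, not_le] at ht
    rcases ht with ht | ht
    · refine intervalIntegral.integral_zero_ae (Eventually.of_forall fun r hr => hz r fun h => ?_)
      have : r ≤ max 0 t := hr.2
      exact absurd h.1 (not_le.2 (this.trans_lt (max_lt ha ht)))
    · have e : ∫ r in (0)..t, ξ r = (∫ r in (0)..1, ξ r) + ∫ r in (1)..t, ξ r :=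
        (intervalIntegral.integral_add_adjacent_intervals (hξc.intervalIntegrable _ _)
          (hξc.intervalIntegrable _ _)).symm
      rw [e, hi1, zero_add]
      refine intervalIntegral.integral_zero_ae (Eventually.of_forall fun r hr => hz r fun h => ?_)
      have : min 1 t < r := hr.1
      exact absurd h.2 (not_le.2 ((lt_min hb ht).trans this))
  have hts : tsupport (fun t => ∫ r in (0)..t, ξ r) ⊆ Icc a b :=
    closure_minimal (fun t ht => by
      by_contra h
      exact ht (hzero t h)) isClosed_Icc
  refine ⟨fun t => ∫ r in (0)..t, ξ r, ?_, ?_, ?_, hde⟩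
  · rw [contDiff_infty_iff_deriv, hde]
    exact ⟨fun t => (hd t).differentiableAt, hξ⟩
  · exact HasCompactSupport.of_support_subset_isCompact isCompact_Icc
      ((subset_tsupport _).trans hts)
  · exact hts.trans fun t ht => ⟨ha.trans_le ht.1, ht.2.trans_lt hb⟩

theorem exists_bump_unitInterval : ∃ ζ : ℝ → ℝ, ContDiff ℝ ∞ ζ ∧ HasCompactSupport ζ ∧
    tsupport ζ ⊆ Ioo 0 1 ∧ ∫ t, ζ t = 1 := by
  let φ : ContDiffBump (1 / 2 : ℝ) := ⟨1 / 8, 1 / 4, by norm_num, by norm_num⟩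
  refine ⟨φ.normed volume, φ.contDiff_normed, φ.hasCompactSupport_normed, ?_, φ.integral_normed⟩
  rw [φ.tsupport_normed_eq, Real.closedBall_eq_Icc]
  intro t ht
  simp only [φ] at ht
  constructor <;> linarith [ht.1, ht.2]

/-- The du Bois-Reymond lemma: subtracting a multiple of a bump of integral one gives any test
function mean zero, hence makes it a derivative of a test function. Continuity of `H` upgrades
almost everywhere to every point of `[0,1]`, endpoints included. -/
theorem eq_of_forall_integral_deriv_mul {H : ℝ → ℝ} (hH : Continuous H)
    (h : ∀ θ : ℝ → ℝ, ContDiff ℝ ∞ θ → HasCompactSupport θ → tsupport θ ⊆ Ioo 0 1 →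
      ∫ t in (0)..1, deriv θ t * H t = 0) {s t : ℝ} (hs : s ∈ Icc (0 : ℝ) 1)
    (ht : t ∈ Icc (0 : ℝ) 1) : H t = H s := by
  obtain ⟨ζ, hζ, hζc, hζs, hζ1⟩ := exists_bump_unitInterval
  set c := ∫ r, ζ r * H r with hc
  have hint : ∀ ξ : ℝ → ℝ, Continuous ξ → HasCompactSupport ξ → Integrable ξ := fun ξ h1 h2 =>
    h1.integrable_of_hasCompactSupport h2
  have key : ∀ g : ℝ → ℝ, ContDiff ℝ ∞ g → HasCompactSupport g → tsupport g ⊆ Ioo 0 1 →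
      ∫ r, g r • (H r - c) = 0 := by
    intro g hg hgc hgs
    set k := ∫ r, g r
    have i1 := hint _ hg.continuous hgc
    have i2 := hint _ hζ.continuous hζc
    have i3 := hint (fun r => g r * H r) (hg.continuous.mul hH) hgc.mul_right
    have i4 := hint (fun r => ζ r * H r) (hζ.continuous.mul hH) hζc.mul_right
    have hs2 : tsupport (fun r => g r - k * ζ r) ⊆ Ioo 0 1 :=
      (tsupport_sub g fun r => k * ζ r).trans (union_subset hgs
        ((tsupport_mul_subset_right (f := fun _ => k)).trans hζs))
    have hc2 : HasCompactSupport (fun r => g r - k * ζ r) := hgc.sub hζc.mul_left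
    obtain ⟨θ, hθ, hθc, hθs, hθd⟩ := exists_primitive_of_integral_eq_zero
      (ξ := fun r => g r - k * ζ r) (hg.sub (contDiff_const.mul hζ)) hc2 hs2
      (by rw [integral_sub i1 (i2.const_mul k), integral_const_mul, hζ1]; simp [k])
    have h1 := h θ hθ hθc hθs
    rw [hθd, integral_eq_integral_of_tsupport
      ((tsupport_mul_subset_left (f := fun r => g r - k * ζ r) (g := H)).trans hs2)] at h1
    have h2 : ∫ r, (g r - k * ζ r) * H r = (∫ r, g r * H r) - k * c := by
      rw [hc, ← integral_const_mul, ← integral_sub i3 (i4.const_mul k)]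
      congr 1; ext r; ring
    have h3 : ∫ r, g r • (H r - c) = (∫ r, g r * H r) - k * c := by
      simp only [smul_eq_mul, mul_sub]
      rw [integral_sub i3 (i1.mul_const c), integral_mul_const]
    rw [h3, ← h2, h1]
  have hae := isOpen_Ioo.ae_eq_zero_of_integral_contDiff_smul_eq_zero
    ((hH.sub continuous_const).locallyIntegrable.locallyIntegrableOn (Ioo (0 : ℝ) 1)) key
  have hae2 : H =ᵐ[volume.restrict (Icc 0 1)] fun _ => c := by
    rw [Filter.EventuallyEq, ← restrict_Ioo_eq_restrict_Icc, ae_restrict_iff' measurableSet_Ioo]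
    filter_upwards [hae] with r hr hr2
    exact sub_eq_zero.1 (hr hr2)
  have heq := Measure.eqOn_Icc_of_ae_eq volume zero_ne_one hae2 hH.continuousOn continuousOn_const
  rw [heq ht, heq hs]

/-- Integration by parts shows that `f` minus the primitive of `g` has zero distributional
derivative. -/
theorem sub_eq_integral_of_forall_test {f g : ℝ → ℝ} (hf : Continuous f) (hg : Integrable g)
    (h : ∀ θ : ℝ → ℝ, ContDiff ℝ ∞ θ → HasCompactSupport θ → tsupport θ ⊆ Ioo 0 1 →
      ∫ t in (0)..1, (deriv θ t * f t + θ t * g t) = 0) {s t : ℝ} (hs : s ∈ Icc (0 : ℝ) 1)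
    (ht : t ∈ Icc (0 : ℝ) 1) : f t - f s = ∫ r in s..t, g r := by
  have hG : Continuous fun t => ∫ r in (0)..t, g r :=
    intervalIntegral.continuous_primitive (fun _ _ => hg.intervalIntegrable) 0
  have key := eq_of_forall_integral_deriv_mul (H := fun t => f t - ∫ r in (0)..t, g r)
    (hf.sub hG) (fun θ hθ hθc hθs => ?_) hs ht
  · rw [← intervalIntegral.integral_interval_sub_left hg.intervalIntegrable hg.intervalIntegrable]
    have key' : (f t - ∫ r in (0)..t, g r) = f s - ∫ r in (0)..s, g r := key
    linarith
  · have hd : Continuous (deriv θ) := hθ.continuous_deriv (by norm_cast)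
    have e1 := h θ hθ hθc hθs
    have hz : θ 0 = 0 ∧ θ 1 = 0 := ⟨image_eq_zero_of_notMem_tsupport fun h => (hθs h).1.false,
      image_eq_zero_of_notMem_tsupport fun h => (hθs h).2.false⟩
    have e2 := AbsolutelyContinuousOnInterval.integral_mul_deriv_eq_deriv_mul
      (f := θ) (g := fun t => ∫ r in (0)..t, g r) (a := 0) (b := 1)
      (hθ.of_le (by norm_cast) : ContDiff ℝ 1 θ).contDiffOn.absolutelyContinuousOnInterval
      (hg.intervalIntegrable.absolutelyContinuousOnInterval_intervalIntegral (by simp))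
    rw [hz.1, hz.2, zero_mul, zero_mul, sub_zero, zero_sub] at e2
    have e3 : ∫ t in (0)..1, θ t * deriv (fun t => ∫ r in (0)..t, g r) t
        = ∫ t in (0)..1, θ t * g t := by
      refine intervalIntegral.integral_congr_ae ?_
      filter_upwards [(hg.intervalIntegrable (a := 0) (b := 1)).ae_hasDerivAt_integral] with t ht htm
      rw [(ht (uIoc_subset_uIcc htm) 0 (by simp)).deriv]
    rw [e3] at e2
    have i1 : IntervalIntegrable (fun t => deriv θ t * f t) volume 0 1 :=
      (hd.mul hf).intervalIntegrable _ _
    have i2 : IntervalIntegrable (fun t => deriv θ t * ∫ r in (0)..t, g r) volume 0 1 :=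
      (hd.mul hG).intervalIntegrable _ _
    have i3 : IntervalIntegrable (fun t => θ t * g t) volume 0 1 :=
      hg.intervalIntegrable.continuousOn_mul hθ.continuous.continuousOn
    rw [intervalIntegral.integral_add i1 i3] at e1
    simp only [mul_sub]
    rw [intervalIntegral.integral_sub i1 i2]
    linarith

/-! ### Solutions of the continuity equation -/

variable {d m : ℕ} {Y : Set (E d)} {v : E d → E m → E d} {C p : ℝ} {κ : Kernel I (E m)}
  {u : PreL2P2 m} {μ₀ : ProbabilityMeasure (E d × Y)}

/-- The inclusion of `ℝᵈ × Y` in `ℝᵈ × ℝᵈ`. -/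
def inclusion (z : E d × Y) : E d × E d := (z.1, z.2)

theorem continuous_inclusion : Continuous (inclusion (Y := Y)) := by unfold inclusion; fun_prop

theorem measurable_inclusion : Measurable (inclusion (Y := Y)) := by unfold inclusion; fun_prop

/-- The curve of measures on `ℝᵈ × ℝᵈ` induced by a curve of measures on `ℝᵈ × Y`. -/
noncomputable def pushCurve (μ : C(I, ProbabilityMeasure (E d × Y))) (t : ℝ) :
    Measure (E d × E d) := (μ (proj t) : Measure (E d × Y)).map inclusion

theorem avgField_ae_eq (hae : ∀ᵐ t, κ t = (u.toFun t).meas) :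
    ∀ᵐ t : I, ∀ x, avgField v (u.toFun t) x = controlField v κ t x := by
  filter_upwards [hae] with t ht x
  rw [avgField, controlField_coe, ht]

theorem measurable_pushCurve (μ : C(I, ProbabilityMeasure (E d × Y))) :
    Measurable (pushCurve μ) :=
  (Measure.measurable_map _ measurable_inclusion).comp
    ((measurable_coe_of_continuous μ.continuous).comp measurable_proj)

/-- Space-time test functions of product form identify the distributional derivative of `t ↦ ∫ f
dμ_t`; narrow continuity makes this an integrated identity between any two times, with time 0
included. -/
theorem isWeakSolution_pushCurve (hv : IsVelocity v C p) (hκ : IsControl κ)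
    (hae : ∀ᵐ t, κ t = (u.toFun t).meas) {μ : C(I, ProbabilityMeasure (E d × Y))}
    (hμ : IsSolution v μ₀ u μ) :
    IsWeakSolution (prodField (E d) (controlField v κ)) (pushCurve μ) := by
  have hB := (hκ.isField hv).prod (G := E d)
  set B := prodField (E d) (controlField v κ) with hBdef
  have hprob : ∀ t, IsProbabilityMeasure (pushCurve μ t) := fun t =>
    Measure.isProbabilityMeasure_map measurable_inclusion.aemeasurable
  have hmeas := measurable_pushCurve μ
  let K : Kernel ℝ (E d × E d) := ⟨pushCurve μ, hmeas⟩
  have hK : IsMarkovKernel K := ⟨hprob⟩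
  have hBz : ∀ t, t ∉ Icc (0 : ℝ) 1 → B t = 0 := fun t ht => by
    ext1 z
    simp only [hBdef, prodField, controlField]
    rw [indicator_of_notMem ht]
    rfl
  have hlm : Measurable fun t => ∫⁻ z, ‖B t z‖ₑ ∂pushCurve μ t :=
    Measurable.lintegral_kernel_prod_right' (κ := K) (f := fun p : ℝ × (E d × E d) => ‖B p.1 p.2‖ₑ)
      (hB.measurable_uncurry.enorm)
  have hfin : ∫⁻ t, ∫⁻ z, ‖B t z‖ₑ ∂pushCurve μ t < ⊤ := by
    have e : ∫⁻ t, ∫⁻ z, ‖B t z‖ₑ ∂pushCurve μ t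
        = ∫⁻ t in Icc (0 : ℝ) 1, ∫⁻ z, ‖B t z‖ₑ ∂pushCurve μ t := by
      refine (setLIntegral_eq_of_support_subset fun t ht => ?_).symm
      by_contra hc
      exact ht (by simp [hBz t hc])
    rw [e]
    refine lt_of_eq_of_lt ?_ hμ.field_integrable
    rw [← lintegral_unitInterval (fun t => ∫⁻ z, ‖B t z‖ₑ ∂pushCurve μ t)]
    refine lintegral_congr_ae ?_
    filter_upwards [avgField_ae_eq hae] with t ht
    have hBt : Measurable fun z => ‖B t z‖ₑ := (hB.continuous t).measurable.enorm
    simp only [pushCurve, proj_coe]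
    rw [lintegral_map hBt measurable_inclusion]
    refine lintegral_congr fun z => ?_
    rw [ht]
    have e2 : ‖((controlField v κ t z.1, 0) : E d × E d)‖ = ‖controlField v κ t z.1‖ := by
      rw [Prod.norm_mk, norm_zero, sup_of_le_left (norm_nonneg _)]
    show ‖((controlField v κ t z.1, 0) : E d × E d)‖ₑ = _
    rw [← ofReal_norm, e2, ofReal_norm]
  have hae_int : ∀ᵐ t, Integrable (B t) (pushCurve μ t) := by
    filter_upwards [ae_lt_top hlm hfin.ne] with t ht
    exact ⟨(hB.continuous t).aestronglyMeasurable, ht⟩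
  refine ⟨hprob, hmeas, hae_int, ⟨?_, ?_⟩, fun f hf hfc s t hs hst ht => ?_⟩
  · exact (StronglyMeasurable.integral_kernel_prod_right' (κ := K)
      (f := fun p : ℝ × (E d × E d) => ‖B p.1 p.2‖)
      hB.measurable_uncurry.norm.stronglyMeasurable).aestronglyMeasurable
  · refine lt_of_le_of_lt (lintegral_mono fun t => ?_) hfin
    refine (enorm_integral_le_lintegral_enorm _).trans (lintegral_mono fun z => ?_)
    simp
  have hf1 : ContDiff ℝ 1 f := hf.of_le (by norm_cast)
  obtain ⟨R', hR'⟩ := hfc.isCompact.isBounded.exists_norm_le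
  obtain ⟨R, hR0, hR⟩ : ∃ R : ℝ, 0 ≤ R ∧ ∀ x, R < ‖x‖ → f x = 0 :=
    ⟨max R' 0, le_max_right _ _, fun x hx => image_eq_zero_of_notMem_tsupport fun h =>
      absurd (hR' x h) (not_le.2 ((le_max_left _ _).trans_lt hx))⟩
  obtain ⟨Kf, hKf⟩ : ∃ Kf, ∀ x, ‖fderiv ℝ f x‖ ≤ Kf :=
    (hfc.fderiv ℝ).exists_bound_of_continuous (hf1.continuous_fderiv (by norm_num))
  have hDm : Measurable fun p : ℝ × (E d × E d) => fderiv ℝ f p.2 (B p.1 p.2) := by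
    have h3 : Continuous fun q : (E d × E d) × (E d × E d) => fderiv ℝ f q.1 q.2 :=
      (((hf1.continuous_fderiv (by norm_num)).comp continuous_fst).clm_apply continuous_snd)
    exact h3.measurable.comp (measurable_snd.prodMk hB.measurable_uncurry)
  have hDi : ∀ t, Integrable (fun z => fderiv ℝ f z (B t z)) (pushCurve μ t) := fun t =>
    (integrable_const (Kf * (1 + R) * controlLip C p κ t)).mono'
      (hDm.comp measurable_prodMk_left).aestronglyMeasurable
      (Eventually.of_forall fun z => hB.abs_fderiv_apply_le hKf hR hR0 t z)
  have hFc : Continuous fun t => ∫ z, f z ∂pushCurve μ t := by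
    have e : ∀ t, ∫ z, f z ∂pushCurve μ t = ∫ z, f (inclusion z) ∂(μ (proj t) : Measure (E d × Y)) :=
      fun t => integral_map measurable_inclusion.aemeasurable hf.continuous.aestronglyMeasurable
    simp only [e]
    obtain ⟨b, hb⟩ := hfc.exists_bound_of_continuous hf.continuous
    let fb : BoundedContinuousFunction (E d × Y) ℝ := BoundedContinuousFunction.ofNormedAddCommGroup
      (fun z => f (inclusion z)) (hf.continuous.comp continuous_inclusion) b fun z => hb _
    exact continuous_iff_continuousAt.2 fun t =>
      ProbabilityMeasure.tendsto_iff_forall_integral_tendsto.1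
        ((μ.continuous.comp continuous_projIcc).tendsto t) fb
  have hGi : Integrable fun t => ∫ z, fderiv ℝ f z (B t z) ∂pushCurve μ t := by
    refine (hB.integrable.const_mul (Kf * (1 + R))).mono' ?_ (Eventually.of_forall fun t => ?_)
    · exact (StronglyMeasurable.integral_kernel_prod_right' (κ := K)
        hDm.stronglyMeasurable).aestronglyMeasurable
    · have := norm_integral_le_of_norm_le_const (μ := pushCurve μ t)
        (f := fun z => fderiv ℝ f z (B t z))
        (Eventually.of_forall fun z => hB.abs_fderiv_apply_le hKf hR hR0 t z)
      simpa using this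
  refine sub_eq_integral_of_forall_test hFc hGi (fun θ hθ hθc hθs => ?_) ⟨hs, hst.trans ht⟩
    ⟨hs.trans hst, ht⟩
  -- The tensor product of `θ` and `f` is the test function inserted in the weak formulation.
  set φ : ℝ × E d × E d → ℝ := fun q => θ q.1 * f q.2 with hφ
  have hφd : ∀ q w, fderiv ℝ φ q w = θ q.1 * fderiv ℝ f q.2 w.2 + f q.2 * (deriv θ q.1 * w.1) := by
    intro q w
    have h1 : HasFDerivAt (fun q : ℝ × E d × E d => θ q.1)
        ((fderiv ℝ θ q.1).comp (ContinuousLinearMap.fst ℝ ℝ (E d × E d))) q :=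
      ((hθ.differentiable (by norm_num)).differentiableAt.hasFDerivAt).comp q hasFDerivAt_fst
    have h2 : HasFDerivAt (fun q : ℝ × E d × E d => f q.2)
        ((fderiv ℝ f q.2).comp (ContinuousLinearMap.snd ℝ ℝ (E d × E d))) q :=
      ((hf1.differentiable (by norm_num)).differentiableAt.hasFDerivAt).comp q hasFDerivAt_snd
    have h3 : fderiv ℝ φ q = _ := (h1.mul h2).fderiv
    rw [h3]
    simp [mul_comm]
  have hφs : tsupport φ ⊆ tsupport θ ×ˢ tsupport f := by
    refine closure_minimal (fun q hq => ?_) ((isClosed_tsupport _).prod (isClosed_tsupport _))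
    exact ⟨subset_tsupport _ (left_ne_zero_of_mul hq), subset_tsupport _ (right_ne_zero_of_mul hq)⟩
  have hw := hμ.weak φ ((hθ.comp contDiff_fst).mul (hf.comp contDiff_snd))
    (HasCompactSupport.of_support_subset_isCompact (hθc.isCompact.prod hfc.isCompact)
      ((subset_tsupport _).trans hφs))
    (hφs.trans (prod_mono hθs (subset_univ _)))
  rw [← integral_unitInterval, ← hw]
  refine integral_congr_ae ?_
  filter_upwards [avgField_ae_eq (v := v) hae] with t ht
  have i1 : Integrable (fun z => deriv θ t * f z) (pushCurve μ t) :=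
    (integrable_of_continuous_of_eq_zero hf.continuous hR).const_mul _
  have i2 := (hDi t).const_mul (θ t)
  rw [← integral_const_mul, ← integral_const_mul, ← integral_add i1 i2, pushCurve,
    integral_map measurable_inclusion.aemeasurable (by
      rw [← pushCurve]; exact (i1.add i2).aestronglyMeasurable)]
  simp only [proj_coe]
  refine integral_congr_ae (Eventually.of_forall fun z => ?_)
  simp only [hφd, ht]
  simp only [hBdef, prodField, inclusion, Prod.mk_zero_zero, map_zero]
  ring

end MeanFieldNet

/-! ### Existence, uniqueness and the functional along the flow -/

namespace MeanFieldNet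

open Filter Topology ProbabilityTheory Caratheodory

variable {d m : ℕ} {Y : Set (E d)} {v : E d → E m → E d} {C p : ℝ} {κ : Kernel I (E m)}
  {u : PreL2P2 m} {μ₀ : ProbabilityMeasure (E d × Y)}

theorem measurableEmbedding_inclusion (hY : MeasurableSet Y) :
    MeasurableEmbedding (inclusion (Y := Y)) :=
  MeasurableEmbedding.id.prodMap (MeasurableEmbedding.subtype_coe hY)

theorem exists_ae_norm_le_of_isCompact_support
    (h : IsCompact (μ₀ : Measure (E d × Y)).support) :
    ∃ R : ℝ, 0 ≤ R ∧ ∀ᵐ z ∂(μ₀ : Measure (E d × Y)), ‖z.1‖ ≤ R := by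
  obtain ⟨R, hR⟩ := (h.image continuous_fst).isBounded.exists_norm_le
  refine ⟨max R 0, le_max_right _ _, ?_⟩
  filter_upwards [Measure.support_mem_ae (μ := (μ₀ : Measure (E d × Y)))] with z hz
  exact (hR z.1 (mem_image_of_mem _ hz)).trans (le_max_left _ _)

/-- The image of `μ₀` under the flow of a field on the first coordinate. -/
noncomputable def flowCurve {B : ℝ → E d → E d} {L : ℝ → ℝ} (h : IsField B L)
    (μ₀ : ProbabilityMeasure (E d × Y)) : C(I, ProbabilityMeasure (E d × Y)) where
  toFun t := μ₀.map (f := fun z : E d × Y => (h.flow 0 z.1 t, z.2))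
    (((h.continuous_flow_right 0 t).comp continuous_fst).prodMk continuous_snd).aemeasurable
  continuous_toFun := by
    refine continuous_iff_continuousAt.2 fun t =>
      ProbabilityMeasure.tendsto_iff_forall_integral_tendsto.2 fun f => ?_
    have e : ∀ s : I, ∫ z, f z ∂(μ₀.map (f := fun z : E d × Y => (h.flow 0 z.1 s, z.2))
        (((h.continuous_flow_right 0 s).comp continuous_fst).prodMk
          continuous_snd).aemeasurable : Measure (E d × Y))
        = ∫ z, f (h.flow 0 z.1 s, z.2) ∂(μ₀ : Measure (E d × Y)) := fun s => by
      rw [ProbabilityMeasure.toMeasure_map]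
      exact integral_map (((h.continuous_flow_right 0 s).comp continuous_fst).prodMk
          continuous_snd).aemeasurable f.continuous.aestronglyMeasurable
    simp only [e]
    refine (continuous_of_dominated (F := fun (s : I) (z : E d × Y) => f (h.flow 0 z.1 s, z.2))
      (bound := fun _ => ‖f‖) (fun s => ?_) (fun s => Eventually.of_forall fun z =>
      f.norm_coe_le_norm _) (integrable_const _) (Eventually.of_forall fun z => ?_)).tendsto t
    · exact (f.continuous.comp (((h.continuous_flow_right 0 s).comp continuous_fst).prodMk
          continuous_snd)).aestronglyMeasurable
    · exact f.continuous.comp (((h.continuous_flow 0 z.1).comp continuous_subtype_val).prodMk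
          continuous_const)

section

variable {B : ℝ → E d → E d} {L : ℝ → ℝ} (h : IsField B L)
include h

theorem measurable_flowMap (t : ℝ) :
    Measurable fun z : E d × Y => (h.flow 0 z.1 t, z.2) :=
  (((h.continuous_flow_right 0 t).comp continuous_fst).prodMk continuous_snd).measurable

theorem flowCurve_coe (t : I) : (flowCurve h μ₀ t : Measure (E d × Y))
    = (μ₀ : Measure (E d × Y)).map fun z => (h.flow 0 z.1 t, z.2) := rfl

theorem flowCurve_zero : flowCurve h μ₀ 0 = μ₀ := by
  apply Subtype.ext
  show (flowCurve h μ₀ 0 : Measure (E d × Y)) = _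
  rw [flowCurve_coe]
  have : (fun z : E d × Y => (h.flow 0 z.1 ((0 : I) : ℝ), z.2)) = id := by
    funext z
    simp [h.flow_self]
  rw [this, Measure.map_id]
  rfl

theorem norm_field_flow_le {R t : ℝ} {x : E d} (hx : ‖x‖ ≤ R) :
    ‖B t (h.flow 0 x t)‖ ≤ L t * (flowConst L * (1 + R)) := by
  refine (h.growth t _).trans (mul_le_mul_of_nonneg_left ?_ (h.nonneg t))
  refine (h.growth_flow 0 t x).trans (mul_le_mul_of_nonneg_left (by linarith) ?_)
  exact (flowConst_pos L).le

theorem measurable_fieldFlow : Measurable fun q : ℝ × E d => B q.1 (h.flow 0 q.2 q.1) :=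
  h.measurable_uncurry.comp (measurable_fst.prodMk (h.measurable_flow_uncurry 0))

/-- The space-time curve `t ↦ (t, flow 0 x t, y)` is a primitive of `(1, B, 0)`, so the chain rule
leaves only the endpoint values of `φ`. -/
theorem integral_fderiv_flow {φ : ℝ × E d × E d → ℝ} (hφ : ContDiff ℝ 1 φ)
    (h0 : ∀ w, φ (0, w) = 0) (h1 : ∀ w, φ (1, w) = 0) (x y : E d) :
    ∫ t in (0)..1, fderiv ℝ φ (t, h.flow 0 x t, y) (1, B t (h.flow 0 x t), 0) = 0 := by
  have hi := fun a b => h.intervalIntegrable_comp (h.continuous_flow 0 x) a b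
  have hi2 : ∀ a b : ℝ, IntervalIntegrable
      (fun t => (B t (h.flow 0 x t), (0 : E d))) volume a b := fun a b =>
    ⟨(hi a b).1.prodMk (integrable_zero _ _ _), (hi a b).2.prodMk (integrable_zero _ _ _)⟩
  have hi3 : ∀ a b : ℝ, IntervalIntegrable
      (fun t => ((1 : ℝ), B t (h.flow 0 x t), (0 : E d))) volume a b := fun a b =>
    ⟨(integrable_const _).prodMk (hi2 a b).1, (integrable_const _).prodMk (hi2 a b).2⟩
  have hc : ∀ t, ((0 : ℝ), x, y) + ∫ r in (0)..t, ((1 : ℝ), B r (h.flow 0 x r), (0 : E d))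
      = (t, h.flow 0 x t, y) := fun t => by
    rw [intervalIntegral_prodMk intervalIntegrable_const (hi2 0 t),
      intervalIntegral_prodMk (hi 0 t) intervalIntegrable_const, h.flow_eq 0 x t]
    simp
  have key := integral_fderiv_comp_primitive (hi3 0 1) ((0 : ℝ), x, y) hφ
  simp only [hc] at key
  rw [key, h1, h0, sub_zero]

end

/-- After a change of variables to `μ₀` and Fubini, the weak formulation reduces to
`integral_fderiv_flow` on each trajectory. The compact support of `μ₀` supplies the radius `R` in
the integrable bounds. -/
theorem isSolution_flowCurve (hv : IsVelocity v C p) (hκ : IsControl κ)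
    (hae : ∀ᵐ t, κ t = (u.toFun t).meas)
    (hμ₀ : IsCompact (μ₀ : Measure (E d × Y)).support) :
    IsSolution v μ₀ u (flowCurve (hκ.isField hv) μ₀) := by
  obtain ⟨R, hR0, hR⟩ := exists_ae_norm_le_of_isCompact_support hμ₀
  have h := hκ.isField hv
  set L := controlLip C p κ
  have hM := measurable_fieldFlow h
  refine ⟨flowCurve_zero h, ?_, fun φ hφ hφc hφs => ?_⟩
  · have e : ∫⁻ t : I, ∫⁻ z, ‖avgField v (u.toFun t) z.1‖ₑ
          ∂(flowCurve h μ₀ t : Measure (E d × Y))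
        ≤ ∫⁻ t : I, ENNReal.ofReal (L t * (flowConst L * (1 + R))) := by
      refine lintegral_mono_ae ?_
      filter_upwards [avgField_ae_eq (v := v) hae] with t ht
      simp only [ht]
      have hBt : Measurable fun z : E d × Y => ‖controlField v κ t z.1‖ₑ :=
        ((h.continuous t).measurable.comp measurable_fst).enorm
      rw [flowCurve_coe, lintegral_map hBt (measurable_flowMap h t)]
      calc _ ≤ ∫⁻ z, ENNReal.ofReal (L t * (flowConst L * (1 + R))) ∂(μ₀ : Measure (E d × Y)) := by
            refine lintegral_mono_ae ?_
            filter_upwards [hR] with z hz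
            rw [← ofReal_norm]
            exact ENNReal.ofReal_le_ofReal (norm_field_flow_le h hz)
        _ = _ := by simp
    refine e.trans_lt ?_
    have hi : Integrable fun t : I => L t * (flowConst L * (1 + R)) :=
      (integrableOn_unitInterval.1 h.integrable.integrableOn).mul_const _
    exact hi.lintegral_lt_top
  · have hφ1 : ContDiff ℝ 1 φ := hφ.of_le (by norm_cast)
    have hz : ∀ w, φ (0, w) = 0 ∧ φ (1, w) = 0 := fun w =>
      ⟨image_eq_zero_of_notMem_tsupport fun h => (hφs h).1.1.false,
        image_eq_zero_of_notMem_tsupport fun h => (hφs h).1.2.false⟩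
    obtain ⟨K, hK⟩ : ∃ K, ∀ q, ‖fderiv ℝ φ q‖ ≤ K :=
      (hφc.fderiv ℝ).exists_bound_of_continuous (hφ1.continuous_fderiv (by norm_num))
    have hdc : Continuous fun q : (ℝ × E d × E d) × (ℝ × E d × E d) => fderiv ℝ φ q.1 q.2 :=
      ((hφ1.continuous_fderiv (by norm_num)).comp continuous_fst).clm_apply continuous_snd
    let Φ : ℝ → E d × Y → ℝ := fun t z =>
      fderiv ℝ φ (t, h.flow 0 z.1 t, z.2) (1, controlField v κ t (h.flow 0 z.1 t), 0)
    have hΦm : Measurable (Function.uncurry Φ) := by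
      have h1 : Measurable fun q : ℝ × (E d × Y) => h.flow 0 q.2.1 q.1 :=
        (h.measurable_flow_uncurry 0).comp
          (measurable_fst.prodMk (measurable_fst.comp measurable_snd))
      have h2 : Measurable fun q : ℝ × (E d × Y) =>
          controlField v κ q.1 (h.flow 0 q.2.1 q.1) :=
        hM.comp (measurable_fst.prodMk (measurable_fst.comp measurable_snd))
      refine hdc.measurable.comp ((measurable_fst.prodMk (h1.prodMk ?_)).prodMk
        (measurable_const.prodMk (h2.prodMk measurable_const)))
      exact measurable_subtype_coe.comp (measurable_snd.comp measurable_snd)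
    have hΦi : Integrable (Function.uncurry Φ)
        ((volume.restrict (Ioc 0 1)).prod (μ₀ : Measure (E d × Y))) := by
      have hb : Integrable (fun q : ℝ × (E d × Y) => K * (1 + L q.1 * (flowConst L * (1 + R))))
          ((volume.restrict (Ioc 0 1)).prod (μ₀ : Measure (E d × Y))) := by
        have : Integrable (fun t => K * (1 + L t * (flowConst L * (1 + R))))
            (volume.restrict (Ioc 0 1)) :=
          ((integrable_const _).add (h.integrable.restrict.mul_const _)).const_mul K
        exact this.comp_fst _
      refine hb.mono' hΦm.aestronglyMeasurable ?_
      have : ∀ᵐ q ∂((volume.restrict (Ioc (0 : ℝ) 1)).prod (μ₀ : Measure (E d × Y))),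
          ‖q.2.1‖ ≤ R := Measure.quasiMeasurePreserving_snd.ae hR
      filter_upwards [this] with q hq
      have hK0 : 0 ≤ K := (norm_nonneg _).trans (hK 0)
      refine (ContinuousLinearMap.le_opNorm _ _).trans (mul_le_mul (hK _) ?_ (norm_nonneg _) hK0)
      have hn := norm_field_flow_le h (t := q.1) hq
      simp only [Prod.norm_mk, norm_one, norm_zero]
      have := norm_nonneg (controlField v κ q.1 (h.flow 0 q.2.1 q.1))
      refine max_le (by linarith) (max_le (by linarith) (by linarith))
    have e1 : ∫ t : I, ∫ z : E d × Y,
        (fderiv ℝ φ ((t : ℝ), z.1, (z.2 : E d)) (1, 0, 0)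
          + fderiv ℝ φ ((t : ℝ), z.1, (z.2 : E d)) (0, avgField v (u.toFun t) z.1, 0))
        ∂(flowCurve h μ₀ t : Measure (E d × Y))
        = ∫ t : I, ∫ z, Φ t z ∂(μ₀ : Measure (E d × Y)) := by
      refine integral_congr_ae ?_
      filter_upwards [avgField_ae_eq (v := v) hae] with t ht
      simp only [ht]
      have hBm := h.continuous t
      rw [flowCurve_coe, integral_map (measurable_flowMap h t).aemeasurable]
      · refine integral_congr_ae (Eventually.of_forall fun z => ?_)
        simp only [Φ]
        rw [← map_add]
        simp
      · have c1 : Continuous fun z : E d × Y =>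
            (((t : ℝ), z.1, (z.2 : E d)), ((1 : ℝ), (0 : E d), (0 : E d))) := by fun_prop
        have c2 : Continuous fun z : E d × Y =>
            (((t : ℝ), z.1, (z.2 : E d)), ((0 : ℝ), controlField v κ t z.1, (0 : E d))) := by
          fun_prop
        exact ((hdc.comp c1).add (hdc.comp c2)).aestronglyMeasurable
    rw [e1, integral_unitInterval (fun t => ∫ z, Φ t z ∂(μ₀ : Measure (E d × Y))),
      intervalIntegral.integral_of_le zero_le_one, integral_integral_swap hΦi]
    refine integral_eq_zero_of_ae (Eventually.of_forall fun z => ?_)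
    simp only [← intervalIntegral.integral_of_le zero_le_one, Φ]
    exact integral_fderiv_flow h hφ1 (fun w => (hz w).1) (fun w => (hz w).2) z.1 z.2

/-- Uniqueness is obtained on the vector space `ℝᵈ × ℝᵈ` from `eq_map_flow` and pulled back along
the inclusion, a measurable embedding since `Y` is measurable. -/
theorem IsSolution.eq_flowCurve (hv : IsVelocity v C p) (hκ : IsControl κ)
    (hae : ∀ᵐ t, κ t = (u.toFun t).meas) (hY : MeasurableSet Y)
    {μ : C(I, ProbabilityMeasure (E d × Y))} (hμ : IsSolution v μ₀ u μ) :
    μ = flowCurve (hκ.isField hv) μ₀ := by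
  have h := hκ.isField hv
  have h2 := h.prod (G := E d)
  ext1 t
  apply Subtype.ext
  show (μ t : Measure (E d × Y)) = (flowCurve h μ₀ t : Measure (E d × Y))
  have key := h2.eq_map_flow (isWeakSolution_pushCurve hv hκ hae hμ) t.2.1 t.2.2
  have h0 : proj 0 = 0 := proj_coe 0
  have hf : Measurable fun z : E d × E d => h2.flow 0 z t :=
    (h2.continuous_flow_right 0 t).measurable
  rw [pushCurve, pushCurve, proj_coe, h0, hμ.initial, Measure.map_map hf measurable_inclusion] at key
  have e : (fun z : E d × E d => h2.flow 0 z t) ∘ inclusion (Y := Y)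
      = inclusion ∘ fun z : E d × Y => (h.flow 0 z.1 t, z.2) := by
    funext z
    simp only [Function.comp, inclusion]
    rw [h.flow_prod]
  rw [e, ← Measure.map_map measurable_inclusion (measurable_flowMap h t), ← flowCurve_coe] at key
  have hemb := measurableEmbedding_inclusion hY
  rw [← hemb.comap_map (μ t : Measure (E d × Y)), key, hemb.comap_map]

theorem existsUnique_isSolution (hv : IsVelocity v C p) (hY : MeasurableSet Y)
    (hμ₀ : IsCompact (μ₀ : Measure (E d × Y)).support) (u : PreL2P2 m) :
    ∃! μ, IsSolution v μ₀ u μ := by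
  obtain ⟨κ, hκ, hae⟩ := u.exists_isControl
  exact ⟨_, isSolution_flowCurve hv hκ hae hμ₀, fun μ hμ => hμ.eq_flowCurve hv hκ hae hY⟩

theorem solution_eq_flowCurve (hv : IsVelocity v C p) (hκ : IsControl κ)
    (hae : ∀ᵐ t, κ t = (u.toFun t).meas) (hY : MeasurableSet Y)
    (hμ₀ : IsCompact (μ₀ : Measure (E d × Y)).support) :
    solution v μ₀ u = flowCurve (hκ.isField hv) μ₀ := by
  have hex : ∃ μ, IsSolution v μ₀ u μ := ⟨_, isSolution_flowCurve hv hκ hae hμ₀⟩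
  rw [solution, dif_pos hex]
  exact hex.choose_spec.eq_flowCurve hv hκ hae hY

theorem preJ_eq (hv : IsVelocity v C p) (hκ : IsControl κ)
    (hae : ∀ᵐ t, κ t = (u.toFun t).meas) (hY : MeasurableSet Y)
    (hμ₀ : IsCompact (μ₀ : Measure (E d × Y)).support) (lam : ℝ) {l : E d × Y → ℝ≥0}
    (hl : Measurable l) :
    preJ lam v l μ₀ u
      = ∫⁻ z, (l ((hκ.isField hv).flow 0 z.1 1, z.2) : ℝ≥0∞) ∂(μ₀ : Measure (E d × Y))
        + ENNReal.ofReal (lam / 2) * ∫⁻ t, ∫⁻ θ, ‖θ‖ₑ ^ 2 ∂κ t := by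
  rw [preJ, solution_eq_flowCurve hv hκ hae hY hμ₀, flowCurve_coe,
    lintegral_map hl.coe_nnreal_ennreal (measurable_flowMap (hκ.isField hv) _)]
  congr 2
  refine lintegral_congr_ae ?_
  filter_upwards [hae] with t ht
  simp only [ht]

theorem preJ_lt_top (hv : IsVelocity v C p) (hY : MeasurableSet Y)
    (hμ₀ : IsCompact (μ₀ : Measure (E d × Y)).support) (lam : ℝ) {l : E d × Y → ℝ≥0}
    (hl : Measurable l) {A B : ℝ} (hB : 0 ≤ B) (hgrowth : ∀ x y, (l (x, y) : ℝ) ≤ A + B * ‖x‖ ^ 2)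
    (u : PreL2P2 m) : preJ lam v l μ₀ u < ⊤ := by
  obtain ⟨κ, hκ, hae⟩ := u.exists_isControl
  rw [preJ_eq hv hκ hae hY hμ₀ lam hl]
  refine ENNReal.add_lt_top.2 ⟨?_, ENNReal.mul_lt_top ENNReal.ofReal_lt_top hκ.total_lt_top⟩
  obtain ⟨R, hR0, hR⟩ := exists_ae_norm_le_of_isCompact_support hμ₀
  have h := hκ.isField hv
  set L := controlLip C p κ
  calc _ ≤ ∫⁻ z, ENNReal.ofReal (A + B * (flowConst L * (1 + R)) ^ 2) ∂(μ₀ : Measure (E d × Y)) := by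
        refine lintegral_mono_ae ?_
        filter_upwards [hR] with z hz
        rw [← ENNReal.ofReal_coe_nnreal]
        refine ENNReal.ofReal_le_ofReal ((hgrowth _ _).trans ?_)
        have h1 := h.growth_flow 0 1 z.1
        have h2 : flowConst L * (1 + ‖z.1‖) ≤ flowConst L * (1 + R) :=
          mul_le_mul_of_nonneg_left (by linarith) (flowConst_pos L).le
        have h3 := norm_nonneg (h.flow 0 z.1 1)
        gcongr
        linarith
    _ < ⊤ := by simp

end MeanFieldNet

namespace MeanFieldNet

open Filter Topology ProbabilityTheory

variable {m : ℕ} {κ κ' : Kernel I (E m)}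

/-! ### Compactness of sets of controls -/

/-- The law of the pair of a uniformly distributed time and the control at that time. -/
noncomputable def IsControl.joint (hκ : IsControl κ) : ProbabilityMeasure (I × E m) :=
  ⟨(volume : Measure I) ⊗ₘ κ, by have := hκ.markov; infer_instance⟩

theorem IsControl.coe_joint (hκ : IsControl κ) :
    (hκ.joint : Measure (I × E m)) = (volume : Measure I) ⊗ₘ κ := rfl

theorem measurable_enorm_snd_sq : Measurable fun q : I × E m => ‖q.2‖ₑ ^ 2 := by fun_prop

theorem IsControl.lintegral_joint (hκ : IsControl κ) :
    ∫⁻ q, ‖q.2‖ₑ ^ 2 ∂(hκ.joint : Measure (I × E m)) = ∫⁻ t, ∫⁻ θ, ‖θ‖ₑ ^ 2 ∂κ t := by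
  have := hκ.markov
  rw [hκ.coe_joint, Measure.lintegral_compProd measurable_enorm_snd_sq]

/-- Portmanteau: the liminf inequality on open sets passes to nonnegative continuous functions,
bounded or not. -/
theorem lintegral_enorm_sq_le_liminf {ν : ProbabilityMeasure (I × E m)}
    {νs : ℕ → ProbabilityMeasure (I × E m)} (h : Tendsto νs atTop (𝓝 ν)) :
    ∫⁻ q, ‖q.2‖ₑ ^ 2 ∂(ν : Measure (I × E m))
      ≤ liminf (fun n => ∫⁻ q, ‖q.2‖ₑ ^ 2 ∂(νs n : Measure (I × E m))) atTop := by
  have e : ∀ q : I × E m, ‖q.2‖ₑ ^ 2 = ENNReal.ofReal (‖q.2‖ ^ 2) := fun q => by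
    rw [ENNReal.ofReal_pow (norm_nonneg _), ofReal_norm]
  simp only [e]
  exact lintegral_le_liminf_lintegral_of_forall_isOpen_measure_le_liminf_measure (by fun_prop)
    (fun q => sq_nonneg _) fun G hG => ProbabilityMeasure.le_liminf_measure_open_of_tendsto h hG

theorem isTightMeasureSet_of_lintegral_enorm_sq_le {K : ℝ≥0∞} (hK : K ≠ ⊤) :
    IsTightMeasureSet {ν : Measure (I × E m) | ∫⁻ q, ‖q.2‖ₑ ^ 2 ∂ν ≤ K} := by
  refine isTightMeasureSet_iff_exists_isCompact_measure_compl_le.2 fun ε hε => ?_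
  obtain ⟨R, hR⟩ : ∃ R : ℝ≥0, K / (R : ℝ≥0∞) ^ 2 ≤ ε ∧ R ≠ 0 := by
    have h1 : Tendsto (fun n : ℕ => K / (((n : ℝ≥0) : ℝ≥0∞)) ^ 2) atTop (𝓝 0) := by
      have h2 : Tendsto (fun n : ℕ => ((n : ℝ≥0∞)) ^ 2) atTop (𝓝 ⊤) := by
        have := ENNReal.Tendsto.pow (n := 2) ENNReal.tendsto_nat_nhds_top
        simpa using this
      have h3 := ENNReal.Tendsto.const_div (a := K) h2 (Or.inr hK)
      simpa using h3
    obtain ⟨n, hn, hn1⟩ := ((h1.eventually_lt_const hε).and (eventually_ge_atTop 1)).exists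
    exact ⟨n, hn.le, by positivity⟩
  refine ⟨univ ×ˢ Metric.closedBall 0 R, isCompact_univ.prod (isCompact_closedBall _ _),
    fun ν hν => ?_⟩
  have hsub : (univ ×ˢ Metric.closedBall (0 : E m) R)ᶜ
      ⊆ {q : I × E m | (R : ℝ≥0∞) ^ 2 ≤ ‖q.2‖ₑ ^ 2} := by
    intro q hq
    have : ¬ ‖q.2‖ ≤ R := by simpa using hq
    have h2 : (R : ℝ≥0∞) ≤ ‖q.2‖ₑ := by
      rw [enorm_eq_nnnorm, ENNReal.coe_le_coe]
      exact (not_le.1 this).le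
    exact pow_le_pow_left' h2 2
  calc ν _ ≤ ν {q : I × E m | (R : ℝ≥0∞) ^ 2 ≤ ‖q.2‖ₑ ^ 2} := measure_mono hsub
    _ ≤ (∫⁻ q, ‖q.2‖ₑ ^ 2 ∂ν) / (R : ℝ≥0∞) ^ 2 := by
        refine meas_ge_le_lintegral_div measurable_enorm_snd_sq.aemeasurable ?_ ?_
        · simpa using hR.2
        · exact ENNReal.pow_ne_top ENNReal.coe_ne_top
    _ ≤ K / (R : ℝ≥0∞) ^ 2 := ENNReal.div_le_div_right hν _
    _ ≤ ε := hR.1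

/-- Disintegration over the first marginal recovers the kernel. -/
theorem exists_joint_eq {ν : ProbabilityMeasure (I × E m)}
    (h1 : (ν : Measure (I × E m)).fst = volume)
    (h2 : ∫⁻ q, ‖q.2‖ₑ ^ 2 ∂(ν : Measure (I × E m)) < ⊤) :
    ∃ κ : Kernel I (E m), ∃ hκ : IsControl κ, hκ.joint = ν := by
  have hd := (ν : Measure (I × E m)).disintegrate (ν : Measure (I × E m)).condKernel
  rw [h1] at hd
  have hfin : ∫⁻ t, ∫⁻ θ, ‖θ‖ₑ ^ 2 ∂(ν : Measure (I × E m)).condKernel t < ⊤ := by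
    rw [← Measure.lintegral_compProd measurable_enorm_snd_sq, hd]
    exact h2
  obtain ⟨κ, hκ, hae⟩ := exists_isControl_of_kernel _ hfin
  have := hκ.markov
  refine ⟨κ, hκ, Subtype.ext ?_⟩
  show (volume : Measure I) ⊗ₘ κ = (ν : Measure (I × E m))
  rw [← hd]
  exact Measure.compProd_congr hae

/-- Young-measure compactness: bounded energy makes the joint laws tight, so Prokhorov's theorem
applies. Their first marginal is always Lebesgue measure and the energy bound is closed, so the
limit is again the joint law of a control. -/
theorem exists_subseq_tendsto_joint {κ : ℕ → Kernel I (E m)} (hκ : ∀ n, IsControl (κ n))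
    {K : ℝ≥0∞} (hK : K ≠ ⊤) (hb : ∀ n, ∫⁻ t, ∫⁻ θ, ‖θ‖ₑ ^ 2 ∂κ n t ≤ K) :
    ∃ κ' : Kernel I (E m), ∃ hκ' : IsControl κ', ∃ φ : ℕ → ℕ, StrictMono φ ∧
      Tendsto (fun n => (hκ (φ n)).joint) atTop (𝓝 hκ'.joint) := by
  have hc := isCompact_closure_of_isTightMeasureSet
    (S := {ν : ProbabilityMeasure (I × E m) | ∫⁻ q, ‖q.2‖ₑ ^ 2 ∂(ν : Measure (I × E m)) ≤ K})
    ((isTightMeasureSet_of_lintegral_enorm_sq_le hK).subset fun ν ⟨ν', h, e⟩ => e ▸ h)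
  obtain ⟨ν, -, φ, hφ, hν⟩ := hc.isSeqCompact (x := fun n => (hκ n).joint) fun n =>
    subset_closure ((hκ n).lintegral_joint.trans_le (hb n))
  have hfst : ∀ n, ((hκ n).joint : Measure (I × E m)).fst = volume := fun n => by
    have := (hκ n).markov
    rw [(hκ n).coe_joint, Measure.fst_compProd]
  have h1 : (ν : Measure (I × E m)).fst = volume := by
    have hm := ((ProbabilityMeasure.continuous_map
      (continuous_fst : Continuous (Prod.fst : I × E m → I))).tendsto ν).comp hν
    let vol : ProbabilityMeasure I := ⟨volume, inferInstance⟩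
    have he : ∀ n, (hκ (φ n)).joint.map
        (continuous_fst : Continuous (Prod.fst : I × E m → I)).aemeasurable = vol := fun n =>
      Subtype.ext (hfst (φ n))
    have hlim := tendsto_nhds_unique hm (by
      simp only [Function.comp_def, he]
      exact tendsto_const_nhds)
    exact congrArg Subtype.val hlim
  have h2 : ∫⁻ q, ‖q.2‖ₑ ^ 2 ∂(ν : Measure (I × E m)) ≤ K := by
    refine (lintegral_enorm_sq_le_liminf hν).trans ?_
    refine liminf_le_of_le (by isBoundedDefault) fun b hb' => ?_
    obtain ⟨n, hn⟩ := hb'.exists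
    exact hn.trans ((hκ (φ n)).lintegral_joint.trans_le (hb _))
  obtain ⟨κ', hκ', rfl⟩ := exists_joint_eq h1 (h2.trans_lt hK.lt_top)
  exact ⟨κ', hκ', φ, hφ, hν⟩

/-- Weak convergence passes to the integrals of continuous functions of small growth. -/
theorem tendsto_integral_of_growth {X : Type*} [TopologicalSpace X] [MeasurableSpace X]
    [OpensMeasurableSpace X] {ν : ProbabilityMeasure X} {νs : ℕ → ProbabilityMeasure X}
    (h : Tendsto νs atTop (𝓝 ν)) {w f : X → ℝ} {K : ℝ} (hw0 : ∀ x, 0 ≤ w x)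
    (hw : Integrable w (ν : Measure X)) (hwK : ∫ x, w x ∂(ν : Measure X) ≤ K)
    (hws : ∀ n, Integrable w (νs n : Measure X)) (hwsK : ∀ n, ∫ x, w x ∂(νs n : Measure X) ≤ K)
    (hf : Continuous f) (hfw : ∀ δ > 0, ∃ M, ∀ x, |f x| ≤ δ * w x + M) :
    Tendsto (fun n => ∫ x, f x ∂(νs n : Measure X)) atTop (𝓝 (∫ x, f x ∂(ν : Measure X))) := by
  have hK0 : 0 ≤ K := (integral_nonneg hw0).trans hwK
  refine Metric.tendsto_atTop.2 fun ε hε => ?_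
  -- Makes each of the two truncation errors `δ K` less than `ε / 4`; `K + 1` covers `K = 0`.
  set δ := ε / (4 * (K + 1)) with hδ
  have hδ0 : 0 < δ := by positivity
  obtain ⟨M', hM'⟩ := hfw δ hδ0
  obtain ⟨M, hM0, hM⟩ : ∃ M, 0 ≤ M ∧ ∀ x, |f x| ≤ δ * w x + M :=
    ⟨max M' 0, le_max_right _ _, fun x => (hM' x).trans (by linarith [le_max_left M' 0])⟩
  -- The truncation of `f` at height `M` differs from `f` by at most `δ w`, uniformly small in the
  -- mean.
  let g : BoundedContinuousFunction X ℝ := BoundedContinuousFunction.ofNormedAddCommGroup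
    (fun x => max (-M) (min (f x) M)) (by fun_prop) M fun x =>
      abs_le.2 ⟨le_max_left _ _, max_le (by linarith) (min_le_right _ _)⟩
  have hfg : ∀ x, |f x - g x| ≤ δ * w x := fun x => by
    have h1 := abs_le.1 (hM x)
    have h2 := mul_nonneg hδ0.le (hw0 x)
    show |f x - max (-M) (min (f x) M)| ≤ δ * w x
    rw [abs_le]
    rcases le_total (f x) M with h3 | h3
    · rw [min_eq_left h3]
      rcases le_total (-M) (f x) with h4 | h4
      · rw [max_eq_right h4]; constructor <;> linarith
      · rw [max_eq_left h4]; constructor <;> linarith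
    · rw [min_eq_right h3, max_eq_right (by linarith)]; constructor <;> linarith
  have est : ∀ ρ : ProbabilityMeasure X, Integrable w (ρ : Measure X) →
      ∫ x, w x ∂(ρ : Measure X) ≤ K →
      |∫ x, f x ∂(ρ : Measure X) - ∫ x, g x ∂(ρ : Measure X)| ≤ δ * K := fun ρ hi hk => by
    have hfi : Integrable f (ρ : Measure X) := ((hi.const_mul δ).add (integrable_const M)).mono'
      hf.aestronglyMeasurable (Eventually.of_forall hM)
    rw [← integral_sub hfi (g.integrable _)]
    refine (norm_integral_le_of_norm_le (f := fun x => f x - g x) (hi.const_mul δ)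
      (Eventually.of_forall hfg)).trans ?_
    rw [integral_const_mul]
    exact mul_le_mul_of_nonneg_left hk hδ0.le
  have hδK : δ * K < ε / 4 := by
    have : δ * (K + 1) = ε / 4 := by rw [hδ]; field_simp
    linarith
  obtain ⟨N, hN⟩ := Metric.tendsto_atTop.1
    (ProbabilityMeasure.tendsto_iff_forall_integral_tendsto.1 h g) (ε / 4) (by positivity)
  refine ⟨N, fun n hn => ?_⟩
  have h1 := abs_le.1 (est _ (hws n) (hwsK n))
  have h2 := abs_le.1 (est _ hw hwK)
  have h3 := hN n hn
  rw [Real.dist_eq, abs_lt] at h3 ⊢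
  constructor <;> linarith [h1.1, h1.2, h2.1, h2.2, h3.1, h3.2]

end MeanFieldNet

/-! ### Continuity of the flow with respect to the control -/

namespace MeanFieldNet

open Filter Topology ProbabilityTheory Caratheodory

variable {d m : ℕ} {v : E d → E m → E d} {C p K R δ M : ℝ} {κ : Kernel I (E m)}

/-- Here the strict inequality `p < 2` is used. Beyond the threshold `A`, where `A^(p-2) = δ`, the
power `p` is at most `δ` times the square; below it, `A^p` is a bound. -/
theorem exists_rpow_le (hp : p ∈ Ico (0 : ℝ) 2) (hδ : 0 < δ) :
    ∃ M, 0 ≤ M ∧ ∀ a : ℝ, 0 ≤ a → a ^ p ≤ δ * a ^ 2 + M := by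
  set A := δ ^ (1 / (p - 2)) with hA
  have hp2 : p - 2 < 0 := by linarith [hp.2]
  have hA0 : 0 < A := by positivity
  have hAδ : A ^ (p - 2) = δ := by
    rw [hA, ← Real.rpow_mul hδ.le, one_div_mul_cancel hp2.ne, Real.rpow_one]
  refine ⟨A ^ p, by positivity, fun a ha => ?_⟩
  rcases le_total A a with h | h
  · have h1 := Real.rpow_le_rpow_of_nonpos hA0 h hp2.le
    rw [hAδ] at h1
    have h2 : a ^ p = a ^ (p - 2) * a ^ 2 := by
      rw [← Real.rpow_two, ← Real.rpow_add (hA0.trans_le h), sub_add_cancel]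
    have h3 : 0 ≤ A ^ p := by positivity
    have := mul_le_mul_of_nonneg_right h1 (sq_nonneg a)
    linarith
  · have := Real.rpow_le_rpow ha h hp.1
    have h2 : 0 ≤ δ * a ^ 2 := by positivity
    linarith

/-- The bound `K` on the total second moment of a control. -/
def HasEnergyLe (κ : Kernel I (E m)) (K : ℝ) : Prop :=
  ∫⁻ t, ∫⁻ θ, ‖θ‖ₑ ^ 2 ∂κ t ≤ ENNReal.ofReal K

namespace IsControl

variable (hκ : IsControl κ)
include hκ

theorem integral_joint_norm_sq_le (hK0 : 0 ≤ K) (hK : HasEnergyLe κ K) :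
    Integrable (fun q => ‖q.2‖ ^ 2) (hκ.joint : Measure (I × E m)) ∧
      ∫ q, ‖q.2‖ ^ 2 ∂(hκ.joint : Measure (I × E m)) ≤ K := by
  have e : ∫⁻ q, ENNReal.ofReal (‖q.2‖ ^ 2) ∂(hκ.joint : Measure (I × E m))
      ≤ ENNReal.ofReal K := by
    refine le_trans (le_of_eq ?_) (hκ.lintegral_joint.trans_le hK)
    simp only [ENNReal.ofReal_pow (norm_nonneg _), ofReal_norm]
  have hc : Continuous fun q : I × E m => ‖q.2‖ ^ 2 := by fun_prop
  have h0 : ∀ᵐ q ∂(hκ.joint : Measure (I × E m)), 0 ≤ ‖q.2‖ ^ 2 :=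
    Eventually.of_forall fun q => sq_nonneg _
  refine ⟨⟨hc.aestronglyMeasurable, ?_⟩, ?_⟩
  · rw [hasFiniteIntegral_iff_ofReal h0]
    exact e.trans_lt ENNReal.ofReal_lt_top
  · rw [integral_eq_lintegral_of_nonneg_ae h0 hc.aestronglyMeasurable]
    exact ENNReal.toReal_le_of_le_ofReal hK0 e

theorem integral_integral_norm_sq_le (hK0 : 0 ≤ K) (hK : HasEnergyLe κ K) :
    ∫ t, ∫ θ, ‖θ‖ ^ 2 ∂κ t ≤ K := by
  have := hκ.markov
  obtain ⟨h1, h2⟩ := hκ.integral_joint_norm_sq_le hK0 hK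
  rwa [hκ.coe_joint, Measure.integral_compProd h1] at h2

variable (hv : IsVelocity v C p)
include hv

theorem integral_controlLip_le (hK0 : 0 ≤ K) (hK : HasEnergyLe κ K) :
    ∫ t, controlLip C p κ t ≤ C * (1 + K) := by
  have := hκ.markov
  have hi := hκ.integrable_controlLip hv
  have e : ∫ t, controlLip C p κ t = ∫ t : I, controlLip C p κ t := by
    rw [integral_unitInterval, intervalIntegral.integral_of_le zero_le_one,
      ← integral_Icc_eq_integral_Ioc]
    refine (setIntegral_eq_integral_of_forall_compl_eq_zero fun t ht => ?_).symm
    exact indicator_of_notMem ht _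
  rw [e]
  calc _ ≤ ∫ t : I, C * (1 + ∫ θ, ‖θ‖ ^ 2 ∂κ t) := by
        refine integral_mono (integrableOn_unitInterval.1 hi.integrableOn)
          (((integrable_const _).add hκ.integrable_integral_norm_sq).const_mul C) fun t => ?_
        simp only [controlLip]
        rw [indicator_of_mem t.2, proj_coe]
        exact mul_le_mul_of_nonneg_left (hv.integral_rpow_le (hκ.moment_lt_top t)) hv.pos.le
    _ ≤ C * (1 + K) := by
        rw [integral_const_mul, integral_add (integrable_const _) hκ.integrable_integral_norm_sq]
        refine mul_le_mul_of_nonneg_left ?_ hv.pos.le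
        have := hκ.integral_integral_norm_sq_le hK0 hK
        simpa using this

theorem flowConst_controlLip_le (hK0 : 0 ≤ K) (hK : HasEnergyLe κ K) :
    flowConst (controlLip C p κ) ≤ 2 * Real.exp (2 * (C * (1 + K))) := by
  unfold flowConst
  have := hκ.integral_controlLip_le hv hK0 hK
  gcongr

theorem integral_rpow_le (hδ : ∀ a : ℝ, 0 ≤ a → a ^ p ≤ δ * a ^ 2 + M) (t : I) :
    ∫ θ, ‖θ‖ ^ p ∂κ t ≤ δ * (∫ θ, ‖θ‖ ^ 2 ∂κ t) + M := by
  have := hκ.markov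
  have hi := (integrable_norm_sq (hκ.moment_lt_top t)).const_mul δ
  calc _ ≤ ∫ θ, (δ * ‖θ‖ ^ 2 + M) ∂κ t := integral_mono
        (hv.integrable_rpow (hκ.moment_lt_top t)) (hi.add (integrable_const M))
        fun θ => hδ _ (norm_nonneg θ)
    _ = _ := by rw [integral_add hi (integrable_const M), integral_const_mul]; simp

/-- Small weights `j` have small integrals against the velocity, uniformly in the control. -/
theorem norm_integral_smul_le (hK0 : 0 ≤ K) (hK : HasEnergyLe κ K) {X : ℝ → E d}
    (hX : ∀ t : I, 1 + ‖X t‖ ≤ R) (hδ0 : 0 ≤ δ)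
    (hδ : ∀ a : ℝ, 0 ≤ a → a ^ p ≤ δ * a ^ 2 + M) {j : I → ℝ} (hj : Integrable j)
    (hj2 : ∀ t, |j t| ≤ 2) :
    ‖∫ t, j t • ∫ θ, v (X t) θ ∂κ t‖ ≤ C * R * (2 * δ * K + M * ∫ t, |j t|) := by
  have := hκ.markov
  have hR : 0 ≤ R := le_trans (by positivity) (hX 0)
  have hCR : 0 ≤ C * R := mul_nonneg hv.pos.le hR
  have hi := hκ.integrable_integral_norm_sq
  refine (norm_integral_le_of_norm_le (g := fun t : I =>
    C * R * (2 * δ * (∫ θ, ‖θ‖ ^ 2 ∂κ t) + M * |j t|)) ?_ (Eventually.of_forall fun t => ?_)).trans ?_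
  · exact ((hi.const_mul _).add (hj.abs.const_mul M)).const_mul _
  · rw [norm_smul, Real.norm_eq_abs]
    have h1 := hv.norm_integral_le (hκ.moment_lt_top t) (X t)
    have h2 := hκ.integral_rpow_le hv hδ t
    have h3 : 0 ≤ ∫ θ, ‖θ‖ ^ 2 ∂κ t := integral_nonneg fun _ => by positivity
    have h4 : 0 ≤ ∫ θ, ‖θ‖ ^ p ∂κ t := integral_nonneg fun _ => by positivity
    calc |j t| * ‖∫ θ, v (X t) θ ∂κ t‖
        ≤ |j t| * (C * (∫ θ, ‖θ‖ ^ p ∂κ t) * R) := by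
          refine mul_le_mul_of_nonneg_left (h1.trans ?_) (abs_nonneg _)
          exact mul_le_mul_of_nonneg_left (hX t) (mul_nonneg hv.pos.le h4)
      _ ≤ |j t| * (C * (δ * (∫ θ, ‖θ‖ ^ 2 ∂κ t) + M) * R) := by
          have := hv.pos.le
          gcongr
      _ = C * R * (|j t| * (δ * ∫ θ, ‖θ‖ ^ 2 ∂κ t) + M * |j t|) := by ring
      _ ≤ _ := by
          refine mul_le_mul_of_nonneg_left ?_ hCR
          have := mul_le_mul_of_nonneg_right (hj2 t) (mul_nonneg hδ0 h3)
          linarith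
  · rw [integral_const_mul, integral_add (hi.const_mul _) (hj.abs.const_mul M),
      integral_const_mul, integral_const_mul]
    refine mul_le_mul_of_nonneg_left ?_ hCR
    have := mul_le_mul_of_nonneg_left (hκ.integral_integral_norm_sq_le hK0 hK)
      (by positivity : 0 ≤ 2 * δ)
    linarith

theorem integrable_integral_comp {X : ℝ → E d} (hX : Continuous X) :
    Integrable fun t : I => ∫ θ, v (X t) θ ∂κ t := by
  have h := (hκ.isField hv).intervalIntegrable_comp hX 0 1
  rw [intervalIntegrable_iff_integrableOn_Icc_of_le zero_le_one] at h
  have h2 := integrableOn_unitInterval.1 h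
  simpa only [controlField_coe] using h2

theorem integrable_smul_integral_comp {X : ℝ → E d} (hX : Continuous X) {j : I → ℝ}
    (hj : Measurable j) {c : ℝ} (hjc : ∀ t, |j t| ≤ c) :
    Integrable fun t : I => j t • ∫ θ, v (X t) θ ∂κ t :=
  (hκ.integrable_integral_comp hv hX).bdd_smul c hj.aestronglyMeasurable
    (Eventually.of_forall hjc)

theorem norm_integral_smul_sub_le (hK0 : 0 ≤ K) (hK : HasEnergyLe κ K) {X : ℝ → E d}
    (hXc : Continuous X) (hX : ∀ t : I, 1 + ‖X t‖ ≤ R) (hδ0 : 0 ≤ δ)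
    (hδ : ∀ a : ℝ, 0 ≤ a → a ^ p ≤ δ * a ^ 2 + M) {i j : I → ℝ} (hi : Measurable i)
    (hj : Measurable j) (hi1 : ∀ t, |i t| ≤ 1) (hj1 : ∀ t, |j t| ≤ 1) :
    ‖(∫ t, i t • ∫ θ, v (X t) θ ∂κ t) - ∫ t, j t • ∫ θ, v (X t) θ ∂κ t‖
      ≤ C * R * (2 * δ * K + M * ∫ t, |i t - j t|) := by
  have hb : ∀ t, |i t - j t| ≤ 2 := fun t =>
    (abs_sub _ _).trans (by linarith [hi1 t, hj1 t])
  rw [← integral_sub (hκ.integrable_smul_integral_comp hv hXc hi hi1)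
    (hκ.integrable_smul_integral_comp hv hXc hj hj1)]
  simp only [← sub_smul]
  refine hκ.norm_integral_smul_le hv hK0 hK hX hδ0 hδ ?_ hb
  exact (integrable_const (2 : ℝ)).mono' (hi.sub hj).aestronglyMeasurable (Eventually.of_forall hb)

theorem integrable_joint_velocity (hK0 : 0 ≤ K) (hK : HasEnergyLe κ K) {X : ℝ → E d}
    (hXc : Continuous X) (hX : ∀ t : I, 1 + ‖X t‖ ≤ R) {g : I → ℝ} (hg : Continuous g) {G : ℝ}
    (hG : ∀ t, |g t| ≤ G) :
    Integrable (fun q : I × E m => g q.1 • v (X q.1) q.2) (hκ.joint : Measure (I × E m)) := by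
  have hc : Continuous fun q : I × E m => g q.1 • v (X q.1) q.2 := by
    have h1 : Continuous fun q : I × E m => v (X q.1) q.2 :=
      hv.continuous.comp ((hXc.comp (continuous_subtype_val.comp continuous_fst)).prodMk
        continuous_snd)
    exact (hg.comp continuous_fst).smul h1
  refine (((integrable_const (1 : ℝ)).add (hκ.integral_joint_norm_sq_le hK0 hK).1).const_mul
    (G * C * R)).mono' hc.aestronglyMeasurable (Eventually.of_forall fun q => ?_)
  have hR : 0 ≤ R := le_trans (by positivity) (hX 0)
  have hG0 : 0 ≤ G := (abs_nonneg _).trans (hG 0)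
  have hC := hv.pos.le
  rw [norm_smul, Real.norm_eq_abs]
  calc |g q.1| * ‖v (X q.1) q.2‖ ≤ G * (C * ‖q.2‖ ^ p * (1 + ‖X q.1‖)) :=
        mul_le_mul (hG _) (hv.bound _ _) (norm_nonneg _) hG0
    _ ≤ G * (C * (1 + ‖q.2‖ ^ 2) * R) := by
        have h1 := hv.rpow_le q.2
        have h2 := hX q.1
        gcongr
    _ = G * C * R * (1 + ‖q.2‖ ^ 2) := by ring

theorem integral_joint_velocity (hK0 : 0 ≤ K) (hK : HasEnergyLe κ K) {X : ℝ → E d}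
    (hXc : Continuous X) (hX : ∀ t : I, 1 + ‖X t‖ ≤ R) {g : I → ℝ} (hg : Continuous g) {G : ℝ}
    (hG : ∀ t, |g t| ≤ G) :
    ∫ q : I × E m, g q.1 • v (X q.1) q.2 ∂(hκ.joint : Measure (I × E m))
      = ∫ t, g t • ∫ θ, v (X t) θ ∂κ t := by
  have := hκ.markov
  rw [hκ.coe_joint, Measure.integral_compProd
    (hκ.integrable_joint_velocity hv hK0 hK hXc hX hg hG)]
  simp only [integral_smul]

end IsControl

theorem tendsto_euclideanSpace {x : ℕ → E d} {a : E d}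
    (h : ∀ i, Tendsto (fun n => x n i) atTop (𝓝 (a i))) : Tendsto x atTop (𝓝 a) := by
  have h1 : Tendsto (fun n => EuclideanSpace.equiv (Fin d) ℝ (x n)) atTop
      (𝓝 (EuclideanSpace.equiv (Fin d) ℝ a)) := tendsto_pi_nhds.2 h
  have h2 := ((EuclideanSpace.equiv (Fin d) ℝ).symm.continuous.tendsto _).comp h1
  simpa [Function.comp_def] using h2

section

variable {κs : ℕ → Kernel I (E m)} (hv : IsVelocity v C p) (hκ : IsControl κ)
  (hκs : ∀ n, IsControl (κs n)) (hK0 : 0 ≤ K) (hK : HasEnergyLe κ K)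
  (hKs : ∀ n, HasEnergyLe (κs n) K)
  (hlim : Tendsto (fun n => (hκs n).joint) atTop (𝓝 hκ.joint))
include hv hκs hK0 hK hKs hlim

/-- Against the joint law, each component of `g t • v (X t) θ` is a continuous function of `(t, θ)`
growing at most like `|θ|^p`, so weak convergence with bounded energy suffices. -/
theorem tendsto_integral_continuous_smul {X : ℝ → E d} (hXc : Continuous X)
    (hX : ∀ t : I, 1 + ‖X t‖ ≤ R) {g : I → ℝ} (hg : Continuous g) (hG : ∀ t, |g t| ≤ 1) :
    Tendsto (fun n => ∫ t, g t • ∫ θ, v (X t) θ ∂κs n t) atTop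
      (𝓝 (∫ t, g t • ∫ θ, v (X t) θ ∂κ t)) := by
  refine tendsto_euclideanSpace fun i => ?_
  have e : ∀ {κ : Kernel I (E m)} (hκ : IsControl κ) (_ : HasEnergyLe κ K),
      (∫ t, g t • ∫ θ, v (X t) θ ∂κ t) i
        = ∫ q : I × E m, g q.1 * v (X q.1) q.2 i ∂(hκ.joint : Measure (I × E m)) := by
    intro κ hκ hK
    rw [← hκ.integral_joint_velocity hv hK0 hK hXc hX hg hG]
    exact ((EuclideanSpace.proj i : E d →L[ℝ] ℝ).integral_comp_comm
      (hκ.integrable_joint_velocity hv hK0 hK hXc hX hg hG)).symm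
  simp only [e hκ hK, e (hκs _) (hKs _)]
  have hw := hκ.integral_joint_norm_sq_le hK0 hK
  have hws := fun n => (hκs n).integral_joint_norm_sq_le hK0 (hKs n)
  have hR : 0 ≤ R := le_trans (by positivity) (hX 0)
  have hCR : 0 ≤ C * R := mul_nonneg hv.pos.le hR
  refine tendsto_integral_of_growth hlim (w := fun q => ‖q.2‖ ^ 2) (K := K)
    (fun _ => sq_nonneg _) hw.1 hw.2 (fun n => (hws n).1) (fun n => (hws n).2) ?_ fun δ hδ => ?_
  · have h1 : Continuous fun q : I × E m => v (X q.1) q.2 :=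
      hv.continuous.comp ((hXc.comp (continuous_subtype_val.comp continuous_fst)).prodMk
        continuous_snd)
    have h2 : Continuous fun q : I × E m => v (X q.1) q.2 i :=
      (EuclideanSpace.proj i : E d →L[ℝ] ℝ).continuous.comp h1
    exact (hg.comp continuous_fst).mul h2
  · obtain ⟨M, hM0, hM⟩ := exists_rpow_le (δ := δ / (C * R + 1)) hv.exponent (by positivity)
    refine ⟨C * R * M, fun q => ?_⟩
    have h1 : |v (X q.1) q.2 i| ≤ ‖v (X q.1) q.2‖ := PiLp.norm_apply_le (v (X q.1) q.2) i
    have h2 := hM ‖q.2‖ (norm_nonneg _)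
    have h3 : C * R * (δ / (C * R + 1)) ≤ δ := by
      rw [mul_div_assoc', div_le_iff₀ (by positivity)]
      nlinarith
    have h4 : 0 ≤ ‖q.2‖ ^ p := by positivity
    calc |g q.1 * v (X q.1) q.2 i| ≤ 1 * (C * ‖q.2‖ ^ p * (1 + ‖X q.1‖)) := by
          rw [abs_mul]
          exact mul_le_mul (hG _) (h1.trans (hv.bound _ _)) (abs_nonneg _) zero_le_one
      _ ≤ C * ‖q.2‖ ^ p * R := by
          rw [one_mul]
          exact mul_le_mul_of_nonneg_left (hX _) (mul_nonneg hv.pos.le h4)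
      _ = C * R * ‖q.2‖ ^ p := by ring
      _ ≤ C * R * (δ / (C * R + 1) * ‖q.2‖ ^ 2 + M) := mul_le_mul_of_nonneg_left h2 hCR
      _ = C * R * (δ / (C * R + 1)) * ‖q.2‖ ^ 2 + C * R * M := by ring
      _ ≤ δ * ‖q.2‖ ^ 2 + C * R * M := by gcongr

-- The order of choice matters: first `δ` to make the energy term less than `ε / 2`, then `η`
-- depending on the resulting `M`.
omit hκs hK hKs hlim hK0 in
theorem exists_growth_bound (hR : 0 ≤ R) (K : ℝ) (hK0 : 0 ≤ K) {ε : ℝ} (hε : 0 < ε) :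
    ∃ δ M η : ℝ, 0 ≤ δ ∧ 0 < η ∧ (∀ a : ℝ, 0 ≤ a → a ^ p ≤ δ * a ^ 2 + M) ∧
      ∀ s ≤ η, C * R * (2 * δ * K + M * s) < ε := by
  have hCR : 0 ≤ C * R := mul_nonneg hv.pos.le hR
  set D := C * R * (2 * K) + 1 with hD
  have hD0 : 0 < D := by positivity
  obtain ⟨M, hM0, hM⟩ := exists_rpow_le (δ := ε / 2 / D) hv.exponent (by positivity)
  have hD1 : 0 < C * R * M + 1 := by positivity
  refine ⟨ε / 2 / D, M, ε / 2 / (C * R * M + 1), by positivity, by positivity, hM, fun s hs => ?_⟩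
  have h1 : (ε / 2 / D) * D = ε / 2 := div_mul_cancel₀ _ hD0.ne'
  have h2 : (ε / 2 / (C * R * M + 1)) * (C * R * M + 1) = ε / 2 := div_mul_cancel₀ _ hD1.ne'
  have h3 : C * R * M * s ≤ C * R * M * (ε / 2 / (C * R * M + 1)) :=
    mul_le_mul_of_nonneg_left hs (by positivity)
  have h4 : 0 < ε / 2 / D := by positivity
  have h5 : 0 < ε / 2 / (C * R * M + 1) := by positivity
  have h6 : C * R * (2 * (ε / 2 / D) * K + M * s)
      = (ε / 2 / D) * (D - 1) + C * R * M * s := by rw [hD]; ring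
  rw [h6]
  nlinarith

/-- The indicator is approximated in `L¹` by a continuous function bounded by 1. The error is
uniform over all controls of energy at most `K`, by `norm_integral_smul_sub_le`. -/
theorem tendsto_integral_indicator_smul {X : ℝ → E d} (hXc : Continuous X)
    (hX : ∀ t : I, 1 + ‖X t‖ ≤ R) {s : Set I} (hs : IsClosed s) :
    Tendsto (fun n => ∫ t, s.indicator (fun _ => (1 : ℝ)) t • ∫ θ, v (X t) θ ∂κs n t) atTop
      (𝓝 (∫ t, s.indicator (fun _ => (1 : ℝ)) t • ∫ θ, v (X t) θ ∂κ t)) := by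
  have hR : 0 ≤ R := le_trans (by positivity) (hX 0)
  refine Metric.tendsto_atTop.2 fun ε hε => ?_
  obtain ⟨δ, M, η, hδ0, hη, hδ, hsmall⟩ := exists_growth_bound hv hR K hK0 (ε := ε / 3)
    (by positivity)
  obtain ⟨g, hg, hgs, hg1, -, hgL⟩ := exists_continuous_eLpNorm_sub_le_of_closed
    (μ := (volume : Measure I)) (p := 1) (by norm_num) hs isOpen_univ (subset_univ s)
    (measure_ne_top _ _) (1 : ℝ) (ε := ENNReal.ofReal η) (by simpa using hη)
  have hg1' : ∀ t, |g t| ≤ 1 := fun t => by simpa using hg1 t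
  have hsm : Measurable (s.indicator fun _ => (1 : ℝ)) :=
    measurable_const.indicator hs.measurableSet
  have hs1 : ∀ t, |s.indicator (fun _ => (1 : ℝ)) t| ≤ 1 := fun t => by
    by_cases h : t ∈ s <;> simp [h]
  have hint : ∫ t, |g t - s.indicator (fun _ => (1 : ℝ)) t| ≤ η := by
    rw [eLpNorm_one_eq_lintegral_enorm] at hgs
    simp only [← Real.norm_eq_abs]
    rw [integral_norm_eq_lintegral_enorm (f := fun t => g t - s.indicator (fun _ => (1 : ℝ)) t)
      (hg.measurable.sub hsm).aestronglyMeasurable]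
    exact ENNReal.toReal_le_of_le_ofReal hη.le hgs
  have est : ∀ {κ : Kernel I (E m)} (_ : IsControl κ) (_ : HasEnergyLe κ K),
      ‖(∫ t, g t • ∫ θ, v (X t) θ ∂κ t)
        - ∫ t, s.indicator (fun _ => (1 : ℝ)) t • ∫ θ, v (X t) θ ∂κ t‖ < ε / 3 :=
    fun hκ hK => (hκ.norm_integral_smul_sub_le hv hK0 hK hXc hX hδ0 hδ hg.measurable hsm hg1'
      hs1).trans_lt (hsmall _ hint)
  obtain ⟨N, hN⟩ := Metric.tendsto_atTop.1 (tendsto_integral_continuous_smul hv hκ hκs hK0 hK hKs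
    hlim hXc hX hg hg1') (ε / 3) (by positivity)
  refine ⟨N, fun n hn => ?_⟩
  have h1 := est (hκs n) (hKs n)
  have h2 := est hκ hK
  have h3 := hN n hn
  rw [← dist_eq_norm] at h1 h2
  rw [dist_comm] at h1
  refine (dist_triangle4 _ _ _ _).trans_lt (add_lt_add (add_lt_add h1 h3) h2) |>.trans_le ?_
  linarith

/-- Pointwise convergence in `r` becomes uniform on the compact interval because the functions are
equicontinuous, again by uniform integrability. -/
theorem tendstoUniformly_integral_indicator_smul {X : ℝ → E d} (hXc : Continuous X)
    (hX : ∀ t : I, 1 + ‖X t‖ ≤ R) :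
    TendstoUniformly
      (fun n r => ∫ t, (Iic r).indicator (fun _ => (1 : ℝ)) t • ∫ θ, v (X t) θ ∂κs n t)
      (fun r => ∫ t, (Iic r).indicator (fun _ => (1 : ℝ)) t • ∫ θ, v (X t) θ ∂κ t) atTop := by
  have hR : 0 ≤ R := le_trans (by positivity) (hX 0)
  have heq : Equicontinuous
      (fun n (r : I) => ∫ t, (Iic r).indicator (fun _ => (1 : ℝ)) t • ∫ θ, v (X t) θ ∂κs n t) := by
    refine UniformEquicontinuous.equicontinuous (Metric.uniformEquicontinuous_iff.2 fun ε hε => ?_)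
    obtain ⟨δ, M, η, hδ0, hη, hδ, hsmall⟩ := exists_growth_bound hv hR K hK0 hε
    have hsm : ∀ r : I, Measurable ((Iic r).indicator fun _ => (1 : ℝ)) := fun r =>
      measurable_const.indicator measurableSet_Iic
    have hs1 : ∀ r t : I, |(Iic r).indicator (fun _ => (1 : ℝ)) t| ≤ 1 := fun r t => by
      by_cases h : t ∈ Iic r
      · rw [indicator_of_mem h]; simp
      · rw [indicator_of_notMem h]; simp
    refine ⟨η, hη, fun r r' hrr n => ?_⟩
    rw [dist_eq_norm]
    refine ((hκs n).norm_integral_smul_sub_le hv hK0 (hKs n) hXc hX hδ0 hδ (hsm r) (hsm r') (hs1 r)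
      (hs1 r')).trans_lt (hsmall _ (le_trans ?_ hrr.le))
    wlog hle : r ≤ r' generalizing r r'
    · rw [dist_comm]
      simp only [abs_sub_comm ((Iic r).indicator (fun _ => (1 : ℝ)) _)]
      exact this r' r (by rwa [dist_comm]) (le_of_not_ge hle)
    -- The indicators differ exactly on `Ioc r r'`, whose measure is `dist r r'`.
    have e : ∀ t, |(Iic r).indicator (fun _ => (1 : ℝ)) t - (Iic r').indicator (fun _ => (1 : ℝ)) t|
        = (Ioc r r').indicator (fun _ => (1 : ℝ)) t := fun t => by
      by_cases h1 : t ≤ r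
      · simp [indicator, h1, h1.trans hle, not_lt.2 h1]
      · by_cases h2 : t ≤ r' <;> simp [indicator, h1, h2, not_le.1 h1]
    simp only [e]
    rw [integral_indicator_const _ measurableSet_Ioc]
    have h0 : (0 : ℝ) ≤ r' - r := sub_nonneg.2 (Subtype.coe_le_coe.2 hle)
    rw [Measure.real, unitInterval.volume_Ioc, ENNReal.toReal_ofReal h0, Subtype.dist_eq,
      Real.dist_eq, abs_sub_comm, abs_of_nonneg h0, smul_eq_mul, mul_one]
  refine UniformFun.tendsto_iff_tendstoUniformly.1
    ((heq.tendsto_uniformFun_iff_pi atTop _).2 (tendsto_pi_nhds.2 fun r => ?_))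
  exact tendsto_integral_indicator_smul hv hκ hκs hK0 hK hKs hlim hXc hX isClosed_Iic

omit hκs hK hKs hlim hK0 hv in
theorem integral_controlField_eq (κ : Kernel I (E m)) (X : ℝ → E d) (r : I) :
    ∫ q in (0)..(r : ℝ), controlField v κ q (X q)
      = ∫ t, (Iic r).indicator (fun _ => (1 : ℝ)) t • ∫ θ, v (X t) θ ∂κ t := by
  rw [← intervalIntegral.integral_indicator (a₃ := 1) r.2, ← integral_unitInterval]
  refine integral_congr_ae (Eventually.of_forall fun t => ?_)
  simp only
  by_cases h : t ≤ r
  · rw [indicator_of_mem (show (t : ℝ) ∈ {x | x ≤ (r : ℝ)} from h),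
      indicator_of_mem (show t ∈ Iic r from h), one_smul,
      controlField_coe]
  · rw [indicator_of_notMem (show (t : ℝ) ∉ {x | x ≤ (r : ℝ)} from h),
      indicator_of_notMem (show t ∉ Iic r from h), zero_smul]

/-- The flow at the final time depends continuously on the control. -/
theorem tendsto_flow (x : E d) :
    Tendsto (fun n => ((hκs n).isField hv).flow 0 x 1) atTop (𝓝 ((hκ.isField hv).flow 0 x 1)) := by
  have h := hκ.isField hv
  set X := h.flow 0 x with hXdef
  have hXc : Continuous X := h.continuous_flow 0 x
  set R := flowConst (controlLip C p κ) * (1 + ‖x‖)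
  have hX : ∀ t : I, 1 + ‖X t‖ ≤ R := fun t => h.growth_flow 0 t x
  set Q := 2 * Real.exp (2 * (C * (1 + K))) with hQ
  have hQ0 : 0 < Q := by positivity
  have hu := tendstoUniformly_integral_indicator_smul hv hκ hκs hK0 hK hKs hlim hXc hX
  refine Metric.tendsto_atTop.2 fun ε hε => ?_
  obtain ⟨N, hN⟩ := eventually_atTop.1 (Metric.tendstoUniformly_iff.1 hu (ε / (2 * Q))
    (by positivity))
  refine ⟨N, fun n hn => ?_⟩
  have hn' := (hκs n).isField hv
  rw [dist_eq_norm]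
  have key : ‖hn'.flow 0 x 1 - X 1‖ ≤ flowConst (controlLip C p (κs n)) * (ε / (2 * Q)) := by
    -- The defect is taken along the fixed limit curve `X`. The varying fields contribute only
    -- `flowConst`, which the energy bounds by `Q` for all `n`.
    refine hn'.dist_isCurve_le_of_defect h (hn'.isCurve_flow 0 x) (h.isCurve_flow 0 x) fun r hr => ?_
    rw [uIcc_of_le zero_le_one] at hr
    rw [intervalIntegral.integral_sub (hn'.intervalIntegrable_comp hXc 0 r)
      (h.intervalIntegrable_comp hXc 0 r), integral_controlField_eq (κs n) X ⟨r, hr⟩,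
      integral_controlField_eq κ X ⟨r, hr⟩, ← dist_eq_norm, dist_comm]
    exact (hN n hn ⟨r, hr⟩).le
  refine key.trans_lt ?_
  calc flowConst (controlLip C p (κs n)) * (ε / (2 * Q)) ≤ Q * (ε / (2 * Q)) :=
        mul_le_mul_of_nonneg_right ((hκs n).flowConst_controlLip_le hv hK0 (hKs n)) (by positivity)
    _ = ε / 2 := by field_simp
    _ < ε := by linarith

end

end MeanFieldNet

namespace MeanFieldNet

open Filter Topology ProbabilityTheory Caratheodory

/-! ### Existence of a minimizer -/

theorem _root_.ENNReal.liminf_add_liminf_le (f g : ℕ → ℝ≥0∞) :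
    liminf f atTop + liminf g atTop ≤ liminf (fun n => f n + g n) atTop := by
  simp only [liminf_eq_iSup_iInf_of_nat]
  rw [ENNReal.iSup_add_iSup_of_monotone]
  · exact iSup_mono fun n => le_iInf₂ fun i hi => add_le_add (iInf₂_le i hi) (iInf₂_le i hi)
  · exact fun a b hab => le_iInf₂ fun i hi => iInf₂_le i (hab.trans hi)
  · exact fun a b hab => le_iInf₂ fun i hi => iInf₂_le i (hab.trans hi)

variable {d m : ℕ} {Y : Set (E d)} {v : E d → E m → E d} {C p lam A B : ℝ}
  {μ₀ : ProbabilityMeasure (E d × Y)} {l : E d × Y → ℝ≥0}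

/-- Fatou's lemma, with lower semicontinuity of `l` applied along the convergent flows at each fixed
initial point. -/
theorem lintegral_terminal_le_liminf {κ : Kernel I (E m)} {κs : ℕ → Kernel I (E m)} {K : ℝ}
    (hv : IsVelocity v C p) (hκ : IsControl κ) (hκs : ∀ n, IsControl (κs n)) (hK0 : 0 ≤ K)
    (hK : HasEnergyLe κ K) (hKs : ∀ n, HasEnergyLe (κs n) K)
    (hlim : Tendsto (fun n => (hκs n).joint) atTop (𝓝 hκ.joint)) (hl : LowerSemicontinuous l) :
    ∫⁻ z, (l ((hκ.isField hv).flow 0 z.1 1, z.2) : ℝ≥0∞) ∂(μ₀ : Measure (E d × Y))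
      ≤ liminf (fun n => ∫⁻ z, (l (((hκs n).isField hv).flow 0 z.1 1, z.2) : ℝ≥0∞)
        ∂(μ₀ : Measure (E d × Y))) atTop := by
  refine le_trans (lintegral_mono fun z => ?_) (lintegral_liminf_le fun n => ?_)
  · have ht : Tendsto (fun n => (((hκs n).isField hv).flow 0 z.1 1, z.2)) atTop
        (𝓝 ((hκ.isField hv).flow 0 z.1 1, z.2)) :=
      (tendsto_flow hv hκ hκs hK0 hK hKs hlim z.1).prodMk_nhds tendsto_const_nhds
    refine le_of_forall_lt fun c hc => ?_
    obtain ⟨c', hcc, hc'⟩ := exists_between hc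
    refine hcc.trans_le (le_liminf_of_le (by isBoundedDefault) ?_)
    lift c' to ℝ≥0 using (hc'.trans ENNReal.coe_lt_top).ne
    filter_upwards [ht.eventually (hl _ c' (ENNReal.coe_lt_coe.1 hc'))] with n hn
    exact ENNReal.coe_le_coe.2 hn.le
  · exact (hl.measurable.comp (measurable_flowMap ((hκs n).isField hv) 1)).coe_nnreal_ennreal

theorem exists_forall_preJ_le (hv : IsVelocity v C p) (hY : MeasurableSet Y)
    (hμ₀ : IsCompact (μ₀ : Measure (E d × Y)).support) (hlam : 0 < lam)
    (hl : LowerSemicontinuous l) (hB : 0 ≤ B)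
    (hgrowth : ∀ x y, (l (x, y) : ℝ) ≤ A + B * ‖x‖ ^ 2) :
    ∃ u : PreL2P2 m, ∀ w : PreL2P2 m, preJ lam v l μ₀ u ≤ preJ lam v l μ₀ w := by
  have hlm := hl.measurable
  obtain ⟨u₀⟩ : Nonempty (PreL2P2 m) := by
    obtain ⟨η⟩ := (inferInstance : Nonempty (L2P2 m))
    exact ⟨η.out⟩
  set j := ⨅ w : PreL2P2 m, preJ lam v l μ₀ w with hj
  have hjt : j ≠ ⊤ := ((iInf_le _ u₀).trans_lt (preJ_lt_top hv hY hμ₀ lam hlm hB hgrowth u₀)).ne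
  have hex : ∀ n : ℕ, ∃ w : PreL2P2 m, preJ lam v l μ₀ w < j + ((n : ℝ≥0∞) + 1)⁻¹ := fun n =>
    iInf_lt_iff.1 (ENNReal.lt_add_right hjt (by simp))
  choose w hw using hex
  choose κ hκ hae using fun n => (w n).exists_isControl
  have hJ : ∀ n, preJ lam v l μ₀ (w n) = _ := fun n =>
    preJ_eq hv (hκ n) (hae n) hY hμ₀ lam hlm
  set c := ENNReal.ofReal (lam / 2) with hc
  have hc0 : c ≠ 0 := by simpa [hc] using hlam
  have hct : c ≠ ⊤ := ENNReal.ofReal_ne_top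
  -- The terminal cost is nonnegative and the minimizing sequence stays below `j + 1`, so `c` times
  -- the energy is at most `j + 1`; dividing by `c` requires `λ > 0`.
  set K := ((j + 1) / c).toReal with hK
  have hKt : (j + 1) / c ≠ ⊤ := ENNReal.div_ne_top (by simpa using hjt) hc0
  have hen : ∀ n, HasEnergyLe (κ n) K := fun n => by
    rw [HasEnergyLe, hK, ENNReal.ofReal_toReal hKt,
      ENNReal.le_div_iff_mul_le (Or.inl hc0) (Or.inl hct), mul_comm]
    refine le_trans ?_ ((hw n).le.trans (add_le_add_right ?_ j))
    · rw [hJ n]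
      exact le_add_self
    · rw [ENNReal.inv_le_one]
      exact le_add_self
  obtain ⟨κ', hκ', φ, hφ, hlim⟩ := exists_subseq_tendsto_joint hκ ENNReal.ofReal_ne_top hen
  -- The limit is so far only a kernel; here it becomes an admissible competitor.
  obtain ⟨u, hu⟩ := hκ'.exists_preL2P2
  have hmom : ∫⁻ t, ∫⁻ θ, ‖θ‖ₑ ^ 2 ∂κ' t
      ≤ liminf (fun n => ∫⁻ t, ∫⁻ θ, ‖θ‖ₑ ^ 2 ∂κ (φ n) t) atTop := by
    have := lintegral_enorm_sq_le_liminf hlim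
    simpa only [IsControl.lintegral_joint] using this
  have hen' : HasEnergyLe κ' K := by
    refine hmom.trans (liminf_le_of_le (by isBoundedDefault) fun b hb => ?_)
    obtain ⟨n, hn⟩ := hb.exists
    exact hn.trans (hen _)
  have hter := lintegral_terminal_le_liminf (μ₀ := μ₀) hv hκ' (fun n => hκ (φ n))
    ENNReal.toReal_nonneg hen' (fun n => hen (φ n)) hlim hl
  have hmin : preJ lam v l μ₀ u ≤ j := by
    rw [preJ_eq hv hκ' (Eventually.of_forall fun t => (hu t).symm) hY hμ₀ lam hlm]
    have hmul : c * ∫⁻ t, ∫⁻ θ, ‖θ‖ₑ ^ 2 ∂κ' t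
        ≤ liminf (fun n => c * ∫⁻ t, ∫⁻ θ, ‖θ‖ₑ ^ 2 ∂κ (φ n) t) atTop := by
      rw [ENNReal.liminf_const_mul_of_ne_top hct]
      exact mul_le_mul_right hmom c
    refine (add_le_add hter hmul).trans ((ENNReal.liminf_add_liminf_le _ _).trans ?_)
    simp only [← hJ]
    have hlim0 : Tendsto (fun n => j + ((φ n : ℝ≥0∞) + 1)⁻¹) atTop (𝓝 j) := by
      have h1 : Tendsto (fun n : ℕ => ((n : ℝ≥0∞) + 1)⁻¹) atTop (𝓝 0) := by
        have := (tendsto_add_atTop_iff_nat 1).2 ENNReal.tendsto_inv_nat_nhds_zero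
        simpa using this
      simpa using tendsto_const_nhds.add (h1.comp hφ.tendsto_atTop)
    rw [← hlim0.liminf_eq]
    exact liminf_le_liminf (Eventually.of_forall fun n => (hw (φ n)).le)
  exact ⟨u, fun w => hmin.trans (iInf_le _ w)⟩

end MeanFieldNet

theorem mainTheorem5 (d m : ℕ) (lam : ℝ) (hlam : 0 < lam)
    (Y : Set (MeanFieldNet.E d)) (hY : IsCompact Y)
    (v : MeanFieldNet.E d → MeanFieldNet.E m → MeanFieldNet.E d)
    (hv : Continuous (Function.uncurry v))
    (l : MeanFieldNet.E d × Y → ℝ≥0) (hl : LowerSemicontinuous l)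
    (A B : ℝ) (hA : 0 < A) (hB : 0 < B)
    (hgrowth : ∀ (x : MeanFieldNet.E d) (y : Y), (l (x, y) : ℝ) ≤ A + B * ‖x‖ ^ 2)
    (μ₀ : ProbabilityMeasure (MeanFieldNet.E d × Y))
    (hμ₀ : IsCompact (μ₀ : Measure (MeanFieldNet.E d × Y)).support)
    (C p : ℝ) (hC : 0 < C) (hp : p ∈ Ico (0 : ℝ) 2)
    (hvbound : ∀ x θ, ‖v x θ‖ ≤ C * ‖θ‖ ^ p * (1 + ‖x‖))
    (hvlip : ∀ x₁ x₂ θ, ‖v x₁ θ - v x₂ θ‖ ≤ C * ‖θ‖ ^ p * ‖x₁ - x₂‖) :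
    (∀ u : MeanFieldNet.PreL2P2 m, ∃! μ, MeanFieldNet.IsSolution v μ₀ u μ) ∧
    (∀ η : MeanFieldNet.L2P2 m, MeanFieldNet.J lam v l μ₀ η < ⊤) ∧
    ∃ ηmin : MeanFieldNet.L2P2 m, ∀ η : MeanFieldNet.L2P2 m,
      MeanFieldNet.J lam v l μ₀ ηmin ≤ MeanFieldNet.J lam v l μ₀ η := by
  have hvel : MeanFieldNet.IsVelocity v C p := ⟨hv, hC, hp, hvbound, hvlip⟩
  have hYm : MeasurableSet Y := hY.measurableSet
  refine ⟨MeanFieldNet.existsUnique_isSolution hvel hYm hμ₀, fun η => ?_, ?_⟩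
  · induction η using Quotient.inductionOn with
    | _ u => exact MeanFieldNet.preJ_lt_top hvel hYm hμ₀ lam hl.measurable hB.le hgrowth u
  · obtain ⟨u, hu⟩ := MeanFieldNet.exists_forall_preJ_le hvel hYm hμ₀ hlam hl hB.le hgrowth
    refine ⟨Quotient.mk _ u, fun η => ?_⟩
    induction η using Quotient.inductionOn with
    | _ w => exact hu w
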